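/- Let $n\ge 2$ and $1\le k\le n$ be integers. Write $B_\rho=\{x\in\mathbb R^n:|x|<\rho\}$. For an $n\times n$ matrix $A=(a_{ij})$ let $S_k(A)$ be the sum of the $k\times k$ principal minors of $A$ and $S_k^{ij}(A)=\partial S_k/\partial a_{ij}(A)$. For open $\Omega\subseteq B_1$, $W^{1,k+1}(\Omega,|x|^{1-k})$ is the space of weakly differentiable $u$ with finite norm $$\|u\|_{W^{1,k+1}(\Omega,|x|^{1-k})}=\Big(\int_\Omega|u|^{k+1}\,dx+\int_\Omega|x|^{1-k}|\nabla u|^{k+1}\,dx\Big)^{1/(k+1)}.$$ Let $g:\mathbb R\to\mathbb R$. A *classical solution* of $$S_k(D^2u)=g(u)\quad\text{in }B_1\tag{1}$$ is a function $u\in C^2(B_1)\cap C(\overline{B_1})$ with $u=0$ on $\partial B_1$ and $S_j(D^2u)>0$ in $B_1$ for $1\le j\le k$ that satisfies (1). A *weak solution* of (1) is a function $u\in L^{k+1}(B_1)$ for which $\sum_{i,j}u_iu_jS_k^{ij}(D^2u)\in L^1(B_1)$, $g(u)\in L^1(B_1)$, and $$\int_{B_1}\Big\{\frac1k\sum_{i,j}u_i\eta_jS_k^{ij}(D^2u)+g(u)\eta\Big\}dx=0\quad\text{for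 all }\eta\in C_c^1(B_1).$$ Here the subscripts of $u$ and $\eta$ denote partial derivatives, $\nabla u$ is the weak gradient in $B_1$, and $D^2u$ is the weak Hessian, a locally integrable matrix field on $B_1\setminus\{0\}$. A *solution* is a classical or a weak solution. A solution $u$ is *semistable* if $$\int_{B_1}\Big\{\sum_{i,j}\varphi_i\varphi_jS_k^{ij}(D^2u)+g'(u)\varphi^2\Big\}dx\ge0\quad\text{for all }\varphi\in C_c^1(B_1\setminus\{0\}),$$ where $g'$ is the derivative of $g$, with $g'(t):=0$ at the points $t$ at which $g$ is not differentiable. **Theorem.** For all integers $n\ge2$ and $1\le k\le n$ there is a constant $D_{n,k}$, depending only on $n$ and $k$, with the following property. Let $g:\mathbb R\to\mathbb R$ be nonnegative and locally Lipschitz, and let $u\in W^{1,k+1}(B_1,|x|^{1-k})$ be a radially symmetric semistable solution of (1). Put $C=D_{n,k}\,\|u\|_{W^{1,k+1}(B_1\setminus\overline{B_{1/2}},|x|^{1-k})}$. Then $u$ coincides almost everywhere in $B_1$ with a function $u(r)$ of $r=|x|$ which is continuous on $(0,1]$ and satisfies 1. if $n<2k+8$, then $|u(r)|\le C$ for all $r\in(0,1]$;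 2. if $n=2k+8$, then $|u(r)|\le C(|\log r|+1)$ for all $r\in(0,1]$; 3. if $n>2k+8$, then $|u(r)|\le C\,r^{\delta_{n,k}}$ for all $r\in(0,1]$, where $$\delta_{n,k}=\frac{-(k+1)n+2\sqrt{2(k+1)n-4k}+2k^2+6k}{(k+1)^2}.$$ -/

import Mathlib

open MeasureTheory Metric Set
open scoped ContDiff

noncomputable section

namespace KHessian

/-- Euclidean space `ℝⁿ`. -/
abbrev E (n : ℕ) : Type := EuclideanSpace ℝ (Fin n)

/-- The open unit ball `B₁` of `ℝⁿ`. -/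
abbrev unitBall (n : ℕ) : Set (E n) := ball 0 1

/-- The classical partial derivative `∂φ/∂xᵢ`. -/
def partialDeriv {n : ℕ} (i : Fin n) (φ : E n → ℝ) (x : E n) : ℝ :=
  fderiv ℝ φ x (EuclideanSpace.single i 1)

/-- The classical Hessian matrix `D²u(x)`. -/
def hessian {n : ℕ} (u : E n → ℝ) (x : E n) : Matrix (Fin n) (Fin n) ℝ :=
  fun i j => partialDeriv j (partialDeriv i u) x

/-- `φ ∈ C_c^m(Ω)`, extended by zero to the whole space. -/
def IsTestFunction {n : ℕ} (m : WithTop ℕ∞) (Ω : Set (E n)) (φ : E n → ℝ) : Prop :=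
  ContDiff ℝ m φ ∧ HasCompactSupport φ ∧ tsupport φ ⊆ Ω

/-- `h` is the weak partial derivative `∂f/∂xᵢ` in the open set `Ω`
(both functions being locally integrable in `Ω`). -/
def HasWeakPartialDeriv {n : ℕ} (Ω : Set (E n)) (i : Fin n) (f h : E n → ℝ) : Prop :=
  LocallyIntegrableOn f Ω ∧ LocallyIntegrableOn h Ω ∧
    ∀ φ : E n → ℝ, IsTestFunction ∞ Ω φ →
      ∫ x in Ω, f x * partialDeriv i φ x = -∫ x in Ω, h x * φ x

/-- `G` is the weak gradient of `u` in `Ω`. -/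
def HasWeakGradient {n : ℕ} (Ω : Set (E n)) (u : E n → ℝ) (G : E n → E n) : Prop :=
  ∀ i, HasWeakPartialDeriv Ω i u (fun x => G x i)

/-- `H` is the weak Jacobian matrix of the vector field `G` in `Ω`; if `G = ∇u` then `H = D²u`. -/
def HasWeakJacobian {n : ℕ} (Ω : Set (E n)) (G : E n → E n)
    (H : E n → Matrix (Fin n) (Fin n) ℝ) : Prop :=
  ∀ i j, HasWeakPartialDeriv Ω j (fun x => G x i) (fun x => H x i j)

/-- `u ∈ W^{1,k+1}(Ω, |x|^{1-k})`, where `G` is the weak gradient of `u`: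
`u ∈ L^{k+1}(Ω)` and `∫_Ω |x|^{1-k} |∇u|^{k+1} < ∞`. -/
def MemWeightedSobolev {n : ℕ} (k : ℕ) (Ω : Set (E n)) (u : E n → ℝ) (G : E n → E n) : Prop :=
  HasWeakGradient Ω u G ∧
  MemLp u ((k : ENNReal) + 1) (volume.restrict Ω) ∧
  IntegrableOn (fun x => ‖x‖ ^ (1 - (k : ℝ)) * ‖G x‖ ^ (k + 1)) Ω

/-- The norm `(∫_Ω |u|^{k+1} + ∫_Ω |x|^{1-k} |∇u|^{k+1})^{1/(k+1)}`
of `W^{1,k+1}(Ω, |x|^{1-k})`, where `G = ∇u`. -/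
def weightedSobolevNorm {n : ℕ} (k : ℕ) (Ω : Set (E n)) (u : E n → ℝ) (G : E n → E n) : ℝ :=
  ((∫ x in Ω, |u x| ^ (k + 1)) +
    ∫ x in Ω, ‖x‖ ^ (1 - (k : ℝ)) * ‖G x‖ ^ (k + 1)) ^ (1 / ((k : ℝ) + 1))

/-- `S_k(A)`: the sum of the principal minors of order `k` of `A`. For symmetric `A` this is the
`k`-th elementary symmetric function of the eigenvalues. -/
def Sk {n : ℕ} (k : ℕ) (A : Matrix (Fin n) (Fin n) ℝ) : ℝ :=
  ∑ s ∈ Finset.powersetCard k (Finset.univ : Finset (Fin n)),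
    (A.submatrix (fun a : s => (a : Fin n)) (fun a : s => (a : Fin n))).det

/-- `S_k^{ij}(A) = ∂S_k/∂a_{ij} (A)`. -/
def SkDeriv {n : ℕ} (k : ℕ) (A : Matrix (Fin n) (Fin n) ℝ) (i j : Fin n) : ℝ :=
  deriv (fun t : ℝ => Sk k (A + t • Matrix.single i j (1 : ℝ))) 0

/-- `u` is a classical solution of `S_k(D²u) = g(u)` in `B₁`: `u` belongs to
`C²(B₁) ∩ C(closure B₁)`, is `k`-convex, vanishes on `∂B₁`, and satisfies the equation. -/
structure IsClassicalSolution {n : ℕ} (k : ℕ) (g : ℝ → ℝ) (u : E n → ℝ) : Prop where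
  contDiffOn : ContDiffOn ℝ 2 u (unitBall n)
  continuousOn : ContinuousOn u (closedBall 0 1)
  admissible : ∀ x ∈ unitBall n, ∀ j, 1 ≤ j → j ≤ k → 0 < Sk j (hessian u x)
  boundary : ∀ x ∈ sphere (0 : E n) 1, u x = 0
  equation : ∀ x ∈ unitBall n, Sk k (hessian u x) = g (u x)

/-- `u`, with `G = ∇u` and `H = D²u`, is a weak solution of `S_k(D²u) = g(u)` in `B₁`. -/
structure IsWeakSolution {n : ℕ} (k : ℕ) (g : ℝ → ℝ) (u : E n → ℝ) (G : E n → E n)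
    (H : E n → Matrix (Fin n) (Fin n) ℝ) : Prop where
  memLp : MemLp u ((k : ENNReal) + 1) (volume.restrict (unitBall n))
  energy : IntegrableOn (fun x => ∑ i, ∑ j, G x i * G x j * SkDeriv k (H x) i j) (unitBall n)
  integrable : IntegrableOn (fun x => g (u x)) (unitBall n)
  equation : ∀ η : E n → ℝ, IsTestFunction 1 (unitBall n) η →
    ∫ x in unitBall n, ((1 / (k : ℝ)) *
      (∑ i, ∑ j, G x i * partialDeriv j η x * SkDeriv k (H x) i j) + g (u x) * η x) = 0

/-- `u`, with `G = ∇u` and `H = D²u`, is a (classical or weak) solution of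
`S_k(D²u) = g(u)` in `B₁`. -/
def IsSolution {n : ℕ} (k : ℕ) (g : ℝ → ℝ) (u : E n → ℝ) (G : E n → E n)
    (H : E n → Matrix (Fin n) (Fin n) ℝ) : Prop :=
  IsClassicalSolution k g u ∨ IsWeakSolution k g u G H

/-- The second variation `Q_u(φ) = ∫_{B₁} {∑ φᵢ φⱼ S_k^{ij}(D²u) + g'(u) φ²}`, where `H = D²u`. -/
def secondVariation {n : ℕ} (k : ℕ) (g : ℝ → ℝ) (u : E n → ℝ)
    (H : E n → Matrix (Fin n) (Fin n) ℝ) (φ : E n → ℝ) : ℝ :=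
  ∫ x in unitBall n,
    ((∑ i, ∑ j, partialDeriv i φ x * partialDeriv j φ x * SkDeriv k (H x) i j)
      + deriv g (u x) * φ x ^ 2)

/-- Semistability: `Q_u(φ) ≥ 0` for all `φ ∈ C_c^1(B₁ ∖ {0})`. -/
def IsSemistable {n : ℕ} (k : ℕ) (g : ℝ → ℝ) (u : E n → ℝ)
    (H : E n → Matrix (Fin n) (Fin n) ℝ) : Prop :=
  ∀ φ : E n → ℝ, IsTestFunction 1 (unitBall n \ {0}) φ → 0 ≤ secondVariation k g u H φ

/-- `u` is (almost everywhere in `B₁` equal to) a function of `|x|`. -/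
def IsRadial {n : ℕ} (u : E n → ℝ) : Prop :=
  ∃ w : ℝ → ℝ, ∀ᵐ x ∂(volume.restrict (unitBall n)), u x = w ‖x‖

/-- `v` is the continuous radial profile of `u`, i.e. `v` is the function `r ↦ u(r)` on `(0,1]`. -/
def IsRadialProfile {n : ℕ} (u : E n → ℝ) (v : ℝ → ℝ) : Prop :=
  ContinuousOn v (Ioc 0 1) ∧ ∀ᵐ x ∂(volume.restrict (unitBall n)), u x = v ‖x‖

/-- The exponent `δ_{n,k}`. -/
def delta (n k : ℕ) : ℝ :=
  (-((k : ℝ) + 1) * n + 2 * √(2 * ((k : ℝ) + 1) * n - 4 * k) + 2 * (k : ℝ) ^ 2 + 6 * k)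
    / ((k : ℝ) + 1) ^ 2

end KHessian

end

/-!
The proof reduces the theorem to an ordinary differential inequality for the profile `v(r)` of `u`.

**Reduction to one variable.** Testing the definition of the weak gradient with `κ(|x|) x_i` and
using the uniqueness of weak derivatives, one finds `∇u = q(|x|) x / |x|` and `D²u = (q / r) I +
r⁻¹ (q / r)' x xᵀ`, where `q = v'` is continuous and `q / r` is locally absolutely continuous on
`(0, 1)` (`exists_isRadialJet`). Since `S_k (p I + a y yᵀ)` is explicit, the equation says that the
flux `r ^ n (q / r) ^ k` has derivative proportional to `r ^ (n - 1) g(v)`. As `g ≥ 0`, the flux is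
nondecreasing. Moreover `q ≥ 0`: for a classical solution because `S_1(D²u) > 0`, and for a weak
solution because the flux is nonnegative and, by semistability, so is the coefficient `(q / r) ^ (k
- 1)` of the second variation (`leading_coefficient_nonneg`). These facts are collected in
`IsRadialSolution`.

**Semistability.** The function `q` solves the linearized equation up to lower order terms, so
testing the second variation with `q η` eliminates the derivatives of `q` and of `g`. What remains
is the weighted Hardy inequality `∫ m (η'² + 2b η η' / r - (2n - k - 1) / (k + 1) η² / r²) ≥ 0`,
with `m = r ^ (n - k) q ^ (k + 1)` and `b = (k - 1) / (k + 1)` (`IsRadialSolution.weighted_hardy`).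
For `η = r ^ x` the quadratic form has the sign of `(x + α) (x - β)`, where `β ≥ 1` exactly when `n
≥ 2k`. The choice `η = r / (ρ + r) ^ (1 + α)` therefore makes it negative, strictly so for `r ~ ρ`;
after cutting off near `r = 1` one obtains `∫_ρ^{2ρ} m ≤ C ρ ^ (2 + 2α) ∫_{1/2}^{3/4} m`
(`IsRadialSolution.exists_energy_decay`). The cutoff near the origin, or near the radius below
which `u` is constant, costs nothing in the limit (`IsRadialSolution.exists_small_collar`).

**Conclusion.** The monotone flux turns the decay of the energy `m` into the pointwise bound `q ≤ C
r ^ (δ - 1)` with `δ = δ_{n,k}`; when `n < 2k` the monotonicity of the flux alone gives such a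
bound with the positive exponent `(2k - n) / k`. Integrating from `r` to `1/2`, and estimating `u`
on `(1/2, 1)` by its norm there, yields the three cases, since `δ` is positive, zero or negative
according to whether `n` is less than, equal to or greater than `2k + 8`.
-/

namespace KHessian

/-! ### The elementary symmetric functions of a rank-one perturbation of a scalar matrix -/

theorem det_smul_one_add_smul_vecMulVec {ι : Type*} [Fintype ι] [DecidableEq ι]
    (p a : ℝ) (y : ι → ℝ) :
    (p • (1 : Matrix ι ι ℝ) + a • Matrix.vecMulVec y y).det
      = p ^ Fintype.card ι + a * p ^ (Fintype.card ι - 1) * ∑ i, y i ^ 2 := by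
  -- Both sides are continuous in `p`, so that the matrix determinant lemma for `p ≠ 0` suffices.
  have hc1 : Continuous fun p : ℝ =>
      (p • (1 : Matrix ι ι ℝ) + a • Matrix.vecMulVec y y).det := by fun_prop
  have hc2 : Continuous fun p : ℝ =>
      p ^ Fintype.card ι + a * p ^ (Fintype.card ι - 1) * ∑ i, y i ^ 2 := by fun_prop
  refine congrFun (Continuous.ext_on (dense_compl_singleton (0 : ℝ)) hc1 hc2 ?_) p
  intro p hp
  have hp : p ≠ 0 := hp
  have key : p • (1 : Matrix ι ι ℝ) + a • Matrix.vecMulVec y y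
      = p • (1 + Matrix.replicateCol Unit ((a / p) • y) * Matrix.replicateRow Unit y) := by
    ext i j
    simp only [Matrix.add_apply, Matrix.smul_apply, Matrix.vecMulVec_apply, Matrix.mul_apply,
      Matrix.replicateCol_apply, Matrix.replicateRow_apply, Pi.smul_apply, smul_eq_mul,
      Finset.univ_unique, Finset.sum_const, Finset.card_singleton, one_smul]
    field_simp
  simp only [key, Matrix.det_smul, Matrix.det_one_add_replicateCol_mul_replicateRow]
  rcases Nat.eq_zero_or_pos (Fintype.card ι) with h | h
  · have := Fintype.card_eq_zero_iff.1 h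
    simp [dotProduct]
  · obtain ⟨m, hm⟩ := Nat.exists_eq_succ_of_ne_zero h.ne'
    simp only [hm, dotProduct, Pi.smul_apply, smul_eq_mul, Nat.succ_eq_add_one,
      Nat.add_sub_cancel, pow_succ, Finset.mul_sum, mul_add, mul_one]
    congr 1
    refine Finset.sum_congr rfl fun i _ => ?_
    field_simp

theorem sum_powersetCard_sum {n k : ℕ} (hk : 1 ≤ k) (f : Fin n → ℝ) :
    ∑ s ∈ Finset.powersetCard k (Finset.univ : Finset (Fin n)), ∑ i ∈ s, f i
      = ((n - 1).choose (k - 1) : ℝ) * ∑ i, f i := by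
  have h1 : ∀ s : Finset (Fin n), ∑ i ∈ s, f i = ∑ i, if i ∈ s then f i else 0 := by
    intro s; simp
  rw [Finset.sum_congr rfl fun s _ => h1 s, Finset.sum_comm, Finset.mul_sum]
  refine Finset.sum_congr rfl fun i _ => ?_
  rw [← Finset.sum_filter, Finset.sum_const, nsmul_eq_mul]
  congr 2
  have := Finset.card_filter_powersetCard_subset ({i} : Finset (Fin n)) Finset.univ k
    (by simp) (by simpa using hk)
  simpa using this

/-- The `k`-th elementary symmetric function of `p I + a y yᵀ`. -/
theorem Sk_smul_one_add_smul_vecMulVec {n k : ℕ} (hk : 1 ≤ k) (p a : ℝ) (y : Fin n → ℝ) :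
    Sk k (p • (1 : Matrix (Fin n) (Fin n) ℝ) + a • Matrix.vecMulVec y y)
      = (n.choose k : ℝ) * p ^ k
        + a * p ^ (k - 1) * (((n - 1).choose (k - 1) : ℝ) * ∑ i, y i ^ 2) := by
  have h1 : ∀ s ∈ Finset.powersetCard k (Finset.univ : Finset (Fin n)),
      ((p • (1 : Matrix (Fin n) (Fin n) ℝ) + a • Matrix.vecMulVec y y).submatrix
        (fun a : s => (a : Fin n)) (fun a : s => (a : Fin n))).det
      = p ^ k + a * p ^ (k - 1) * ∑ i ∈ s, y i ^ 2 := by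
    intro s hs
    have hs : s.card = k := by simpa using hs
    have h2 : (p • (1 : Matrix (Fin n) (Fin n) ℝ) + a • Matrix.vecMulVec y y).submatrix
        (fun a : s => (a : Fin n)) (fun a : s => (a : Fin n))
        = p • (1 : Matrix s s ℝ) + a • Matrix.vecMulVec (fun i : s => y i) (fun i : s => y i) := by
      ext i j
      simp only [Matrix.submatrix_apply, Matrix.add_apply, Matrix.smul_apply, Matrix.one_apply,
        Matrix.vecMulVec_apply, Subtype.ext_iff]
    rw [h2, det_smul_one_add_smul_vecMulVec, Fintype.card_coe, hs,
      Finset.sum_coe_sort s (fun i => y i ^ 2)]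
  rw [Sk, Finset.sum_congr rfl h1, Finset.sum_add_distrib, ← Finset.mul_sum,
    sum_powersetCard_sum hk]
  simp

theorem differentiable_Sk {n : ℕ} (k : ℕ) :
    Differentiable ℝ (fun A : Fin n → Fin n → ℝ => Sk k (Matrix.of A)) := by
  unfold Sk
  simp only [Matrix.det_apply, Matrix.submatrix_apply, Matrix.of_apply]
  fun_prop

/-- Contracting `S_k^{ij}` with `yᵢ yⱼ` gives the derivative of `S_k` in the direction `y yᵀ`;
here it is computed at a matrix of the form `p I + a y yᵀ`. -/
theorem sum_mul_SkDeriv {n k : ℕ} (hk : 1 ≤ k) (p a : ℝ) (y : Fin n → ℝ) :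
    ∑ i, ∑ j, y i * y j
        * SkDeriv k (p • (1 : Matrix (Fin n) (Fin n) ℝ) + a • Matrix.vecMulVec y y) i j
      = p ^ (k - 1) * (((n - 1).choose (k - 1) : ℝ) * ∑ i, y i ^ 2) := by
  set A : Fin n → Fin n → ℝ :=
    Matrix.of.symm (p • (1 : Matrix (Fin n) (Fin n) ℝ) + a • Matrix.vecMulVec y y) with hA
  have hA' : p • (1 : Matrix (Fin n) (Fin n) ℝ) + a • Matrix.vecMulVec y y = Matrix.of A := by
    simp [hA]
  rw [hA']
  set f : (Fin n → Fin n → ℝ) → ℝ := fun A => Sk k (Matrix.of A) with hf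
  have hfd : HasFDerivAt f (fderiv ℝ f A) A := (differentiable_Sk k A).hasFDerivAt
  have hline : ∀ B : Fin n → Fin n → ℝ,
      HasDerivAt (fun t : ℝ => Sk k (Matrix.of A + t • Matrix.of B)) (fderiv ℝ f A B) 0 := by
    intro B
    have h1 : HasDerivAt (fun t : ℝ => A + t • B) B 0 := by
      simpa using ((hasDerivAt_id (0 : ℝ)).smul_const B).const_add A
    have h2 : HasFDerivAt f (fderiv ℝ f A) (A + (0 : ℝ) • B) := by
      simpa using hfd
    exact h2.comp_hasDerivAt (0 : ℝ) h1
  set e : Fin n → Fin n → Fin n → Fin n → ℝ :=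
    fun i j => Matrix.of.symm (Matrix.single i j (1 : ℝ)) with he
  have h3 : ∀ i j, SkDeriv k (Matrix.of A) i j = fderiv ℝ f A (e i j) := fun i j =>
    (hline (e i j)).deriv
  have h4 : ∑ i, ∑ j, y i * y j * SkDeriv k (Matrix.of A) i j
      = fderiv ℝ f A (fun i j => y i * y j) := by
    have h5 : (fun i j => y i * y j) = ∑ i, ∑ j, (y i * y j) • e i j := by
      have h := Matrix.matrix_eq_sum_single (Matrix.vecMulVec y y)
      funext a b
      have h' := congrFun (congrFun h a) b
      simp only [Matrix.sum_apply, Matrix.vecMulVec_apply, Matrix.single_apply] at h'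
      have he' : ∀ i j, e i j a b = if i = a ∧ j = b then 1 else 0 := fun i j =>
        Matrix.single_apply ..
      simp only [h', Finset.sum_apply, Pi.smul_apply, smul_eq_mul, he', mul_ite, mul_one, mul_zero]
    rw [h5, map_sum]
    refine Finset.sum_congr rfl fun i _ => ?_
    rw [map_sum]
    refine Finset.sum_congr rfl fun j _ => ?_
    rw [map_smul, h3, smul_eq_mul]
  rw [h4]
  have h6 := hline (fun i j => y i * y j)
  have h7 : (fun t : ℝ => Sk k (Matrix.of A + t • Matrix.of fun i j => y i * y j))
      = fun t => (n.choose k : ℝ) * p ^ k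
        + (a + t) * p ^ (k - 1) * (((n - 1).choose (k - 1) : ℝ) * ∑ i, y i ^ 2) := by
    funext t
    rw [← Sk_smul_one_add_smul_vecMulVec hk, ← hA', add_assoc, add_smul]
    rfl
  rw [h7] at h6
  have h8 : HasDerivAt (fun t : ℝ => (n.choose k : ℝ) * p ^ k
        + (a + t) * p ^ (k - 1) * (((n - 1).choose (k - 1) : ℝ) * ∑ i, y i ^ 2))
      (1 * p ^ (k - 1) * (((n - 1).choose (k - 1) : ℝ) * ∑ i, y i ^ 2)) 0 :=
    ((((hasDerivAt_id (0 : ℝ)).const_add a).mul_const _).mul_const _).const_add _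
  rw [h6.unique h8, one_mul]

/-! ### Polar coordinates -/

/-- The area of the unit sphere of `ℝⁿ`. -/
noncomputable def sphereArea (n : ℕ) : ℝ := n * (volume : Measure (E n)).real (ball 0 1)

theorem sphereArea_pos (n : ℕ) [Nontrivial (E n)] : 0 < sphereArea n := by
  have h1 : 0 < n := by
    have := Module.finrank_pos (R := ℝ) (M := E n)
    simpa using this
  have h2 : 0 < (volume : Measure (E n)).real (ball 0 1) :=
    ENNReal.toReal_pos (measure_ball_pos _ _ one_pos).ne' measure_ball_lt_top.ne
  unfold sphereArea
  positivity

theorem setIntegral_ball_fun_norm {n : ℕ} [Nontrivial (E n)] (f : ℝ → ℝ) :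
    ∫ x in unitBall n, f ‖x‖ = sphereArea n * ∫ r in Ioo (0 : ℝ) 1, r ^ (n - 1) * f r := by
  have h1 : ∫ x in unitBall n, f ‖x‖ = ∫ x : E n, (Iio (1 : ℝ)).indicator f ‖x‖ := by
    rw [← integral_indicator measurableSet_ball]
    refine integral_congr_ae (Filter.Eventually.of_forall fun x => ?_)
    simp [indicator]
  have h2 : ∫ r in Ioo (0 : ℝ) 1, r ^ (n - 1) * f r
      = ∫ r in Ioi (0 : ℝ), r ^ (n - 1) • (Iio (1 : ℝ)).indicator f r := by
    rw [← integral_indicator measurableSet_Ioo, ← integral_indicator measurableSet_Ioi]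
    refine integral_congr_ae (Filter.Eventually.of_forall fun r => ?_)
    by_cases h0 : 0 < r <;> by_cases h1 : r < 1 <;> simp [indicator, h0, h1]
  rw [h1, integral_fun_norm_addHaar, h2, sphereArea]
  simp [mul_assoc]

theorem integrableOn_ball_fun_norm {n : ℕ} [Nontrivial (E n)] {f : ℝ → ℝ} :
    IntegrableOn (fun x : E n => f ‖x‖) (unitBall n) ↔
      IntegrableOn (fun r => r ^ (n - 1) * f r) (Ioo 0 1) := by
  simpa using integrableOn_fun_norm_addHaar (volume : Measure (E n)) (f := f) (r := 1)

theorem ae_ball_of_ae_Ioo {n : ℕ} [Nontrivial (E n)] {P : ℝ → Prop}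
    (h : ∀ᵐ r ∂(volume.restrict (Ioo (0 : ℝ) 1)), P r) :
    ∀ᵐ x ∂(volume.restrict (unitBall n)), P ‖x‖ := by
  set T : Set ℝ := toMeasurable (volume.restrict (Ioo (0 : ℝ) 1)) {r | ¬ P r} with hT
  have hTm : MeasurableSet T := measurableSet_toMeasurable _ _
  have hT0 : volume.restrict (Ioo (0 : ℝ) 1) T = 0 := by
    rw [hT, measure_toMeasurable]; exact h
  have hae : (fun r : ℝ => r ^ (n - 1) * T.indicator (fun _ => (1 : ℝ)) r)
      =ᵐ[volume.restrict (Ioo (0 : ℝ) 1)] 0 := by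
    have : ∀ᵐ r ∂(volume.restrict (Ioo (0 : ℝ) 1)), r ∉ T := measure_eq_zero_iff_ae_notMem.1 hT0
    filter_upwards [this] with r hr
    simp [hr]
  have hint : IntegrableOn (fun x : E n => T.indicator (fun _ => (1 : ℝ)) ‖x‖) (unitBall n) := by
    rw [integrableOn_ball_fun_norm]
    exact (integrable_zero _ _ _).congr hae.symm
  have h0 : ∫ x in unitBall n, T.indicator (fun _ => (1 : ℝ)) ‖x‖ = 0 := by
    rw [setIntegral_ball_fun_norm, integral_congr_ae hae]
    simp
  have h1 := (integral_eq_zero_iff_of_nonneg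
    (fun x => indicator_nonneg (fun _ _ => zero_le_one) _) hint).1 h0
  filter_upwards [h1] with x hx
  by_contra hP
  have : ‖x‖ ∈ T := subset_toMeasurable _ _ hP
  simp [this] at hx

theorem ae_Ioi_of_ae_volumeIoiPow {m : ℕ} {P : ℝ → Prop}
    (h : ∀ᵐ r : Ioi (0 : ℝ) ∂(Measure.volumeIoiPow m), P (r : ℝ)) :
    ∀ᵐ r ∂(volume.restrict (Ioi (0 : ℝ))), P r := by
  rw [Measure.volumeIoiPow, ae_withDensity_iff (by fun_prop)] at h
  have h1 : ∀ᵐ r : Ioi (0 : ℝ) ∂(Measure.comap Subtype.val volume), P (r : ℝ) := by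
    filter_upwards [h] with r hr
    refine hr ?_
    have : (0 : ℝ) < (r : ℝ) ^ m := pow_pos r.2 m
    simpa using this
  have := (ae_restrict_iff_subtype (μ := volume) (measurableSet_Ioi : MeasurableSet (Ioi (0:ℝ)))
    (p := P)).2 h1
  exact this

theorem homeomorphUnitSphereProd_symm_coe {n : ℕ} (z : sphere (0 : E n) 1 × Ioi (0 : ℝ)) :
    (((homeomorphUnitSphereProd (E n)).toMeasurableEquiv.symm z :
      ({(0 : E n)}ᶜ : Set (E n))) : E n) = (z.2 : ℝ) • (z.1 : E n) := by
  change (((homeomorphUnitSphereProd (E n)).symm z : ({(0 : E n)}ᶜ : Set (E n))) : E n) = _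
  simp

theorem norm_homeomorphUnitSphereProd_symm {n : ℕ} (z : sphere (0 : E n) 1 × Ioi (0 : ℝ)) :
    ‖(((homeomorphUnitSphereProd (E n)).toMeasurableEquiv.symm z :
      ({(0 : E n)}ᶜ : Set (E n))) : E n)‖ = (z.2 : ℝ) := by
  have h0 : (0 : ℝ) < z.2 := z.2.2
  rw [homeomorphUnitSphereProd_symm_coe]
  simp [norm_smul, abs_of_pos h0]

theorem ae_Ioo_of_ae_ball {n : ℕ} [Nontrivial (E n)] {P : ℝ → Prop}
    (h : ∀ᵐ x ∂(volume.restrict (unitBall n)), P ‖x‖) :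
    ∀ᵐ r ∂(volume.restrict (Ioo (0 : ℝ) 1)), P r := by
  have h1 : ∀ᵐ x : E n, ‖x‖ < 1 → P ‖x‖ := by
    rw [ae_restrict_iff' measurableSet_ball] at h
    filter_upwards [h] with x hx hx1
    exact hx (by simpa using hx1)
  have h2 : ∀ᵐ x : ({(0 : E n)}ᶜ : Set (E n)) ∂((volume : Measure (E n)).comap Subtype.val),
      ‖(x : E n)‖ < 1 → P ‖(x : E n)‖ := by
    have := (ae_restrict_iff_subtype (μ := (volume : Measure (E n)))
      ((measurableSet_singleton (0 : E n)).compl) (p := fun x => ‖x‖ < 1 → P ‖x‖)).1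
      (ae_restrict_of_ae h1)
    exact this
  have mp := ((volume : Measure (E n)).measurePreserving_homeomorphUnitSphereProd)
  have mp' := MeasurePreserving.symm (homeomorphUnitSphereProd (E n)).toMeasurableEquiv mp
  have h3 : ∀ᵐ z : sphere (0 : E n) 1 × Ioi (0 : ℝ) ∂((volume : Measure (E n)).toSphere.prod
      (Measure.volumeIoiPow (Module.finrank ℝ (E n) - 1))), (z.2 : ℝ) < 1 → P (z.2 : ℝ) := by
    filter_upwards [mp'.quasiMeasurePreserving.ae h2] with z hz
    rwa [norm_homeomorphUnitSphereProd_symm] at hz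
  have h4 := Measure.ae_ae_of_ae_prod h3
  have : (ae ((volume : Measure (E n)).toSphere)).NeBot := by
    rw [ae_neBot]; exact Measure.toSphere_ne_zero _
  obtain ⟨θ, h5⟩ := h4.exists
  have h6 := ae_Ioi_of_ae_volumeIoiPow (P := fun r => r < 1 → P r) h5
  have h7 : ∀ᵐ r ∂(volume.restrict (Ioo (0 : ℝ) 1)), r < 1 → P r :=
    ae_restrict_of_ae_restrict_of_subset Ioo_subset_Ioi_self h6
  filter_upwards [h7, ae_restrict_mem measurableSet_Ioo] with r hr hr1
  exact hr hr1.2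

theorem integral_polar {n : ℕ} [Nontrivial (E n)] {h : E n → ℝ} (hh : Integrable h) :
    IntegrableOn (fun r : ℝ => r ^ (n - 1) *
        ∫ θ, h (r • (θ : E n)) ∂(volume : Measure (E n)).toSphere) (Ioi 0) ∧
      ∫ x, h x = ∫ r in Ioi (0 : ℝ), r ^ (n - 1) *
        ∫ θ, h (r • (θ : E n)) ∂(volume : Measure (E n)).toSphere := by
  have hn : Module.finrank ℝ (E n) = n := by simp
  have mp := ((volume : Measure (E n)).measurePreserving_homeomorphUnitSphereProd)
  rw [hn] at mp
  set σ := (volume : Measure (E n)).toSphere with hσ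
  have mp' := MeasurePreserving.symm (homeomorphUnitSphereProd (E n)).toMeasurableEquiv mp
  have hemb : MeasurableEmbedding (homeomorphUnitSphereProd (E n)).toMeasurableEquiv.symm :=
    MeasurableEquiv.measurableEmbedding _
  have hi : Integrable (fun x : ({(0 : E n)}ᶜ : Set (E n)) => h x)
      ((volume : Measure (E n)).comap Subtype.val) := by
    have := (integrableOn_iff_comap_subtypeVal (μ := (volume : Measure (E n))) (f := h)
      ((measurableSet_singleton (0 : E n)).compl)).1 hh.integrableOn
    exact this
  have hi2 : Integrable (fun z : sphere (0 : E n) 1 × Ioi (0 : ℝ) => h ((z.2 : ℝ) • (z.1 : E n)))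
      (σ.prod (Measure.volumeIoiPow (n - 1))) := by
    have := (mp'.integrable_comp_emb hemb).2 hi
    refine this.congr (Filter.Eventually.of_forall fun z => ?_)
    simp only [Function.comp, homeomorphUnitSphereProd_symm_coe]
  have he : ∫ x, h x = ∫ z : sphere (0 : E n) 1 × Ioi (0 : ℝ), h ((z.2 : ℝ) • (z.1 : E n))
      ∂(σ.prod (Measure.volumeIoiPow (n - 1))) := by
    have h1 := mp'.integral_comp hemb (fun x : ({(0 : E n)}ᶜ : Set (E n)) => h x)
    simp only [homeomorphUnitSphereProd_symm_coe] at h1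
    rw [h1, integral_subtype_comap ((measurableSet_singleton (0 : E n)).compl) (fun x => h x),
      restrict_compl_singleton]
  have hi3 := hi2.integral_prod_right
  have hden : Measurable fun r : Ioi (0 : ℝ) => Real.toNNReal ((r : ℝ) ^ (n - 1)) :=
    (measurable_subtype_coe.pow_const _).real_toNNReal
  constructor
  · rw [integrableOn_iff_comap_subtypeVal measurableSet_Ioi]
    have h2 : Measure.volumeIoiPow (n - 1) = Measure.withDensity
      (Measure.comap Subtype.val volume) fun r =>
        ((Real.toNNReal ((r : ℝ) ^ (n - 1)) : NNReal) : ENNReal) :=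
      rfl
    rw [h2, integrable_withDensity_iff_integrable_smul hden] at hi3
    refine hi3.congr (Filter.Eventually.of_forall fun r => ?_)
    have h0 : (0 : ℝ) ≤ (r : ℝ) ^ (n - 1) := (pow_pos r.2 _).le
    simp [NNReal.smul_def, Real.coe_toNNReal _ h0]
  · rw [he, integral_prod_symm _ hi2]
    have h2 : Measure.volumeIoiPow (n - 1) = Measure.withDensity
      (Measure.comap Subtype.val volume) fun r =>
        ((Real.toNNReal ((r : ℝ) ^ (n - 1)) : NNReal) : ENNReal) :=
      rfl
    rw [h2, integral_withDensity_eq_integral_smul hden,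
      integral_subtype_comap measurableSet_Ioi fun r : ℝ =>
        Real.toNNReal (r ^ (n - 1)) • ∫ θ, h (r • (θ : E n)) ∂σ]
    refine setIntegral_congr_fun measurableSet_Ioi fun r hr => ?_
    have h0 : (0 : ℝ) ≤ (r : ℝ) ^ (n - 1) := (pow_pos hr _).le
    simp [NNReal.smul_def, Real.coe_toNNReal _ h0]

theorem exists_Icc_of_isCompact {K : Set ℝ} (hK : IsCompact K) (hs : K ⊆ Ioo 0 1) :
    ∃ a b : ℝ, 0 < a ∧ a < 1 / 2 ∧ 1 / 2 < b ∧ b < 1 ∧ K ⊆ Icc a b := by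
  rcases K.eq_empty_or_nonempty with rfl | hne
  · exact ⟨1 / 4, 3 / 4, by norm_num, by norm_num, by norm_num, by norm_num, empty_subset _⟩
  · have h1 := hs (hK.sInf_mem hne)
    have h2 := hs (hK.sSup_mem hne)
    refine ⟨min (sInf K) (1 / 4), max (sSup K) (3 / 4), lt_min h1.1 (by norm_num),
      (min_le_right _ _).trans_lt (by norm_num), lt_of_lt_of_le (by norm_num) (le_max_right _ _),
      max_lt h2.2 (by norm_num), fun x hx => ?_⟩
    exact ⟨(min_le_left _ _).trans (csInf_le hK.bddBelow hx),
      (le_csSup hK.bddAbove hx).trans (le_max_left _ _)⟩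

theorem isCompact_annulus {n : ℕ} (a b : ℝ) : IsCompact {x : E n | a ≤ ‖x‖ ∧ ‖x‖ ≤ b} := by
  refine (isCompact_closedBall (0 : E n) b).of_isClosed_subset ?_ fun x hx => by simpa using hx.2
  exact (isClosed_le continuous_const continuous_norm).inter
    (isClosed_le continuous_norm continuous_const)

theorem annulus_subset {n : ℕ} {a b : ℝ} (ha : 0 < a) (hb : b < 1) :
    {x : E n | a ≤ ‖x‖ ∧ ‖x‖ ≤ b} ⊆ unitBall n \ {0} := by
  rintro x ⟨h1, h2⟩
  refine ⟨by simpa using h2.trans_lt hb, ?_⟩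
  rintro rfl
  simp at h1
  linarith

/-- Integration over spheres: the pairing of a locally integrable function `f` with radial test
functions is given by a locally integrable function of the radius. -/
theorem exists_radial_moment {n : ℕ} [Nontrivial (E n)] {f : E n → ℝ}
    (hf : LocallyIntegrableOn f (unitBall n \ {0})) :
    ∃ m : ℝ → ℝ, LocallyIntegrableOn m (Ioo 0 1) ∧
      ∀ κ : ℝ → ℝ, Continuous κ → HasCompactSupport κ → tsupport κ ⊆ Ioo 0 1 →
        ∫ x in unitBall n, f x * κ ‖x‖ = ∫ r in Ioo (0 : ℝ) 1, m r * κ r := by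
  have hpol : ∀ r : ℝ, 0 < r → ∀ θ : sphere (0 : E n) 1, ‖r • (θ : E n)‖ = r := by
    intro r hr θ
    simp [norm_smul, abs_of_pos hr]
  have hint : ∀ a b : ℝ, 0 < a → b < 1 →
      IntegrableOn f {x : E n | a ≤ ‖x‖ ∧ ‖x‖ ≤ b} := fun a b ha hb =>
    hf.integrableOn_compact_subset (annulus_subset ha hb) (isCompact_annulus a b)
  refine ⟨fun r => r ^ (n - 1) * ∫ θ, f (r • (θ : E n)) ∂(volume : Measure (E n)).toSphere, ?_, ?_⟩
  · rw [locallyIntegrableOn_iff isOpen_Ioo.isLocallyClosed]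
    intro K hKs hK
    obtain ⟨a, b, ha, -, -, hb, hKab⟩ := exists_Icc_of_isCompact hK hKs
    refine IntegrableOn.mono_set ?_ hKab
    have h1 : Integrable ({x : E n | a ≤ ‖x‖ ∧ ‖x‖ ≤ b}.indicator f) :=
      (integrable_indicator_iff (isCompact_annulus a b).measurableSet).2 (hint a b ha hb)
    have h2 := (integral_polar h1).1.mono_set
      (fun r hr => ha.trans_le hr.1 : Icc a b ⊆ Ioi 0)
    refine h2.congr_fun (fun r hr => ?_) measurableSet_Icc
    have hr0 : 0 < r := ha.trans_le hr.1
    simp only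
    congr 2
    funext θ
    rw [indicator_of_mem]
    simpa [hpol r hr0 θ] using hr
  · intro κ hκ hκc hκs
    obtain ⟨a, b, ha, -, -, hb, hKab⟩ := exists_Icc_of_isCompact hκc hκs
    have hz : ∀ r, r ∉ Icc a b → κ r = 0 := fun r hr =>
      image_eq_zero_of_notMem_tsupport fun h => hr (hKab h)
    obtain ⟨C, hC⟩ := hκ.bounded_above_of_compact_support hκc
    have h1 : IntegrableOn (fun x : E n => f x * κ ‖x‖) {x : E n | a ≤ ‖x‖ ∧ ‖x‖ ≤ b} := by
      refine (hint a b ha hb).mul_bdd (c := C) ?_ ?_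
      · exact (hκ.comp continuous_norm).aestronglyMeasurable
      · exact Filter.Eventually.of_forall fun x => hC _
    have h2 : Integrable (fun x : E n => f x * κ ‖x‖) := by
      refine (integrableOn_iff_integrable_of_support_subset ?_).1 h1
      intro x hx
      by_contra hx'
      exact hx (by simp [hz ‖x‖ hx'])
    have h3 : ∫ x in unitBall n, f x * κ ‖x‖ = ∫ x, f x * κ ‖x‖ := by
      refine setIntegral_eq_integral_of_forall_compl_eq_zero fun x hx => ?_
      rw [hz, mul_zero]
      intro h
      exact hx (by simpa using h.2.trans_lt hb)
    rw [h3, (integral_polar h2).2, ← integral_indicator measurableSet_Ioi,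
      ← integral_indicator measurableSet_Ioo]
    refine integral_congr_ae (Filter.Eventually.of_forall fun r => ?_)
    by_cases hr0 : 0 < r
    · simp only [indicator, mem_Ioi, hr0, mem_Ioo, true_and, if_true, hpol r hr0,
        integral_mul_const, mul_assoc]
      by_cases hr1 : r < 1
      · simp [hr1]
      · simp [hr1, hz r (fun h => hr1 (h.2.trans_lt hb))]
    · simp [indicator, hr0]

/-! ### Weak derivatives -/

theorem integrable_mul_of_tsupport_subset {X : Type*} [NormedAddCommGroup X] [MeasurableSpace X]
    [BorelSpace X] {μ : Measure X} {Ω : Set X} {f φ : X → ℝ} (hf : LocallyIntegrableOn f Ω μ)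
    (hφ : Continuous φ) (hc : HasCompactSupport φ) (hs : tsupport φ ⊆ Ω) :
    Integrable (fun x => f x * φ x) μ := by
  obtain ⟨C, hC⟩ := hφ.bounded_above_of_compact_support hc
  have h1 : IntegrableOn (fun x => f x * φ x) (tsupport φ) μ :=
    (hf.integrableOn_compact_subset hs hc).mul_continuousOn hφ.continuousOn hc
  refine (integrableOn_iff_integrable_of_support_subset fun x hx => ?_).1 h1
  exact subset_tsupport _ (right_ne_zero_of_mul hx)

theorem setIntegral_mul_of_tsupport_subset {X : Type*} [TopologicalSpace X] [MeasurableSpace X]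
    {μ : Measure X} {Ω : Set X} (f : X → ℝ) {φ : X → ℝ} (hs : tsupport φ ⊆ Ω) :
    ∫ x in Ω, f x * φ x ∂μ = ∫ x, f x * φ x ∂μ :=
  setIntegral_eq_integral_of_forall_compl_eq_zero fun x hx => by
    rw [image_eq_zero_of_notMem_tsupport fun h => hx (hs h), mul_zero]

theorem tsupport_partialDeriv_subset {n : ℕ} (i : Fin n) (φ : E n → ℝ) :
    tsupport (partialDeriv i φ) ⊆ tsupport φ :=
  tsupport_fderiv_apply_subset ℝ _

theorem IsTestFunction.continuous_partialDeriv {n : ℕ} {m : WithTop ℕ∞} (hm : m ≠ 0)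
    {Ω : Set (E n)} {φ : E n → ℝ} (h : IsTestFunction m Ω φ) (i : Fin n) :
    Continuous (partialDeriv i φ) :=
  (h.1.continuous_fderiv hm).clm_apply continuous_const

theorem IsTestFunction.hasCompactSupport_partialDeriv {n : ℕ} {m : WithTop ℕ∞}
    {Ω : Set (E n)} {φ : E n → ℝ} (h : IsTestFunction m Ω φ) (i : Fin n) :
    HasCompactSupport (partialDeriv i φ) :=
  h.2.1.fderiv_apply ℝ _

theorem IsTestFunction.tsupport_partialDeriv {n : ℕ} {m : WithTop ℕ∞}
    {Ω : Set (E n)} {φ : E n → ℝ} (h : IsTestFunction m Ω φ) (i : Fin n) :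
    tsupport (partialDeriv i φ) ⊆ Ω :=
  (tsupport_partialDeriv_subset i φ).trans h.2.2

theorem locallyIntegrableOn_of_continuousOn {n : ℕ} {Ω : Set (E n)} (hΩ : IsOpen Ω) {f : E n → ℝ}
    (hf : ContinuousOn f Ω) : LocallyIntegrableOn f Ω :=
  hf.locallyIntegrableOn hΩ.measurableSet

/-- A classical partial derivative is a weak one. -/
theorem hasWeakPartialDeriv_of_contDiffOn {n : ℕ} {Ω : Set (E n)} (hΩ : IsOpen Ω) {f : E n → ℝ}
    (hf : ContDiffOn ℝ 1 f Ω) (i : Fin n) : HasWeakPartialDeriv Ω i f (partialDeriv i f) := by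
  have hd : ContinuousOn (partialDeriv i f) Ω :=
    (hf.continuousOn_fderiv_of_isOpen hΩ le_rfl).clm_apply continuousOn_const
  have l1 := locallyIntegrableOn_of_continuousOn hΩ hf.continuousOn
  have l2 := locallyIntegrableOn_of_continuousOn hΩ hd
  refine ⟨l1, l2, fun φ hφ => ?_⟩
  rw [setIntegral_mul_of_tsupport_subset f (hφ.tsupport_partialDeriv i),
    setIntegral_mul_of_tsupport_subset _ hφ.2.2]
  have hm : (∞ : WithTop ℕ∞) ≠ 0 := by simp
  refine integral_mul_fderiv_eq_neg_fderiv_mul_of_integrable ?_ ?_ ?_ ?_ ?_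
  · exact integrable_mul_of_tsupport_subset l2 hφ.1.continuous hφ.2.1 hφ.2.2
  · exact integrable_mul_of_tsupport_subset l1 (hφ.continuous_partialDeriv hm i)
      (hφ.hasCompactSupport_partialDeriv i) (hφ.tsupport_partialDeriv i)
  · exact integrable_mul_of_tsupport_subset l1 hφ.1.continuous hφ.2.1 hφ.2.2
  · intro x hx
    exact (hf.differentiableOn one_ne_zero).differentiableAt (hΩ.mem_nhds (hφ.2.2 hx))
  · intro x _
    exact hφ.1.differentiable hm x

theorem HasWeakPartialDeriv.ae_unique {n : ℕ} {Ω : Set (E n)} (hΩ : IsOpen Ω) {i : Fin n}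
    {f f' h h' : E n → ℝ} (hff : f =ᵐ[volume.restrict Ω] f')
    (h1 : HasWeakPartialDeriv Ω i f h) (h2 : HasWeakPartialDeriv Ω i f' h') :
    h =ᵐ[volume.restrict Ω] h' := by
  have key : ∀ᵐ x ∂(volume : Measure (E n)), x ∈ Ω → (h - h') x = 0 := by
    refine hΩ.ae_eq_zero_of_integral_contDiff_smul_eq_zero (h1.2.1.sub h2.2.1)
      fun φ hφ hc hs => ?_
    have hT : IsTestFunction ∞ Ω φ := ⟨hφ, hc, hs⟩
    have e1 := h1.2.2 φ hT
    have e2 := h2.2.2 φ hT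
    have e3 : ∫ x in Ω, f x * partialDeriv i φ x = ∫ x in Ω, f' x * partialDeriv i φ x :=
      integral_congr_ae (hff.mono fun x hx => by simp only [hx])
    have e4 : ∫ x in Ω, h x * φ x = ∫ x in Ω, h' x * φ x := by linarith
    rw [setIntegral_mul_of_tsupport_subset _ hs, setIntegral_mul_of_tsupport_subset _ hs] at e4
    have i1 := integrable_mul_of_tsupport_subset h1.2.1 hφ.continuous hc hs
    have i2 := integrable_mul_of_tsupport_subset h2.2.1 hφ.continuous hc hs
    have e5 : ∀ x, φ x • (h - h') x = h x * φ x - h' x * φ x := fun x => by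
      simp only [Pi.sub_apply, smul_eq_mul]; ring
    simp only [e5]
    rw [integral_sub i1 i2, e4, sub_self]
  rw [Filter.EventuallyEq, ae_restrict_iff' hΩ.measurableSet]
  filter_upwards [key] with x hx hxΩ
  exact sub_eq_zero.1 (hx hxΩ)

theorem HasWeakPartialDeriv.mono {n : ℕ} {Ω Ω' : Set (E n)} (hs : Ω' ⊆ Ω) {i : Fin n}
    {f h : E n → ℝ} (h1 : HasWeakPartialDeriv Ω i f h) : HasWeakPartialDeriv Ω' i f h := by
  refine ⟨h1.1.mono_set hs, h1.2.1.mono_set hs, fun φ hφ => ?_⟩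
  have := h1.2.2 φ ⟨hφ.1, hφ.2.1, hφ.2.2.trans hs⟩
  rwa [setIntegral_mul_of_tsupport_subset _ ((hφ.tsupport_partialDeriv i).trans hs),
    setIntegral_mul_of_tsupport_subset _ (hφ.2.2.trans hs),
    ← setIntegral_mul_of_tsupport_subset _ (hφ.tsupport_partialDeriv i),
    ← setIntegral_mul_of_tsupport_subset _ hφ.2.2] at this

/-! ### Radial functions and their derivatives -/

theorem isOpen_punctured (n : ℕ) : IsOpen (unitBall n \ {0}) :=
  isOpen_ball.sdiff isClosed_singleton

theorem contDiffAt_norm_of_ne {n : ℕ} {x : E n} (hx : x ≠ 0) {m : WithTop ℕ∞} :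
    ContDiffAt ℝ m (fun x : E n => ‖x‖) x :=
  contDiffAt_norm ℝ hx

theorem partialDeriv_norm {n : ℕ} {x : E n} (hx : x ≠ 0) (i : Fin n) :
    partialDeriv i (fun x : E n => ‖x‖) x = x i / ‖x‖ := by
  have h1 : HasFDerivAt (fun x : E n => ‖x‖) (fderiv ℝ (fun x : E n => ‖x‖) x) x :=
    ((contDiffAt_norm_of_ne (m := 1) hx).differentiableAt one_ne_zero).hasFDerivAt
  have h2 := h1.pow 2
  have h3 := (hasStrictFDerivAt_norm_sq x).hasFDerivAt
  have h4 := congrArg (fun L => L (EuclideanSpace.single i (1 : ℝ))) (h2.unique h3)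
  have hn : ‖x‖ ≠ 0 := norm_ne_zero_iff.2 hx
  simp [EuclideanSpace.inner_single_right] at h4
  rw [partialDeriv, eq_div_iff hn]
  linarith

theorem partialDeriv_comp_norm {n : ℕ} {x : E n} (hx : x ≠ 0) (i : Fin n) {f : ℝ → ℝ} {f' : ℝ}
    (hf : HasDerivAt f f' ‖x‖) : partialDeriv i (fun x : E n => f ‖x‖) x = f' * (x i / ‖x‖) := by
  have h1 : HasFDerivAt (fun x : E n => ‖x‖) (fderiv ℝ (fun x : E n => ‖x‖) x) x :=
    ((contDiffAt_norm_of_ne (m := 1) hx).differentiableAt one_ne_zero).hasFDerivAt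
  have h2 := hf.comp_hasFDerivAt x h1
  have h3 : fderiv ℝ (fun x : E n => f ‖x‖) x = f' • fderiv ℝ (fun x : E n => ‖x‖) x := h2.fderiv
  rw [← partialDeriv_norm hx i, partialDeriv, h3]
  rfl

theorem norm_mem_Ioo {n : ℕ} {x : E n} (hx : x ∈ unitBall n \ {0}) : ‖x‖ ∈ Ioo (0 : ℝ) 1 :=
  ⟨norm_pos_iff.2 hx.2, by simpa using hx.1⟩

theorem contDiffOn_comp_norm {n : ℕ} {m : WithTop ℕ∞} {f : ℝ → ℝ}
    (hf : ContDiffOn ℝ m f (Ioo 0 1)) :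
    ContDiffOn ℝ m (fun x : E n => f ‖x‖) (unitBall n \ {0}) :=
  hf.comp (fun _ hx => (contDiffAt_norm_of_ne hx.2).contDiffWithinAt) fun _ hx => norm_mem_Ioo hx

/-- A `C^m` function of the radius, supported in a compact subset of `(0,1)`, is a test function. -/
theorem isTestFunction_comp_norm {n : ℕ} {m : WithTop ℕ∞} {κ : ℝ → ℝ} (hκ : ContDiff ℝ m κ)
    (hc : HasCompactSupport κ) (hs : tsupport κ ⊆ Ioo 0 1) :
    IsTestFunction m (unitBall n \ {0}) (fun x : E n => κ ‖x‖) := by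
  obtain ⟨a, b, ha, -, -, hb, hab⟩ := exists_Icc_of_isCompact hc hs
  have h0 : ∀ r, r ∉ Icc a b → κ r = 0 := fun r hr =>
    image_eq_zero_of_notMem_tsupport fun h => hr (hab h)
  have hts : tsupport (fun x : E n => κ ‖x‖) ⊆ {x : E n | a ≤ ‖x‖ ∧ ‖x‖ ≤ b} := by
    refine closure_minimal (fun x hx => ?_) (isCompact_annulus a b).isClosed
    by_contra h
    exact hx (h0 _ h)
  refine ⟨?_, (isCompact_annulus a b).of_isClosed_subset (isClosed_tsupport _) hts,
    hts.trans (annulus_subset ha hb)⟩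
  rw [contDiff_iff_contDiffAt]
  intro x
  by_cases hx : x = 0
  · have : (fun x : E n => κ ‖x‖) =ᶠ[nhds x] fun _ => 0 := by
      have : ball (0 : E n) a ∈ nhds x := by rw [hx]; exact ball_mem_nhds _ ha
      filter_upwards [this] with y hy
      exact h0 _ fun h => (not_lt.2 h.1) (by simpa using hy)
    exact contDiffAt_const.congr_of_eventuallyEq this
  · exact hκ.contDiffAt.comp x (contDiffAt_norm_of_ne hx)

theorem locallyIntegrableOn_comp_norm {n : ℕ} [Nontrivial (E n)] {m : ℝ → ℝ}
    (hm : LocallyIntegrableOn m (Ioo 0 1)) :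
    LocallyIntegrableOn (fun x : E n => m ‖x‖) (unitBall n \ {0}) := by
  rw [locallyIntegrableOn_iff (isOpen_punctured n).isLocallyClosed]
  intro K hKs hK
  have hK' : IsCompact ((fun x : E n => ‖x‖) '' K) := hK.image continuous_norm
  obtain ⟨a, b, ha, -, -, hb, hab⟩ := exists_Icc_of_isCompact hK'
    (by rintro _ ⟨x, hx, rfl⟩; exact norm_mem_Ioo (hKs hx))
  have hsub : Icc a b ⊆ Ioo (0 : ℝ) 1 := fun r hr => ⟨ha.trans_le hr.1, hr.2.trans_lt hb⟩
  have h1 : IntegrableOn m (Icc a b) := hm.integrableOn_compact_subset hsub isCompact_Icc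
  have h2 : IntegrableOn (fun x : E n => (Icc a b).indicator m ‖x‖) (unitBall n) := by
    rw [integrableOn_ball_fun_norm]
    have h3 : IntegrableOn (fun r => r ^ (n - 1) * m r) (Icc a b) :=
      h1.continuousOn_mul (by fun_prop) isCompact_Icc
    refine (((integrable_indicator_iff measurableSet_Icc).2 h3).integrableOn).congr_fun
      (fun r _ => ?_) measurableSet_Ioo
    by_cases hr : r ∈ Icc a b <;> simp [hr]
  refine (h2.mono_set fun x hx => (hKs hx).1).congr_fun (fun x hx => ?_) hK.measurableSet
  simp [indicator_of_mem (hab ⟨x, hx, rfl⟩)]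

/-! ### Primitives of locally integrable functions on `(0,1)` -/

theorem Icc_subset_unit {a b : ℝ} (ha : 0 < a) (hb : b < 1) : Icc a b ⊆ Ioo (0 : ℝ) 1 :=
  fun _ hr => ⟨ha.trans_le hr.1, hr.2.trans_lt hb⟩

theorem uIcc_subset_unit {a b : ℝ} (ha : a ∈ Ioo (0 : ℝ) 1) (hb : b ∈ Ioo (0 : ℝ) 1) :
    uIcc a b ⊆ Ioo (0 : ℝ) 1 :=
  (ordConnected_Ioo).uIcc_subset ha hb

theorem half_mem_unit : (1 / 2 : ℝ) ∈ Ioo (0 : ℝ) 1 := by norm_num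

theorem intervalIntegrable_of_locallyIntegrableOn {h : ℝ → ℝ}
    (hh : LocallyIntegrableOn h (Ioo 0 1)) {a b : ℝ} (ha : a ∈ Ioo (0 : ℝ) 1)
    (hb : b ∈ Ioo (0 : ℝ) 1) : IntervalIntegrable h volume a b :=
  (hh.integrableOn_compact_subset (uIcc_subset_unit ha hb) isCompact_uIcc).intervalIntegrable

theorem absolutelyContinuousOnInterval_primitive {h : ℝ → ℝ}
    (hh : LocallyIntegrableOn h (Ioo 0 1)) {a b : ℝ} (ha : a ∈ Ioo (0 : ℝ) 1)
    (hb : b ∈ Ioo (0 : ℝ) 1) :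
    AbsolutelyContinuousOnInterval (fun r => ∫ s in (1 / 2 : ℝ)..r, h s) a b := by
  have hm1 : min (1 / 2) (min a b) ∈ Ioo (0 : ℝ) 1 :=
    ⟨lt_min (by norm_num) (lt_min ha.1 hb.1), (min_le_left _ _).trans_lt (by norm_num)⟩
  have hm2 : max (1 / 2) (max a b) ∈ Ioo (0 : ℝ) 1 :=
    ⟨lt_of_lt_of_le (by norm_num) (le_max_left _ _), max_lt (by norm_num) (max_lt ha.2 hb.2)⟩
  have h1 := intervalIntegrable_of_locallyIntegrableOn hh hm1 hm2
  have hle : min (1 / 2) (min a b) ≤ max (1 / 2) (max a b) :=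
    (min_le_left _ _).trans (le_max_left _ _)
  refine (h1.absolutelyContinuousOnInterval_intervalIntegral (c := 1 / 2) ?_).mono ?_
  · rw [uIcc_of_le hle]
    exact ⟨min_le_left _ _, le_max_left _ _⟩
  · rw [uIcc_of_le hle]
    exact Icc_subset_Icc (min_le_right _ _) (le_max_right _ _)

theorem continuousOn_primitive {h : ℝ → ℝ} (hh : LocallyIntegrableOn h (Ioo 0 1)) :
    ContinuousOn (fun r => ∫ s in (1 / 2 : ℝ)..r, h s) (Ioo 0 1) := by
  intro r hr
  have h1 : r / 2 ∈ Ioo (0 : ℝ) 1 := ⟨by linarith [hr.1], by linarith [hr.1, hr.2]⟩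
  have h2 : (r + 1) / 2 ∈ Ioo (0 : ℝ) 1 := ⟨by linarith [hr.1], by linarith [hr.2]⟩
  have h3 := (absolutelyContinuousOnInterval_primitive hh h1 h2).continuousOn
  rw [uIcc_of_le (by linarith [hr.1])] at h3
  exact (h3.continuousAt
    (Icc_mem_nhds (by linarith [hr.1]) (by linarith [hr.2]))).continuousWithinAt

theorem ae_hasDerivAt_primitive {h : ℝ → ℝ} (hh : LocallyIntegrableOn h (Ioo 0 1)) :
    ∀ᵐ r ∂(volume.restrict (Ioo (0 : ℝ) 1)),
      HasDerivAt (fun r => ∫ s in (1 / 2 : ℝ)..r, h s) (h r) r := by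
  rw [ae_restrict_iff' measurableSet_Ioo]
  have hm : ∀ m : ℕ, (0 : ℝ) < 1 / ((m : ℝ) + 3) ∧ 1 / ((m : ℝ) + 3) < 1 / 2 := fun m => by
    have : (0 : ℝ) ≤ m := Nat.cast_nonneg m
    refine ⟨by positivity, ?_⟩
    rw [div_lt_div_iff₀ (by positivity) (by norm_num)]
    linarith
  have h1 : ∀ᵐ r : ℝ, ∀ m : ℕ, r ∈ uIcc (1 / ((m : ℝ) + 3)) (1 - 1 / ((m : ℝ) + 3)) →
      ∀ c ∈ uIcc (1 / ((m : ℝ) + 3)) (1 - 1 / ((m : ℝ) + 3)),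
        HasDerivAt (fun x => ∫ t in c..x, h t) (h r) r := by
    rw [ae_all_iff]
    intro m
    obtain ⟨h1, h2⟩ := hm m
    exact (intervalIntegrable_of_locallyIntegrableOn hh ⟨h1, by linarith⟩
      ⟨by linarith, by linarith⟩).ae_hasDerivAt_integral
  filter_upwards [h1] with r hr hr1
  obtain ⟨m, hm'⟩ := exists_nat_one_div_lt (lt_min hr1.1 (sub_pos.2 hr1.2))
  have h3 : 1 / ((m : ℝ) + 3) ≤ 1 / ((m : ℝ) + 1) :=
    one_div_le_one_div_of_le (by positivity) (by linarith)
  have h4 := lt_min_iff.1 hm'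
  obtain ⟨h5, h6⟩ := hm m
  have h7 := hr m
  rw [uIcc_of_le (by linarith)] at h7
  exact h7 ⟨by linarith [h4.1], by linarith [h4.2]⟩ _ ⟨by linarith, by linarith⟩

/-- A locally integrable function on `(0,1)` with a locally integrable weak derivative is almost
everywhere a primitive of that derivative. -/
theorem exists_eq_primitive_of_weak_deriv {f h : ℝ → ℝ} (hf : LocallyIntegrableOn f (Ioo 0 1))
    (hh : LocallyIntegrableOn h (Ioo 0 1))
    (hw : ∀ ψ : ℝ → ℝ, ContDiff ℝ ∞ ψ → HasCompactSupport ψ → tsupport ψ ⊆ Ioo 0 1 →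
      ∫ r in Ioo (0 : ℝ) 1, f r * deriv ψ r = -∫ r in Ioo (0 : ℝ) 1, h r * ψ r) :
    ∃ c : ℝ, ∀ᵐ r ∂(volume.restrict (Ioo (0 : ℝ) 1)), f r = c + ∫ s in (1 / 2 : ℝ)..r, h s := by
  set I : ℝ → ℝ := fun r => ∫ s in (1 / 2 : ℝ)..r, h s with hI
  have hIc : ContinuousOn I (Ioo 0 1) := continuousOn_primitive hh
  have hIl : LocallyIntegrableOn I (Ioo 0 1) := hIc.locallyIntegrableOn measurableSet_Ioo
  have hder : ∀ᵐ r ∂(volume.restrict (Ioo (0 : ℝ) 1)), HasDerivAt I (h r) r :=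
    ae_hasDerivAt_primitive hh
  -- `I` has the weak derivative `h`.
  have hIw : ∀ ψ : ℝ → ℝ, ContDiff ℝ ∞ ψ → HasCompactSupport ψ → tsupport ψ ⊆ Ioo 0 1 →
      ∫ r in Ioo (0 : ℝ) 1, I r * deriv ψ r = -∫ r in Ioo (0 : ℝ) 1, h r * ψ r := by
    intro ψ hψ hψc hψs
    obtain ⟨a, b, ha, ha2, hb2, hb, hab⟩ := exists_Icc_of_isCompact hψc hψs
    have hz2 : ∀ r, r ∉ Icc a b → ψ r = 0 := fun r hr =>
      image_eq_zero_of_notMem_tsupport fun h => hr (hab h)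
    have hz3 : ∀ r, r ∉ Icc a b → deriv ψ r = 0 := fun r hr =>
      image_eq_zero_of_notMem_tsupport fun h => hr (hab (tsupport_deriv_subset h))
    set a' := a / 2
    set b' := (b + 1) / 2
    have ha' : a' ∈ Ioo (0 : ℝ) 1 := ⟨by simp only [a']; linarith, by simp only [a']; linarith⟩
    have hb' : b' ∈ Ioo (0 : ℝ) 1 := ⟨by simp only [b']; linarith, by simp only [b']; linarith⟩
    have hab' : a' ≤ b' := by simp only [a', b']; linarith
    have e1 : ∀ F : ℝ → ℝ, (∀ r, r ∉ Icc a b → F r = 0) →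
        ∫ r in Ioo (0 : ℝ) 1, F r = ∫ r in a'..b', F r := by
      intro F hF
      rw [intervalIntegral.integral_of_le hab',
        setIntegral_eq_integral_of_forall_compl_eq_zero (s := Ioo (0 : ℝ) 1),
        setIntegral_eq_integral_of_forall_compl_eq_zero (s := Ioc a' b')]
      · intro r hr
        refine hF r fun hr' => hr ?_
        simp only [a', b']
        exact ⟨by linarith [hr'.1], by linarith [hr'.2]⟩
      · intro r hr
        exact hF r fun hr' => hr (Icc_subset_unit ha hb hr')
    rw [e1 _ fun r hr => by rw [hz3 r hr, mul_zero], e1 _ fun r hr => by rw [hz2 r hr, mul_zero]]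
    have hψac : AbsolutelyContinuousOnInterval ψ a' b' :=
      ((hψ.of_le (by simp)).contDiffOn).absolutelyContinuousOnInterval
    rw [(absolutelyContinuousOnInterval_primitive hh ha' hb').integral_mul_deriv_eq_deriv_mul hψac,
      hz2 a' (fun h => by have := h.1; simp only [a'] at this; linarith),
      hz2 b' (fun h => by have := h.2; simp only [b'] at this; linarith)]
    simp only [mul_zero, sub_self, zero_sub, neg_inj]
    rw [intervalIntegral.integral_of_le hab', intervalIntegral.integral_of_le hab']
    refine integral_congr_ae ?_
    have hsub : Ioc a' b' ⊆ Ioo 0 1 := fun r hr => ⟨ha'.1.trans hr.1, hr.2.trans_lt hb'.2⟩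
    filter_upwards [ae_restrict_of_ae_restrict_of_subset hsub hder] with r hr
    rw [hr.deriv]
  -- Hence `f - I` has vanishing weak derivative.
  have hel : LocallyIntegrableOn (f - I) (Ioo 0 1) := hf.sub hIl
  have he : ∀ ψ : ℝ → ℝ, ContDiff ℝ ∞ ψ → HasCompactSupport ψ → tsupport ψ ⊆ Ioo 0 1 →
      ∫ r in Ioo (0 : ℝ) 1, (f - I) r * deriv ψ r = 0 := by
    intro ψ hψ hψc hψs
    have hd : Continuous (deriv ψ) := hψ.continuous_deriv (by simp)
    have hs := (fun _ h => hψs (tsupport_deriv_subset h) : tsupport (deriv ψ) ⊆ Ioo 0 1)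
    have i1 := (integrable_mul_of_tsupport_subset hf hd hψc.deriv hs).integrableOn (s := Ioo 0 1)
    have i2 := (integrable_mul_of_tsupport_subset hIl hd hψc.deriv hs).integrableOn (s := Ioo 0 1)
    simp only [Pi.sub_apply, sub_mul]
    rw [integral_sub i1 i2, hw ψ hψ hψc hψs, hIw ψ hψ hψc hψs, sub_self]
  let B : ContDiffBump (1 / 2 : ℝ) := ⟨1 / 8, 1 / 4, by norm_num, by norm_num⟩
  set ψ₀ : ℝ → ℝ := B.normed volume with hψ₀
  have h0s : ContDiff ℝ ∞ ψ₀ := B.contDiff_normed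
  have h0c : HasCompactSupport ψ₀ := B.hasCompactSupport_normed
  have h0t : tsupport ψ₀ ⊆ Ioo 0 1 := by
    rw [hψ₀, B.tsupport_normed_eq]
    intro r hr
    rw [Real.closedBall_eq_Icc] at hr
    have h1 : B.rOut = 1 / 4 := rfl
    rw [h1] at hr
    exact ⟨by linarith [hr.1], by linarith [hr.2]⟩
  have h0i : ∫ r, ψ₀ r = 1 := B.integral_normed
  set c := ∫ r in Ioo (0 : ℝ) 1, (f - I) r * ψ₀ r with hc
  refine ⟨c, ?_⟩
  have key : ∀ᵐ r ∂(volume : Measure ℝ), r ∈ Ioo (0 : ℝ) 1 → ((f - I) r - c) = 0 := by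
    refine isOpen_Ioo.ae_eq_zero_of_integral_contDiff_smul_eq_zero
      (hel.sub ((continuousOn_const).locallyIntegrableOn measurableSet_Ioo)) fun χ hχ hχc hχs => ?_
    set J := ∫ r, χ r with hJ
    set ψ : ℝ → ℝ := fun r => χ r - J * ψ₀ r with hψ
    have hψs : ContDiff ℝ ∞ ψ := hχ.sub (contDiff_const.mul h0s)
    have hψcont := hψs.continuous
    have hψc : HasCompactSupport ψ := hχc.sub (h0c.mul_left (f := fun _ => J))
    have hψt : tsupport ψ ⊆ Ioo 0 1 := by
      refine (tsupport_sub χ (fun r => J * ψ₀ r)).trans (union_subset hχs ?_)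
      exact (tsupport_mul_subset_right (f := fun _ => J)).trans h0t
    obtain ⟨a, b, ha, ha2, hb2, hb, hab⟩ := exists_Icc_of_isCompact hψc hψt
    have hz : ∀ r, r ∉ Icc a b → ψ r = 0 := fun r hr =>
      image_eq_zero_of_notMem_tsupport fun h => hr (hab h)
    have iχ : Integrable χ := hχ.continuous.integrable_of_hasCompactSupport hχc
    have i0 : Integrable ψ₀ := h0s.continuous.integrable_of_hasCompactSupport h0c
    have hψ0 : ∫ r, ψ r = 0 := by
      rw [hψ, integral_sub iχ (i0.const_mul J), integral_const_mul, h0i, mul_one, sub_self]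
    -- The primitive of `ψ` is a test function, because `ψ` has integral zero.
    set Ψ : ℝ → ℝ := fun r => ∫ s in (0 : ℝ)..r, ψ s with hΨ
    have hΨd : ∀ r, HasDerivAt Ψ (ψ r) r := fun r =>
      intervalIntegral.integral_hasDerivAt_right (hψcont.intervalIntegrable _ _)
        (hψcont.stronglyMeasurableAtFilter _ _) hψcont.continuousAt
    have hΨderiv : deriv Ψ = ψ := funext fun r => (hΨd r).deriv
    have hΨs : ContDiff ℝ ∞ Ψ := by
      rw [contDiff_infty_iff_deriv]
      exact ⟨fun r => (hΨd r).differentiableAt, by rw [hΨderiv]; exact hψs⟩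
    have hΨz : ∀ r, r ∉ Icc a b → Ψ r = 0 := by
      intro r hr
      rw [mem_Icc, not_and_or, not_le, not_le] at hr
      rcases hr with hr | hr
      · refine intervalIntegral.integral_zero_ae (Filter.Eventually.of_forall fun s hs => ?_)
        refine hz s fun hs' => ?_
        rw [mem_uIoc] at hs
        rcases hs with hs | hs <;> linarith [hs'.1, hs.2]
      · have : Ψ r = ∫ s, ψ s := by
          rw [hΨ]
          simp only
          rw [intervalIntegral.integral_of_le (by linarith),
            setIntegral_eq_integral_of_forall_compl_eq_zero]
          intro s hs
          exact hz s fun hs' => hs ⟨by linarith [hs'.1], by linarith [hs'.2]⟩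
        rw [this, hψ0]
    have hΨt : tsupport Ψ ⊆ Icc a b :=
      closure_minimal (fun r hr => by by_contra h; exact hr (hΨz r h)) isClosed_Icc
    have e1 := he Ψ hΨs (isCompact_Icc.of_isClosed_subset (isClosed_tsupport _) hΨt)
      (hΨt.trans (Icc_subset_unit ha hb))
    rw [hΨderiv] at e1
    have i1 := integrable_mul_of_tsupport_subset hel hχ.continuous hχc hχs
    have i2 := integrable_mul_of_tsupport_subset hel h0s.continuous h0c h0t
    have e2 : ∫ r in Ioo (0 : ℝ) 1, (f - I) r * ψ r
        = ∫ r in Ioo (0 : ℝ) 1, (f - I) r * χ r - J * ((f - I) r * ψ₀ r) :=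
      integral_congr_ae (Filter.Eventually.of_forall fun r => by simp only [hψ]; ring)
    rw [e1, integral_sub i1.integrableOn (i2.integrableOn.const_mul J), integral_const_mul, ← hc,
      setIntegral_mul_of_tsupport_subset _ hχs] at e2
    have e3 : ∀ r, χ r • ((f - I) r - c) = (f - I) r * χ r - c * χ r := fun r => by
      simp only [smul_eq_mul]; ring
    have e4 : ∫ r, χ r • ((f - I) r - c) = ∫ r, ((f - I) r * χ r - c * χ r) :=
      integral_congr_ae (Filter.Eventually.of_forall e3)
    change ∫ r, χ r • ((f - I) r - c) = 0
    rw [e4, integral_sub i1 (iχ.const_mul c), integral_const_mul]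
    linarith
  rw [ae_restrict_iff' measurableSet_Ioo]
  filter_upwards [key] with r hr hr1
  have := hr hr1
  simp only [Pi.sub_apply] at this
  linarith

theorem abs_apply_div_norm_le_one {n : ℕ} (x : E n) (i : Fin n) : |x i / ‖x‖| ≤ 1 := by
  rw [abs_div, abs_norm]
  exact div_le_one_of_le₀ (by simpa using PiLp.norm_apply_le x i) (norm_nonneg _)

theorem locallyIntegrableOn_mul_continuousOn {n : ℕ} {f g : E n → ℝ} {Ω : Set (E n)}
    (hΩ : IsOpen Ω) (hf : LocallyIntegrableOn f Ω) (hg : ContinuousOn g Ω) :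
    LocallyIntegrableOn (fun x => f x * g x) Ω :=
  hf.mul_continuousOn hg hΩ.isLocallyClosed

/-- The weak gradient of an absolutely continuous function of the radius. The chain rule is
classical when the derivative is continuous, and both sides depend continuously on the derivative
in `L¹`. -/
theorem hasWeakPartialDeriv_comp_norm {n : ℕ} [Nontrivial (E n)] {p p' : ℝ → ℝ} {c : ℝ}
    (hp' : LocallyIntegrableOn p' (Ioo 0 1))
    (hp : ∀ r ∈ Ioo (0 : ℝ) 1, p r = c + ∫ s in (1 / 2 : ℝ)..r, p' s) (i : Fin n) :
    HasWeakPartialDeriv (unitBall n \ {0}) i (fun x => p ‖x‖)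
      (fun x => p' ‖x‖ * (x i / ‖x‖)) := by
  set Ω := unitBall n \ {0} with hΩ
  have hΩo : IsOpen Ω := isOpen_punctured n
  have hpc : ContinuousOn p (Ioo 0 1) :=
    (continuousOn_const.add (continuousOn_primitive hp')).congr hp
  have hdir : ContinuousOn (fun x : E n => x i / ‖x‖) Ω := by
    refine ContinuousOn.div (by fun_prop) (by fun_prop) fun x hx => ?_
    exact norm_ne_zero_iff.2 hx.2
  have l1 : LocallyIntegrableOn (fun x : E n => p ‖x‖) Ω :=
    locallyIntegrableOn_of_continuousOn hΩo
      (hpc.comp continuous_norm.continuousOn fun x hx => norm_mem_Ioo hx)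
  have l2 : LocallyIntegrableOn (fun x : E n => p' ‖x‖ * (x i / ‖x‖)) Ω :=
    locallyIntegrableOn_mul_continuousOn hΩo (locallyIntegrableOn_comp_norm hp') hdir
  refine ⟨l1, l2, fun φ hφ => ?_⟩
  have hK : IsCompact ((fun x : E n => ‖x‖) '' tsupport φ) := hφ.2.1.isCompact.image continuous_norm
  obtain ⟨a, b, ha, ha2, hb2, hb, hab⟩ := exists_Icc_of_isCompact hK
    (by rintro _ ⟨x, hx, rfl⟩; exact norm_mem_Ioo (hφ.2.2 hx))
  have hn : ∀ x ∈ tsupport φ, ‖x‖ ∈ Icc a b := fun x hx => hab ⟨x, hx, rfl⟩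
  have hm : (∞ : WithTop ℕ∞) ≠ 0 := by simp
  have hdc := hφ.continuous_partialDeriv hm i
  have hdk := hφ.hasCompactSupport_partialDeriv i
  have hdt := hφ.tsupport_partialDeriv i
  obtain ⟨M, hM⟩ := hφ.1.continuous.bounded_above_of_compact_support hφ.2.1
  have hM0 : 0 ≤ M := (norm_nonneg _).trans (hM 0)
  set M₁ := ∫ x, |partialDeriv i φ x| with hM₁
  have hM₁0 : 0 ≤ M₁ := integral_nonneg fun x => abs_nonneg _
  have hω := sphereArea_pos n
  have haI : a ∈ Ioo (0 : ℝ) 1 := ⟨ha, by linarith⟩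
  set T : ℝ := ∫ x in Ω, p ‖x‖ * partialDeriv i φ x
  set S : ℝ := ∫ x in Ω, p' ‖x‖ * (x i / ‖x‖) * φ x
  have key : ∀ ε > 0, |T + S| ≤ (M₁ + M * sphereArea n) * ε := by
    intro ε hε
    have hi : Integrable ((Icc a b).indicator p') :=
      (integrable_indicator_iff measurableSet_Icc).2
        (hp'.integrableOn_compact_subset (Icc_subset_unit ha hb) isCompact_Icc)
    obtain ⟨g, -, hg1, hgc, hgi⟩ := hi.exists_hasCompactSupport_integral_sub_le hε
    set d : ℝ → ℝ := fun r => |(Icc a b).indicator p' r - g r| with hd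
    have hdi : Integrable d := (hi.sub hgi).norm
    have hd1 : ∫ r, d r ≤ ε := hg1
    set P : ℝ → ℝ := fun r => p a + ∫ s in a..r, g s with hP
    have hPd : ∀ r, HasDerivAt P (g r) r := fun r =>
      (intervalIntegral.integral_hasDerivAt_right (hgc.intervalIntegrable _ _)
        (hgc.stronglyMeasurableAtFilter _ _) hgc.continuousAt).const_add _
    have hP1 : ContDiff ℝ 1 P := by
      rw [contDiff_one_iff_deriv]
      refine ⟨fun r => (hPd r).differentiableAt, ?_⟩
      rw [show deriv P = g from funext fun r => (hPd r).deriv]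
      exact hgc
    have hclose : ∀ r ∈ Icc a b, |p r - P r| ≤ ε := by
      intro r hr
      have hrI := Icc_subset_unit ha hb hr
      have j1 := intervalIntegrable_of_locallyIntegrableOn hp' half_mem_unit haI
      have j2 := intervalIntegrable_of_locallyIntegrableOn hp' haI hrI
      have e1 : p r - P r = ∫ s in a..r, (p' s - g s) := by
        rw [intervalIntegral.integral_sub j2 (hgc.intervalIntegrable _ _), hP]
        simp only
        rw [hp r hrI, hp a haI, ← intervalIntegral.integral_add_adjacent_intervals j1 j2]
        ring
      rw [e1, intervalIntegral.integral_of_le hr.1]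
      rw [← Real.norm_eq_abs]
      refine (norm_integral_le_integral_norm _).trans (le_trans ?_ hd1)
      calc ∫ s in Ioc a r, ‖p' s - g s‖ = ∫ s in Ioc a r, d s := by
            refine setIntegral_congr_fun measurableSet_Ioc fun s hs => ?_
            have : s ∈ Icc a b := ⟨hs.1.le, hs.2.trans hr.2⟩
            simp only [hd, indicator_of_mem this, Real.norm_eq_abs]
        _ ≤ ∫ s, d s := setIntegral_le_integral hdi
            (Filter.Eventually.of_forall fun s => abs_nonneg _)
    -- The smooth chain rule for the approximation `P`.
    have hPw := hasWeakPartialDeriv_of_contDiffOn hΩo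
      (contDiffOn_comp_norm (n := n) (hP1.contDiffOn (s := Ioo 0 1))) i
    have e2 : ∫ x in Ω, P ‖x‖ * partialDeriv i φ x
        = -∫ x in Ω, g ‖x‖ * (x i / ‖x‖) * φ x := by
      rw [hPw.2.2 φ hφ]
      congr 1
      refine setIntegral_congr_fun hΩo.measurableSet fun x hx => ?_
      simp only
      rw [partialDeriv_comp_norm hx.2 i (hPd _)]
    have lg : LocallyIntegrableOn (fun x : E n => g ‖x‖ * (x i / ‖x‖)) Ω :=
      locallyIntegrableOn_mul_continuousOn hΩo (locallyIntegrableOn_of_continuousOn hΩo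
        (hgc.comp continuous_norm).continuousOn) hdir
    have i1 := (integrable_mul_of_tsupport_subset l1 hdc hdk hdt).integrableOn (s := Ω)
    have i2 := (integrable_mul_of_tsupport_subset hPw.1 hdc hdk hdt).integrableOn (s := Ω)
    have i3 := (integrable_mul_of_tsupport_subset l2 hφ.1.continuous hφ.2.1 hφ.2.2).integrableOn
      (s := Ω)
    have i4 := (integrable_mul_of_tsupport_subset lg hφ.1.continuous hφ.2.1 hφ.2.2).integrableOn
      (s := Ω)
    have e3 : T + S = (∫ x in Ω, (p ‖x‖ * partialDeriv i φ x - P ‖x‖ * partialDeriv i φ x))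
        + ∫ x in Ω, (p' ‖x‖ * (x i / ‖x‖) * φ x - g ‖x‖ * (x i / ‖x‖) * φ x) := by
      rw [integral_sub i1 i2, integral_sub i3 i4, e2]
      ring
    have b1 : |∫ x in Ω, (p ‖x‖ * partialDeriv i φ x - P ‖x‖ * partialDeriv i φ x)|
        ≤ ε * M₁ := by
      have hI : Integrable (fun x : E n => ε * |partialDeriv i φ x|) :=
        ((hdc.integrable_of_hasCompactSupport hdk).norm).const_mul ε
      rw [← Real.norm_eq_abs]
      refine (norm_integral_le_of_norm_le hI.integrableOn
        (Filter.Eventually.of_forall fun x => ?_)).trans ?_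
      · rw [← sub_mul, norm_mul, Real.norm_eq_abs, Real.norm_eq_abs]
        by_cases hx : x ∈ tsupport φ
        · exact mul_le_mul_of_nonneg_right (hclose _ (hn x hx)) (abs_nonneg _)
        · rw [image_eq_zero_of_notMem_tsupport fun h => hx (tsupport_partialDeriv_subset i φ h)]
          simp
      · rw [hM₁, ← integral_const_mul]
        exact setIntegral_le_integral hI (Filter.Eventually.of_forall fun x => by positivity)
    have b2 : |∫ x in Ω, (p' ‖x‖ * (x i / ‖x‖) * φ x - g ‖x‖ * (x i / ‖x‖) * φ x)|
        ≤ M * (sphereArea n * ε) := by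
      have hr1 : IntegrableOn (fun r => r ^ (n - 1) * d r) (Ioo 0 1) := by
        refine hdi.integrableOn.bdd_mul (c := 1) (by fun_prop) ?_
        filter_upwards [ae_restrict_mem measurableSet_Ioo] with r hr
        rw [Real.norm_eq_abs, abs_of_nonneg (pow_nonneg hr.1.le _)]
        exact pow_le_one₀ hr.1.le hr.2.le
      have hI : IntegrableOn (fun x : E n => M * d ‖x‖) (unitBall n) :=
        (integrableOn_ball_fun_norm.2 hr1).const_mul M
      rw [← Real.norm_eq_abs]
      refine (norm_integral_le_of_norm_le (hI.mono_set sdiff_subset)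
        (Filter.Eventually.of_forall fun x => ?_)).trans ?_
      · by_cases hx : x ∈ tsupport φ
        · have hb1 := abs_apply_div_norm_le_one x i
          have hb2 := hM x
          have e4 : p' ‖x‖ * (x i / ‖x‖) * φ x - g ‖x‖ * (x i / ‖x‖) * φ x
              = (p' ‖x‖ - g ‖x‖) * (x i / ‖x‖) * φ x := by ring
          rw [e4, norm_mul, norm_mul, mul_comm]
          refine mul_le_mul hb2 ?_ (by positivity) hM0
          simp only [hd, indicator_of_mem (hn x hx), Real.norm_eq_abs]
          exact mul_le_of_le_one_right (abs_nonneg _) hb1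
        · rw [image_eq_zero_of_notMem_tsupport hx]
          simp only [mul_zero, sub_self, norm_zero]
          positivity
      · calc ∫ x in Ω, M * d ‖x‖ ≤ ∫ x in unitBall n, M * d ‖x‖ :=
              setIntegral_mono_set hI (Filter.Eventually.of_forall fun x => by positivity)
                (Filter.Eventually.of_forall fun x hx => hx.1)
          _ = M * (sphereArea n * ∫ r in Ioo (0 : ℝ) 1, r ^ (n - 1) * d r) := by
              rw [integral_const_mul, setIntegral_ball_fun_norm]
          _ ≤ M * (sphereArea n * ∫ r in Ioo (0 : ℝ) 1, d r) := by
              refine mul_le_mul_of_nonneg_left (mul_le_mul_of_nonneg_left ?_ hω.le) hM0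
              refine setIntegral_mono_on hr1 hdi.integrableOn measurableSet_Ioo fun r hr => ?_
              exact mul_le_of_le_one_left (abs_nonneg _) (pow_le_one₀ hr.1.le hr.2.le)
          _ ≤ M * (sphereArea n * ε) := by
              gcongr
              exact (setIntegral_le_integral hdi
                (Filter.Eventually.of_forall fun s => abs_nonneg _)).trans hd1
    rw [e3]
    refine (abs_add_le _ _).trans ((add_le_add b1 b2).trans (le_of_eq ?_))
    ring
  have h0 : |T + S| ≤ 0 := by
    refine le_of_forall_pos_le_add fun ε hε => ?_
    have hC : 0 < M₁ + M * sphereArea n + 1 := by positivity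
    have := key (ε / (M₁ + M * sphereArea n + 1)) (by positivity)
    refine this.trans ?_
    rw [zero_add, mul_div_assoc', div_le_iff₀ hC]
    nlinarith
  have h1 := abs_nonpos_iff.1 h0
  change T = -S
  linarith

/-! ### Structure of radial functions with two weak derivatives -/

theorem partialDeriv_mul {n : ℕ} {f g : E n → ℝ} {x : E n} (hf : DifferentiableAt ℝ f x)
    (hg : DifferentiableAt ℝ g x) (i : Fin n) :
    partialDeriv i (fun x => f x * g x) x
      = partialDeriv i f x * g x + f x * partialDeriv i g x := by
  have h : fderiv ℝ (fun x => f x * g x) x = f x • fderiv ℝ g x + g x • fderiv ℝ f x :=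
    (hf.hasFDerivAt.mul hg.hasFDerivAt).fderiv
  rw [partialDeriv, h]
  simp only [add_apply, smul_apply, smul_eq_mul,
    partialDeriv]
  ring

theorem contDiff_coord {n : ℕ} {m : WithTop ℕ∞} (i : Fin n) : ContDiff ℝ m (fun x : E n => x i) :=
  (EuclideanSpace.proj (𝕜 := ℝ) i).contDiff

theorem partialDeriv_coord {n : ℕ} (i j : Fin n) (x : E n) :
    partialDeriv j (fun x : E n => x i) x = if i = j then 1 else 0 := by
  have h : fderiv ℝ (fun x : E n => x i) x = EuclideanSpace.proj (𝕜 := ℝ) i :=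
    (EuclideanSpace.proj (𝕜 := ℝ) i).hasFDerivAt.fderiv
  rw [partialDeriv, h]
  simp

theorem IsTestFunction.mul_right {n : ℕ} {m : WithTop ℕ∞} {Ω : Set (E n)} {φ a : E n → ℝ}
    (h : IsTestFunction m Ω φ) (ha : ContDiff ℝ m a) :
    IsTestFunction m Ω (fun x => φ x * a x) :=
  ⟨h.1.mul ha, h.2.1.mul_right, (tsupport_mul_subset_left).trans h.2.2⟩

/-- The product rule for a weak derivative and a smooth factor. -/
theorem HasWeakPartialDeriv.mul_smooth {n : ℕ} {Ω : Set (E n)} (hΩ : IsOpen Ω) {i : Fin n}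
    {f h a : E n → ℝ} (hw : HasWeakPartialDeriv Ω i f h) (ha : ContDiff ℝ ∞ a) :
    HasWeakPartialDeriv Ω i (fun x => f x * a x)
      (fun x => h x * a x + f x * partialDeriv i a x) := by
  have hm : (∞ : WithTop ℕ∞) ≠ 0 := by simp
  have hda : Continuous (partialDeriv i a) := (ha.continuous_fderiv hm).clm_apply continuous_const
  have l1 : LocallyIntegrableOn (fun x => h x * a x) Ω :=
    locallyIntegrableOn_mul_continuousOn hΩ hw.2.1 ha.continuous.continuousOn
  have l2 : LocallyIntegrableOn (fun x => f x * partialDeriv i a x) Ω :=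
    locallyIntegrableOn_mul_continuousOn hΩ hw.1 hda.continuousOn
  refine ⟨locallyIntegrableOn_mul_continuousOn hΩ hw.1 ha.continuous.continuousOn, l1.add l2,
    fun φ hφ => ?_⟩
  have e1 := hw.2.2 _ (hφ.mul_right ha)
  have i1 := (integrable_mul_of_tsupport_subset
    (locallyIntegrableOn_mul_continuousOn hΩ hw.1 ha.continuous.continuousOn)
    (hφ.continuous_partialDeriv hm i) (hφ.hasCompactSupport_partialDeriv i)
    (hφ.tsupport_partialDeriv i)).integrableOn (s := Ω)
  have i2 := (integrable_mul_of_tsupport_subset l1 hφ.1.continuous hφ.2.1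
    hφ.2.2).integrableOn (s := Ω)
  have i3 := (integrable_mul_of_tsupport_subset l2 hφ.1.continuous hφ.2.1
    hφ.2.2).integrableOn (s := Ω)
  have e2 : ∫ x in Ω, f x * partialDeriv i (fun x => φ x * a x) x
      = (∫ x in Ω, f x * a x * partialDeriv i φ x)
        + ∫ x in Ω, f x * partialDeriv i a x * φ x := by
    rw [← integral_add i1 i3]
    refine integral_congr_ae (Filter.Eventually.of_forall fun x => ?_)
    simp only
    rw [partialDeriv_mul (hφ.1.differentiable hm x) (ha.differentiable hm x)]
    ring
  have e3 : ∫ x in Ω, (h x * a x + f x * partialDeriv i a x) * φ x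
      = (∫ x in Ω, h x * (φ x * a x)) + ∫ x in Ω, f x * partialDeriv i a x * φ x := by
    have : ∫ x in Ω, h x * (φ x * a x) = ∫ x in Ω, h x * a x * φ x :=
      integral_congr_ae (Filter.Eventually.of_forall fun x => by simp only; ring)
    rw [this, ← integral_add i2 i3]
    exact integral_congr_ae (Filter.Eventually.of_forall fun x => by simp only; ring)
  rw [e3, ← neg_eq_iff_eq_neg.2 e1, e2]
  ring

theorem restrict_punctured (n : ℕ) [Nontrivial (E n)] :
    (volume : Measure (E n)).restrict (unitBall n \ {0}) = volume.restrict (unitBall n) :=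
  Measure.restrict_congr_set (sdiff_null_ae_eq_self (measure_singleton _))

theorem locallyIntegrableOn_of_comp_norm {n : ℕ} [Nontrivial (E n)] {m : ℝ → ℝ} {f : E n → ℝ}
    (hf : LocallyIntegrableOn f (unitBall n \ {0}))
    (hfm : ∀ᵐ x ∂(volume.restrict (unitBall n)), f x = m ‖x‖) :
    LocallyIntegrableOn m (Ioo 0 1) := by
  rw [locallyIntegrableOn_iff isOpen_Ioo.isLocallyClosed]
  intro K hKs hK
  obtain ⟨a, b, ha, -, -, hb, hab⟩ := exists_Icc_of_isCompact hK hKs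
  refine IntegrableOn.mono_set ?_ hab
  have h1 : IntegrableOn f {x : E n | a ≤ ‖x‖ ∧ ‖x‖ ≤ b} :=
    hf.integrableOn_compact_subset (annulus_subset ha hb) (isCompact_annulus a b)
  have hsub : {x : E n | a ≤ ‖x‖ ∧ ‖x‖ ≤ b} ⊆ unitBall n := fun x hx =>
    (annulus_subset ha hb hx).1
  have h2 : IntegrableOn (fun x : E n => (Icc a b).indicator m ‖x‖) (unitBall n) := by
    have h3 := ((integrable_indicator_iff (isCompact_annulus a b).measurableSet).2 h1).integrableOn
      (s := unitBall n)
    refine h3.congr ?_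
    filter_upwards [hfm] with x hx
    by_cases hxs : a ≤ ‖x‖ ∧ ‖x‖ ≤ b
    · rw [indicator_of_mem (by exact hxs), indicator_of_mem (by exact hxs), hx]
    · rw [indicator_of_notMem (by exact hxs), indicator_of_notMem (by exact hxs)]
  rw [integrableOn_ball_fun_norm] at h2
  have h4 : IntegrableOn (fun r => (r ^ (n - 1))⁻¹ * (r ^ (n - 1) * (Icc a b).indicator m r))
      (Icc a b) := by
    refine (h2.mono_set (Icc_subset_unit ha hb)).continuousOn_mul ?_ isCompact_Icc
    exact ContinuousOn.inv₀ (by fun_prop) fun r hr => pow_ne_zero _ (ha.trans_le hr.1).ne'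
  refine h4.congr_fun (fun r hr => ?_) measurableSet_Icc
  simp only [indicator_of_mem hr]
  rw [inv_mul_cancel_left₀ (pow_ne_zero _ (ha.trans_le hr.1).ne')]

theorem contDiff_mul_of_tsupport_subset {m : WithTop ℕ∞} {U : Set ℝ} (hU : IsOpen U) {ψ f : ℝ → ℝ}
    (hψ : ContDiffOn ℝ m ψ U) (hs : tsupport ψ ⊆ U) (hf : ContDiffOn ℝ m f U) :
    ContDiff ℝ m (fun r => ψ r * f r) := by
  rw [contDiff_iff_contDiffAt]
  intro r
  by_cases hr : r ∈ tsupport ψ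
  · have hr' := hU.mem_nhds (hs hr)
    exact (hψ.contDiffAt hr').mul (hf.contDiffAt hr')
  · have h0 : (fun r => ψ r * f r) =ᶠ[nhds r] fun _ => 0 := by
      filter_upwards [(isClosed_tsupport ψ).isOpen_compl.mem_nhds hr] with t ht
      rw [image_eq_zero_of_notMem_tsupport ht, zero_mul]
    exact contDiffAt_const.congr_of_eventuallyEq h0

theorem sum_sq_eq_norm_sq {n : ℕ} (x : E n) : ∑ i, x i ^ 2 = ‖x‖ ^ 2 := by
  simp [EuclideanSpace.norm_sq_eq]

theorem locallyIntegrableOn_finset_sum {n : ℕ} {ι : Type*} {Ω : Set (E n)} (hΩ : IsOpen Ω)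
    {s : Finset ι} {f : ι → E n → ℝ} (hf : ∀ i ∈ s, LocallyIntegrableOn (f i) Ω) :
    LocallyIntegrableOn (fun x => ∑ i ∈ s, f i x) Ω := by
  rw [locallyIntegrableOn_iff hΩ.isLocallyClosed]
  exact fun K hKs hK => integrable_finsetSum _ fun i hi =>
    (hf i hi).integrableOn_compact_subset hKs hK

/-- A radial function with a weak gradient is given by an absolutely continuous profile. -/
theorem exists_profile_of_isRadial {n : ℕ} [Nontrivial (E n)] {u : E n → ℝ} {G : E n → E n}
    (hu : IsRadial u) (hG : HasWeakGradient (unitBall n \ {0}) u G) :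
    ∃ (c : ℝ) (q : ℝ → ℝ), LocallyIntegrableOn q (Ioo 0 1) ∧
      (∀ᵐ x ∂(volume.restrict (unitBall n)), u x = c + ∫ s in (1 / 2 : ℝ)..‖x‖, q s) ∧
      ∀ᵐ x ∂(volume.restrict (unitBall n)), ∀ i, G x i = q ‖x‖ * (x i / ‖x‖) := by
  obtain ⟨w, hw⟩ := hu
  have hΩo := isOpen_punctured n
  have hω := sphereArea_pos n
  have hne : Nonempty (Fin n) := by
    by_contra h
    rw [not_nonempty_iff] at h
    exact not_subsingleton (E n) inferInstance
  obtain ⟨i₀⟩ := hne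
  have hn1 : 1 ≤ n := by have := i₀.2; omega
  have hwl : LocallyIntegrableOn w (Ioo 0 1) := locallyIntegrableOn_of_comp_norm (hG i₀).1 hw
  have hGl : LocallyIntegrableOn (fun x => ∑ i, G x i * x i) (unitBall n \ {0}) := by
    have : ∀ i ∈ (Finset.univ : Finset (Fin n)),
        LocallyIntegrableOn (fun x => G x i * x i) (unitBall n \ {0}) := fun i _ =>
      locallyIntegrableOn_mul_continuousOn hΩo (hG i).2.1
        (contDiff_coord (m := 0) i).continuous.continuousOn
    exact locallyIntegrableOn_finset_sum hΩo this
  obtain ⟨m, hml, hm⟩ := exists_radial_moment hGl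
  set q : ℝ → ℝ := fun r => m r * ((sphereArea n) * r ^ n)⁻¹ with hq
  have hcinv : ContinuousOn (fun r : ℝ => ((sphereArea n) * r ^ n)⁻¹) (Ioo 0 1) :=
    ContinuousOn.inv₀ (by fun_prop) fun r hr =>
      mul_ne_zero hω.ne' (pow_ne_zero _ hr.1.ne')
  have hql : LocallyIntegrableOn q (Ioo 0 1) :=
    hml.mul_continuousOn hcinv isOpen_Ioo.isLocallyClosed
  have key : ∀ ψ : ℝ → ℝ, ContDiff ℝ ∞ ψ → HasCompactSupport ψ → tsupport ψ ⊆ Ioo 0 1 →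
      ∫ r in Ioo (0 : ℝ) 1, w r * deriv ψ r = -∫ r in Ioo (0 : ℝ) 1, q r * ψ r := by
    intro ψ hψ hψc hψs
    -- The divergence of the field `κ(|x|) x` is `r^{1-n} ψ'(r)`.
    set κ : ℝ → ℝ := fun r => ψ r * (r ^ n)⁻¹ with hκ
    have hκs : ContDiff ℝ ∞ κ := by
      refine contDiff_mul_of_tsupport_subset isOpen_Ioo hψ.contDiffOn hψs ?_
      exact ContDiffOn.inv (by fun_prop) fun r hr => pow_ne_zero _ hr.1.ne'
    have hκc : HasCompactSupport κ := hψc.mul_right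
    have hκt : tsupport κ ⊆ Ioo 0 1 := (tsupport_mul_subset_left).trans hψs
    have hT := isTestFunction_comp_norm (n := n) hκs hκc hκt
    have hm0 : (∞ : WithTop ℕ∞) ≠ 0 := by simp
    have hTi : ∀ i, IsTestFunction ∞ (unitBall n \ {0}) (fun x : E n => κ ‖x‖ * x i) :=
      fun i => hT.mul_right (contDiff_coord i)
    have hκd : ∀ r ∈ Ioo (0 : ℝ) 1, r * deriv κ r + n * κ r = r * (r ^ n)⁻¹ * deriv ψ r := by
      intro r hr
      have hr0 : r ≠ 0 := hr.1.ne'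
      have h1 : HasDerivAt κ (deriv ψ r * (r ^ n)⁻¹
          + ψ r * (-(n * r ^ (n - 1)) / (r ^ n) ^ 2)) r :=
        ((hψ.differentiable hm0 r).hasDerivAt).mul ((hasDerivAt_pow n r).inv (pow_ne_zero _ hr0))
      have h2 : r ^ n = r ^ (n - 1) * r := by rw [← pow_succ]; congr 1; omega
      have h3 : r ^ (n - 1) ≠ 0 := pow_ne_zero _ hr0
      rw [h1.deriv]
      simp only [hκ, h2]
      generalize r ^ (n - 1) = A at h3
      field_simp
      ring
    have hdiv : ∀ x ∈ unitBall n \ {0}, ∑ i, partialDeriv i (fun x : E n => κ ‖x‖ * x i) x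
        = ‖x‖ * (‖x‖ ^ n)⁻¹ * deriv ψ ‖x‖ := by
      intro x hx
      have hr := norm_mem_Ioo hx
      have h1 : ∀ i, partialDeriv i (fun x : E n => κ ‖x‖ * x i) x
          = deriv κ ‖x‖ / ‖x‖ * x i ^ 2 + κ ‖x‖ := by
        intro i
        rw [partialDeriv_mul (hT.1.differentiable hm0 x)
          ((contDiff_coord (m := ∞) i).differentiable hm0 x),
          partialDeriv_comp_norm hx.2 i (hκs.differentiable hm0 _).hasDerivAt, partialDeriv_coord]
        simp only [if_true]
        ring
      simp only [h1]
      rw [Finset.sum_add_distrib, ← Finset.mul_sum, sum_sq_eq_norm_sq, ← hκd _ hr]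
      have := hr.1.ne'
      simp
      field_simp
    have e1 : ∑ i, ∫ x in unitBall n \ {0}, u x * partialDeriv i (fun x : E n => κ ‖x‖ * x i) x
        = ∑ i, -∫ x in unitBall n \ {0}, G x i * (κ ‖x‖ * x i) :=
      Finset.sum_congr rfl fun i _ => (hG i).2.2 _ (hTi i)
    rw [← integral_finsetSum _ (fun i _ => (integrable_mul_of_tsupport_subset (hG i).1
        ((hTi i).continuous_partialDeriv hm0 i) ((hTi i).hasCompactSupport_partialDeriv i)
        ((hTi i).tsupport_partialDeriv i)).integrableOn), Finset.sum_neg_distrib,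
      ← integral_finsetSum _ (fun i _ => (integrable_mul_of_tsupport_subset (hG i).2.1
        (hTi i).1.continuous (hTi i).2.1 (hTi i).2.2).integrableOn)] at e1
    have e2 : ∫ x in unitBall n \ {0}, ∑ i, G x i * (κ ‖x‖ * x i)
        = ∫ r in Ioo (0 : ℝ) 1, m r * κ r := by
      rw [← hm κ hκs.continuous hκc hκt, restrict_punctured]
      refine integral_congr_ae (Filter.Eventually.of_forall fun x => ?_)
      simp only [Finset.sum_mul]
      exact Finset.sum_congr rfl fun i _ => by ring
    have e3 : ∫ x in unitBall n \ {0},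
        ∑ i, u x * partialDeriv i (fun x : E n => κ ‖x‖ * x i) x
        = sphereArea n * ∫ r in Ioo (0 : ℝ) 1, w r * deriv ψ r := by
      have h1 : ∫ x in unitBall n \ {0},
          ∑ i, u x * partialDeriv i (fun x : E n => κ ‖x‖ * x i) x
          = ∫ x in unitBall n \ {0}, (fun r => w r * (r * (r ^ n)⁻¹ * deriv ψ r)) ‖x‖ := by
        refine integral_congr_ae ?_
        rw [← restrict_punctured] at hw
        filter_upwards [hw, ae_restrict_mem hΩo.measurableSet] with x hx hxΩ
        rw [← Finset.mul_sum, hdiv x hxΩ, hx]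
      rw [h1, restrict_punctured,
        setIntegral_ball_fun_norm (n := n) (fun r => w r * (r * (r ^ n)⁻¹ * deriv ψ r))]
      congr 1
      refine setIntegral_congr_fun measurableSet_Ioo fun r hr => ?_
      have h2 : r ^ n = r ^ (n - 1) * r := by rw [← pow_succ]; congr 1; omega
      have hr0 : r ≠ 0 := hr.1.ne'
      have h3 : r ^ (n - 1) ≠ 0 := pow_ne_zero _ hr0
      simp only [h2]
      field_simp
    rw [e2, e3] at e1
    have e4 : ∫ r in Ioo (0 : ℝ) 1, q r * ψ r
        = (sphereArea n)⁻¹ * ∫ r in Ioo (0 : ℝ) 1, m r * κ r := by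
      rw [← integral_const_mul]
      refine integral_congr_ae (Filter.Eventually.of_forall fun r => ?_)
      simp only [hq, hκ, mul_inv]
      ring
    rw [e4]
    field_simp
    linarith
  obtain ⟨c, hc⟩ := exists_eq_primitive_of_weak_deriv hwl hql key
  have huae : ∀ᵐ x ∂(volume.restrict (unitBall n)), u x = c + ∫ s in (1 / 2 : ℝ)..‖x‖, q s := by
    filter_upwards [hw, ae_ball_of_ae_Ioo hc] with x h1 h2
    rw [h1, h2]
  refine ⟨c, q, hql, huae, ?_⟩
  rw [ae_all_iff]
  intro i
  have h1 := hasWeakPartialDeriv_comp_norm (n := n) (p := fun r => c + ∫ s in (1 / 2 : ℝ)..r, q s)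
    hql (fun r _ => rfl) i
  have h2 := HasWeakPartialDeriv.ae_unique hΩo (by rw [restrict_punctured]; exact huae) (hG i) h1
  rw [restrict_punctured] at h2
  exact h2

/-- The data of a radial function with two weak derivatives away from the origin: the profile `v`,
its derivative `q`, which is such that `q r / r` is locally absolutely continuous on `(0,1)` with
almost everywhere derivative `p'`. The Hessian is `(q/r) I + (p'/r) x xᵀ`. -/
structure IsRadialJet {n : ℕ} (u : E n → ℝ) (G : E n → E n)
    (H : E n → Matrix (Fin n) (Fin n) ℝ) (v q p' : ℝ → ℝ) : Prop where
  absolutelyContinuous : ∀ a ∈ Ioo (0 : ℝ) 1, ∀ b ∈ Ioo (0 : ℝ) 1,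
    AbsolutelyContinuousOnInterval (fun r => q r / r) a b
  ae_hasDerivAt : ∀ᵐ r ∂(volume.restrict (Ioo (0 : ℝ) 1)), HasDerivAt (fun r => q r / r) (p' r) r
  hasDerivAt : ∀ r ∈ Ioo (0 : ℝ) 1, HasDerivAt v (q r) r
  continuousOn : ContinuousOn q (Ioo 0 1)
  ae_eq : ∀ᵐ x ∂(volume.restrict (unitBall n)), u x = v ‖x‖
  ae_gradient : ∀ᵐ x ∂(volume.restrict (unitBall n)), ∀ i, G x i = q ‖x‖ * (x i / ‖x‖)
  ae_hessian : ∀ᵐ x ∂(volume.restrict (unitBall n)),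
    H x = (q ‖x‖ / ‖x‖) • (1 : Matrix (Fin n) (Fin n) ℝ)
      + (p' ‖x‖ / ‖x‖) • Matrix.vecMulVec (fun i => x i) (fun i => x i)

theorem locallyIntegrableOn_deriv_of_absolutelyContinuous {p : ℝ → ℝ}
    (hp : ∀ a ∈ Ioo (0 : ℝ) 1, ∀ b ∈ Ioo (0 : ℝ) 1, AbsolutelyContinuousOnInterval p a b) :
    LocallyIntegrableOn (deriv p) (Ioo 0 1) := by
  rw [locallyIntegrableOn_iff isOpen_Ioo.isLocallyClosed]
  intro K hKs hK
  obtain ⟨a, b, ha, ha2, hb2, hb, hab⟩ := exists_Icc_of_isCompact hK hKs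
  have h1 := (hp a ⟨ha, by linarith⟩ b ⟨by linarith, hb⟩).intervalIntegrable_deriv
  rw [intervalIntegrable_iff_integrableOn_Icc_of_le (by linarith)] at h1
  exact h1.mono_set hab

theorem ae_hasDerivAt_of_absolutelyContinuous {p : ℝ → ℝ}
    (hp : ∀ a ∈ Ioo (0 : ℝ) 1, ∀ b ∈ Ioo (0 : ℝ) 1, AbsolutelyContinuousOnInterval p a b) :
    ∀ᵐ r ∂(volume.restrict (Ioo (0 : ℝ) 1)), HasDerivAt p (deriv p r) r := by
  have h1 := ae_hasDerivAt_primitive (locallyIntegrableOn_deriv_of_absolutelyContinuous hp)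
  filter_upwards [h1, ae_restrict_mem measurableSet_Ioo] with r hr hr1
  have h2 : p =ᶠ[nhds r] fun r => p (1 / 2) + ∫ s in (1 / 2 : ℝ)..r, deriv p s := by
    filter_upwards [isOpen_Ioo.mem_nhds hr1] with t ht
    rw [(hp _ half_mem_unit t ht).integral_deriv_eq_sub]
    ring
  exact (hr.const_add _).congr_of_eventuallyEq h2

theorem exists_isRadialJet {n : ℕ} [Nontrivial (E n)] {u : E n → ℝ} {G : E n → E n}
    {H : E n → Matrix (Fin n) (Fin n) ℝ} (hu : IsRadial u)
    (hG : HasWeakGradient (unitBall n \ {0}) u G) (hH : HasWeakJacobian (unitBall n \ {0}) G H) :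
    ∃ v q p' : ℝ → ℝ, IsRadialJet u G H v q p' := by
  obtain ⟨c, q₀, hq₀l, huae, hGae⟩ := exists_profile_of_isRadial hu hG
  have hΩo := isOpen_punctured n
  have hω := sphereArea_pos n
  obtain ⟨m, hml, hm⟩ := exists_radial_moment
    (locallyIntegrableOn_finset_sum hΩo (s := Finset.univ) fun i _ => (hH i i).2.1)
  set f : ℝ → ℝ := fun r => q₀ r * (sphereArea n * r ^ (n - 1)) with hf
  have hfl : LocallyIntegrableOn f (Ioo 0 1) :=
    hq₀l.mul_continuousOn (by fun_prop) isOpen_Ioo.isLocallyClosed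
  have hm0 : (∞ : WithTop ℕ∞) ≠ 0 := by simp
  -- Testing the trace of the Hessian with radial functions.
  have key : ∀ ψ : ℝ → ℝ, ContDiff ℝ ∞ ψ → HasCompactSupport ψ → tsupport ψ ⊆ Ioo 0 1 →
      ∫ r in Ioo (0 : ℝ) 1, f r * deriv ψ r = -∫ r in Ioo (0 : ℝ) 1, m r * ψ r := by
    intro ψ hψ hψc hψs
    have hT := isTestFunction_comp_norm (n := n) hψ hψc hψs
    have e1 : ∑ i, ∫ x in unitBall n \ {0}, G x i * partialDeriv i (fun x : E n => ψ ‖x‖) x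
        = ∑ i, -∫ x in unitBall n \ {0}, H x i i * ψ ‖x‖ :=
      Finset.sum_congr rfl fun i _ => (hH i i).2.2 _ hT
    rw [← integral_finsetSum _ (fun i _ => (integrable_mul_of_tsupport_subset (hH i i).1
        (hT.continuous_partialDeriv hm0 i) (hT.hasCompactSupport_partialDeriv i)
        (hT.tsupport_partialDeriv i)).integrableOn), Finset.sum_neg_distrib,
      ← integral_finsetSum _ (fun i _ => (integrable_mul_of_tsupport_subset (hH i i).2.1
        hT.1.continuous hT.2.1 hT.2.2).integrableOn)] at e1
    have e2 : ∫ x in unitBall n \ {0}, ∑ i, H x i i * ψ ‖x‖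
        = ∫ r in Ioo (0 : ℝ) 1, m r * ψ r := by
      rw [← hm ψ hψ.continuous hψc hψs, restrict_punctured]
      simp only [Finset.sum_mul]
    have e3 : ∫ x in unitBall n \ {0}, ∑ i, G x i * partialDeriv i (fun x : E n => ψ ‖x‖) x
        = ∫ r in Ioo (0 : ℝ) 1, f r * deriv ψ r := by
      have h1 : ∫ x in unitBall n \ {0}, ∑ i, G x i * partialDeriv i (fun x : E n => ψ ‖x‖) x
          = ∫ x in unitBall n \ {0}, (fun r => q₀ r * deriv ψ r) ‖x‖ := by
        refine integral_congr_ae ?_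
        rw [← restrict_punctured] at hGae
        filter_upwards [hGae, ae_restrict_mem hΩo.measurableSet] with x hx hxΩ
        have hr := (norm_mem_Ioo hxΩ).1.ne'
        have h2 : ∀ i, G x i * partialDeriv i (fun x : E n => ψ ‖x‖) x
            = q₀ ‖x‖ * deriv ψ ‖x‖ / ‖x‖ ^ 2 * x i ^ 2 := by
          intro i
          rw [hx i, partialDeriv_comp_norm hxΩ.2 i (hψ.differentiable hm0 _).hasDerivAt]
          field_simp
        simp only [h2]
        rw [← Finset.mul_sum, sum_sq_eq_norm_sq]
        field_simp
      rw [h1, restrict_punctured, setIntegral_ball_fun_norm (n := n) (fun r => q₀ r * deriv ψ r),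
        ← integral_const_mul]
      refine integral_congr_ae (Filter.Eventually.of_forall fun r => ?_)
      simp only [hf]
      ring
    rw [← e3, e1, e2]
  obtain ⟨c₂, hc₂⟩ := exists_eq_primitive_of_weak_deriv hfl hml key
  set F : ℝ → ℝ := fun r => c₂ + ∫ s in (1 / 2 : ℝ)..r, m s with hF
  set q : ℝ → ℝ := fun r => F r * (sphereArea n * r ^ (n - 1))⁻¹ with hq
  have hden : ∀ r ∈ Ioo (0 : ℝ) 1, sphereArea n * r ^ (n - 1) ≠ 0 := fun r hr =>
    mul_ne_zero hω.ne' (pow_ne_zero _ hr.1.ne')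
  have hFc : ContinuousOn F (Ioo 0 1) := continuousOn_const.add (continuousOn_primitive hml)
  have hqc : ContinuousOn q (Ioo 0 1) := hFc.mul (ContinuousOn.inv₀ (by fun_prop) hden)
  have hqq : ∀ᵐ r ∂(volume.restrict (Ioo (0 : ℝ) 1)), q₀ r = q r := by
    filter_upwards [hc₂, ae_restrict_mem measurableSet_Ioo] with r hr hr1
    simp only [hq, hF, ← hr, hf]
    rw [mul_inv_cancel_right₀ (hden r hr1)]
  have hac : ∀ a ∈ Ioo (0 : ℝ) 1, ∀ b ∈ Ioo (0 : ℝ) 1,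
      AbsolutelyContinuousOnInterval (fun r => q r / r) a b := by
    intro a ha b hb
    have h1 : AbsolutelyContinuousOnInterval F a b := by
      have h2 : AbsolutelyContinuousOnInterval (fun _ : ℝ => c₂) a b :=
        (contDiff_const.contDiffOn).absolutelyContinuousOnInterval
      exact h2.add (absolutelyContinuousOnInterval_primitive hml ha hb)
    have h3 : AbsolutelyContinuousOnInterval (fun r => (sphereArea n * r ^ (n - 1) * r)⁻¹) a b := by
      refine ContDiffOn.absolutelyContinuousOnInterval ?_
      refine ContDiffOn.inv (by fun_prop) fun r hr => ?_
      have hr' := uIcc_subset_unit ha hb hr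
      exact mul_ne_zero (hden r hr') hr'.1.ne'
    have h4 : (fun r => q r / r) = F * fun r => (sphereArea n * r ^ (n - 1) * r)⁻¹ := by
      funext r
      simp only [hq, Pi.mul_apply, mul_inv, div_eq_mul_inv]
      ring
    rw [h4]
    exact h1.mul h3
  set v : ℝ → ℝ := fun r => c + ∫ s in (1 / 2 : ℝ)..r, q s with hv
  have hint : ∀ r ∈ Ioo (0 : ℝ) 1, ∫ s in (1 / 2 : ℝ)..r, q₀ s = ∫ s in (1 / 2 : ℝ)..r, q s := by
    intro r hr
    refine intervalIntegral.integral_congr_ae ?_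
    rw [ae_restrict_iff' measurableSet_Ioo] at hqq
    filter_upwards [hqq] with s hs hs1
    exact hs (uIcc_subset_unit half_mem_unit hr (uIoc_subset_uIcc hs1))
  have hGae' : ∀ᵐ x ∂(volume.restrict (unitBall n)), ∀ i, G x i = q ‖x‖ * (x i / ‖x‖) := by
    filter_upwards [hGae, ae_ball_of_ae_Ioo hqq] with x h1 h2
    rwa [← h2]
  refine ⟨v, q, deriv fun r => q r / r, hac, ae_hasDerivAt_of_absolutelyContinuous hac, ?_, hqc, ?_,
    hGae', ?_⟩
  · intro r hr
    have h1 : IntervalIntegrable q volume (1 / 2) r :=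
      (hqc.mono (uIcc_subset_unit half_mem_unit hr)).intervalIntegrable
    exact (intervalIntegral.integral_hasDerivAt_right h1
      (hqc.stronglyMeasurableAtFilter isOpen_Ioo r hr)
      (hqc.continuousAt (isOpen_Ioo.mem_nhds hr))).const_add _
  · have : ∀ᵐ x ∂(volume.restrict (unitBall n)), x ∈ unitBall n \ {0} := by
      rw [← restrict_punctured]; exact ae_restrict_mem hΩo.measurableSet
    filter_upwards [huae, this] with x h1 h2
    rw [h1, hint _ (norm_mem_Ioo h2)]
  · have hp := locallyIntegrableOn_deriv_of_absolutelyContinuous hac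
    have hpp : ∀ r ∈ Ioo (0 : ℝ) 1, (fun r => q r / r) r
        = (q (1 / 2) / (1 / 2)) + ∫ s in (1 / 2 : ℝ)..r, deriv (fun r => q r / r) s := by
      intro r hr
      rw [(hac _ half_mem_unit r hr).integral_deriv_eq_sub]
      ring
    have h1 : ∀ i j, ∀ᵐ x ∂(volume.restrict (unitBall n)), H x i j
        = deriv (fun r => q r / r) ‖x‖ * (x j / ‖x‖) * x i
          + q ‖x‖ / ‖x‖ * (if i = j then 1 else 0) := by
      intro i j
      have w1 := (hasWeakPartialDeriv_comp_norm (n := n) hp hpp j).mul_smooth hΩo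
        (contDiff_coord i)
      have h2 := HasWeakPartialDeriv.ae_unique hΩo ?_ (hH i j) w1
      · rw [restrict_punctured] at h2
        filter_upwards [h2] with x hx
        rw [hx, partialDeriv_coord]
      · rw [restrict_punctured]
        filter_upwards [hGae'] with x hx
        rw [hx i]
        ring
    have h3 : ∀ᵐ x ∂(volume.restrict (unitBall n)), ∀ i j, H x i j
        = deriv (fun r => q r / r) ‖x‖ * (x j / ‖x‖) * x i
          + q ‖x‖ / ‖x‖ * (if i = j then 1 else 0) := by
      rw [ae_all_iff]; intro i
      rw [ae_all_iff]; intro j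
      exact h1 i j
    filter_upwards [h3] with x hx
    ext i j
    rw [hx i j]
    simp only [Matrix.add_apply, Matrix.smul_apply, Matrix.one_apply, Matrix.vecMulVec_apply,
      smul_eq_mul]
    ring

/-! ### The equation and the second variation for radial functions -/

namespace IsRadialJet

variable {n : ℕ} {u : E n → ℝ} {G : E n → E n} {H : E n → Matrix (Fin n) (Fin n) ℝ}
  {v q p' : ℝ → ℝ}

theorem ae_Sk [Nontrivial (E n)] (J : IsRadialJet u G H v q p') {j : ℕ} (hj : 1 ≤ j) :
    ∀ᵐ x ∂(volume.restrict (unitBall n)), Sk j (H x)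
      = (n.choose j : ℝ) * (q ‖x‖ / ‖x‖) ^ j
        + ((n - 1).choose (j - 1) : ℝ) * (q ‖x‖ / ‖x‖) ^ (j - 1) * (‖x‖ * p' ‖x‖) := by
  have h0 : ∀ᵐ x ∂(volume.restrict (unitBall n)), x ∈ unitBall n \ {0} := by
    rw [← restrict_punctured]; exact ae_restrict_mem (isOpen_punctured n).measurableSet
  filter_upwards [J.ae_hessian, h0] with x hx hx0
  have hr := (norm_mem_Ioo hx0).1.ne'
  rw [hx, Sk_smul_one_add_smul_vecMulVec hj, sum_sq_eq_norm_sq]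
  congr 1
  generalize (q ‖x‖ / ‖x‖) ^ (j - 1) = A
  field_simp

theorem ae_contraction [Nontrivial (E n)] (J : IsRadialJet u G H v q p') {k : ℕ} (hk : 1 ≤ k) :
    ∀ᵐ x ∂(volume.restrict (unitBall n)), ∑ i, ∑ j, x i * x j * SkDeriv k (H x) i j
      = ‖x‖ ^ 2 * ((n - 1).choose (k - 1) : ℝ) * (q ‖x‖ / ‖x‖) ^ (k - 1) := by
  filter_upwards [J.ae_hessian] with x hx
  rw [hx, sum_mul_SkDeriv hk, sum_sq_eq_norm_sq]
  ring

theorem ae_gradient_contraction [Nontrivial (E n)] (J : IsRadialJet u G H v q p') {k : ℕ}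
    (hk : 1 ≤ k) {κ : ℝ → ℝ} (hκ : Differentiable ℝ κ) :
    ∀ᵐ x ∂(volume.restrict (unitBall n)),
      ∑ i, ∑ j, G x i * partialDeriv j (fun x : E n => κ ‖x‖) x * SkDeriv k (H x) i j
        = ((n - 1).choose (k - 1) : ℝ) * (q ‖x‖ / ‖x‖) ^ (k - 1) * q ‖x‖ * deriv κ ‖x‖ := by
  have h0 : ∀ᵐ x ∂(volume.restrict (unitBall n)), x ∈ unitBall n \ {0} := by
    rw [← restrict_punctured]; exact ae_restrict_mem (isOpen_punctured n).measurableSet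
  filter_upwards [J.ae_contraction hk, J.ae_gradient, h0] with x h1 h2 hx0
  have hr := (norm_mem_Ioo hx0).1.ne'
  have h3 : ∀ i j, G x i * partialDeriv j (fun x : E n => κ ‖x‖) x * SkDeriv k (H x) i j
      = q ‖x‖ * deriv κ ‖x‖ / ‖x‖ ^ 2 * (x i * x j * SkDeriv k (H x) i j) := by
    intro i j
    rw [h2 i, partialDeriv_comp_norm hx0.2 j (hκ _).hasDerivAt]
    field_simp
  simp only [h3, ← Finset.mul_sum, h1]
  generalize (q ‖x‖ / ‖x‖) ^ (k - 1) = A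
  field_simp

theorem ae_quadratic_contraction [Nontrivial (E n)] (J : IsRadialJet u G H v q p') {k : ℕ}
    (hk : 1 ≤ k) {κ : ℝ → ℝ} (hκ : Differentiable ℝ κ) :
    ∀ᵐ x ∂(volume.restrict (unitBall n)),
      ∑ i, ∑ j, partialDeriv i (fun x : E n => κ ‖x‖) x * partialDeriv j (fun x : E n => κ ‖x‖) x
          * SkDeriv k (H x) i j
        = ((n - 1).choose (k - 1) : ℝ) * (q ‖x‖ / ‖x‖) ^ (k - 1) * deriv κ ‖x‖ ^ 2 := by
  have h0 : ∀ᵐ x ∂(volume.restrict (unitBall n)), x ∈ unitBall n \ {0} := by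
    rw [← restrict_punctured]; exact ae_restrict_mem (isOpen_punctured n).measurableSet
  filter_upwards [J.ae_contraction hk, h0] with x h1 hx0
  have hr := (norm_mem_Ioo hx0).1.ne'
  have h3 : ∀ i j, partialDeriv i (fun x : E n => κ ‖x‖) x
      * partialDeriv j (fun x : E n => κ ‖x‖) x * SkDeriv k (H x) i j
      = deriv κ ‖x‖ ^ 2 / ‖x‖ ^ 2 * (x i * x j * SkDeriv k (H x) i j) := by
    intro i j
    rw [partialDeriv_comp_norm hx0.2 j (hκ _).hasDerivAt,
      partialDeriv_comp_norm hx0.2 i (hκ _).hasDerivAt]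
    field_simp
  simp only [h3, ← Finset.mul_sum, h1]
  generalize (q ‖x‖ / ‖x‖) ^ (k - 1) = A
  field_simp

/-- The second variation on radial test functions. -/
theorem radial_stability [Nontrivial (E n)] (J : IsRadialJet u G H v q p') {k : ℕ} (hk : 1 ≤ k)
    {g : ℝ → ℝ} (hs : IsSemistable k g u H) {κ : ℝ → ℝ} (hκ : ContDiff ℝ 1 κ)
    (hc : HasCompactSupport κ) (ht : tsupport κ ⊆ Ioo 0 1) :
    0 ≤ ∫ r in Ioo (0 : ℝ) 1, r ^ (n - 1) * (((n - 1).choose (k - 1) : ℝ) * (q r / r) ^ (k - 1)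
      * deriv κ r ^ 2 + deriv g (v r) * κ r ^ 2) := by
  have h1 := hs _ (isTestFunction_comp_norm (n := n) hκ hc ht)
  have h2 : secondVariation k g u H (fun x : E n => κ ‖x‖)
      = ∫ x in unitBall n, (fun r => ((n - 1).choose (k - 1) : ℝ) * (q r / r) ^ (k - 1)
      * deriv κ r ^ 2 + deriv g (v r) * κ r ^ 2) ‖x‖ := by
    refine integral_congr_ae ?_
    filter_upwards [J.ae_quadratic_contraction hk (hκ.differentiable one_ne_zero), J.ae_eq]
      with x h3 h4
    rw [h3, h4]
  rw [h2, setIntegral_ball_fun_norm (n := n) (fun r => ((n - 1).choose (k - 1) : ℝ)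
    * (q r / r) ^ (k - 1) * deriv κ r ^ 2 + deriv g (v r) * κ r ^ 2)] at h1
  exact nonneg_of_mul_nonneg_right h1 (sphereArea_pos n)

/-- Testing the weak equation with functions of the radius that are constant near the origin
gives its integrated form: the flux through the sphere of radius `r` is the total mass of `g(u)`
inside. -/
theorem flux_eq [Nontrivial (E n)] (J : IsRadialJet u G H v q p') {k : ℕ} (hk : 1 ≤ k)
    {g : ℝ → ℝ} (hw : IsWeakSolution k g u G H) :
    IntegrableOn (fun r => r ^ (n - 1) * g (v r)) (Ioo 0 1) ∧ ∀ r ∈ Ioo (0 : ℝ) 1,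
      ((n - 1).choose (k - 1) : ℝ) / k * (r ^ n * (q r / r) ^ k)
        = ∫ s in (0 : ℝ)..r, s ^ (n - 1) * g (v s) := by
  set c : ℝ := ((n - 1).choose (k - 1) : ℝ) with hc
  set γ : ℝ → ℝ := fun r => r ^ (n - 1) * g (v r) with hγ
  set F : ℝ → ℝ := fun r => c / k * (r ^ n * (q r / r) ^ k) with hF
  have hn1 : 1 ≤ n := by
    have := Module.finrank_pos (R := ℝ) (M := E n)
    rw [finrank_euclideanSpace_fin] at this
    omega
  have hγi : IntegrableOn γ (Ioo 0 1) := by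
    refine integrableOn_ball_fun_norm.1 (?_ : IntegrableOn (fun x : E n => g (v ‖x‖)) (unitBall n))
    refine hw.integrable.congr ?_
    filter_upwards [J.ae_eq] with x hx
    rw [hx]
  have hγi' : IntervalIntegrable γ volume 0 1 := by
    rw [intervalIntegrable_iff_integrableOn_Ioo_of_le zero_le_one]
    exact hγi
  set I : ℝ → ℝ := fun r => ∫ s in (0 : ℝ)..r, γ s with hI
  have hIac : AbsolutelyContinuousOnInterval I 0 1 :=
    hγi'.absolutelyContinuousOnInterval_intervalIntegral (by simp)
  have hId : ∀ᵐ r : ℝ, r ∈ uIcc (0 : ℝ) 1 → HasDerivAt I (γ r) r := by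
    filter_upwards [hγi'.ae_hasDerivAt_integral] with r hr hr1
    exact hr hr1 0 (by simp)
  have hIc : ContinuousOn I (Ioo 0 1) := by
    have := hIac.continuousOn
    rw [uIcc_of_le zero_le_one] at this
    exact this.mono Ioo_subset_Icc_self
  have hFc : ContinuousOn F (Ioo 0 1) := by
    refine continuousOn_const.mul (ContinuousOn.mul (by fun_prop) (ContinuousOn.pow ?_ k))
    exact J.continuousOn.div continuousOn_id fun r hr => hr.1.ne'
  have hl : LocallyIntegrableOn (fun r => F r - I r) (Ioo 0 1) :=
    (hFc.sub hIc).locallyIntegrableOn measurableSet_Ioo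
  have hlF : LocallyIntegrableOn F (Ioo 0 1) := hFc.locallyIntegrableOn measurableSet_Ioo
  have hlI : LocallyIntegrableOn I (Ioo 0 1) := hIc.locallyIntegrableOn measurableSet_Ioo
  have key : ∀ᵐ r ∂(volume : Measure ℝ), r ∈ Ioo (0 : ℝ) 1 → F r - I r = 0 := by
    refine isOpen_Ioo.ae_eq_zero_of_integral_contDiff_smul_eq_zero hl fun ψ hψ hψc hψs => ?_
    obtain ⟨a, b, ha, ha2, hb2, hb, hab⟩ := exists_Icc_of_isCompact hψc hψs
    have hz : ∀ r, r ∉ Icc a b → ψ r = 0 := fun r hr =>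
      image_eq_zero_of_notMem_tsupport fun h => hr (hab h)
    have hψcont := hψ.continuous
    set θ : ℝ → ℝ := fun r => ∫ s in (b : ℝ)..r, ψ s with hθ
    have hθd : ∀ r, HasDerivAt θ (ψ r) r := fun r =>
      intervalIntegral.integral_hasDerivAt_right (hψcont.intervalIntegrable _ _)
        (hψcont.stronglyMeasurableAtFilter _ _) hψcont.continuousAt
    have hθ' : deriv θ = ψ := funext fun r => (hθd r).deriv
    have hθs : ContDiff ℝ 1 θ := by
      rw [contDiff_one_iff_deriv, hθ']
      exact ⟨fun r => (hθd r).differentiableAt, hψcont⟩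
    have hθb : ∀ r, b ≤ r → θ r = 0 := by
      intro r hr
      refine intervalIntegral.integral_zero_ae (Filter.Eventually.of_forall fun s hs => ?_)
      rw [uIoc_of_le hr] at hs
      exact hz s fun h => by linarith [h.2, hs.1]
    have hθa : ∀ r, r ≤ a → θ r = θ a := by
      intro r hr
      have h1 : θ a = θ r + ∫ s in r..a, ψ s :=
        (intervalIntegral.integral_add_adjacent_intervals (hψcont.intervalIntegrable _ _)
          (hψcont.intervalIntegrable _ _)).symm
      have h2 : ∫ s in r..a, ψ s = 0 := by
        refine intervalIntegral.integral_zero_ae ?_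
        filter_upwards [Measure.ae_ne volume a] with s hsa hs
        rw [uIoc_of_le hr] at hs
        exact hz s fun h => hsa (le_antisymm hs.2 h.1)
      linarith
    have hts : tsupport (fun x : E n => θ ‖x‖) ⊆ closedBall 0 b := by
      refine closure_minimal (fun x hx => ?_) isClosed_closedBall
      by_contra h
      rw [mem_closedBall_zero_iff, not_le] at h
      exact hx (hθb _ h.le)
    have hη : IsTestFunction 1 (unitBall n) (fun x : E n => θ ‖x‖) := by
      refine ⟨?_, (isCompact_closedBall (0 : E n) b).of_isClosed_subset (isClosed_tsupport _) hts,
        hts.trans (closedBall_subset_ball hb)⟩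
      rw [contDiff_iff_contDiffAt]
      intro x
      by_cases hx : x = 0
      · have h1 : (fun x : E n => θ ‖x‖) =ᶠ[nhds x] fun _ => θ a := by
          have h2 : ball (0 : E n) a ∈ nhds x := by rw [hx]; exact ball_mem_nhds _ ha
          filter_upwards [h2] with y hy
          exact hθa _ (mem_ball_zero_iff.1 hy).le
        exact contDiffAt_const.congr_of_eventuallyEq h1
      · exact hθs.contDiffAt.comp x (contDiffAt_norm_of_ne hx)
    have e1 := hw.equation _ hη
    have e2 : ∫ x in unitBall n, ((1 / (k : ℝ)) *
        (∑ i, ∑ j, G x i * partialDeriv j (fun x : E n => θ ‖x‖) x * SkDeriv k (H x) i j)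
          + g (u x) * θ ‖x‖)
        = ∫ x in unitBall n, (fun r => (1 / (k : ℝ)) * (c * (q r / r) ^ (k - 1) * q r * ψ r)
          + g (v r) * θ r) ‖x‖ := by
      refine integral_congr_ae ?_
      filter_upwards [J.ae_gradient_contraction hk (hθs.differentiable one_ne_zero), J.ae_eq]
        with x h3 h4
      rw [h3, h4, hθ']
    rw [e2, setIntegral_ball_fun_norm (n := n) (fun r => (1 / (k : ℝ)) *
      (c * (q r / r) ^ (k - 1) * q r * ψ r) + g (v r) * θ r)] at e1
    have e3 := (mul_eq_zero.1 e1).resolve_left (sphereArea_pos n).ne'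
    have e4 : ∫ r in Ioo (0 : ℝ) 1, r ^ (n - 1) * ((1 / (k : ℝ)) *
        (c * (q r / r) ^ (k - 1) * q r * ψ r) + g (v r) * θ r)
        = ∫ r in Ioo (0 : ℝ) 1, (F r * ψ r + γ r * θ r) := by
      refine setIntegral_congr_fun measurableSet_Ioo fun r hr => ?_
      have h1 : r ^ n = r ^ (n - 1) * r := by rw [← pow_succ]; congr 1; omega
      have h2 : (q r / r) ^ k = (q r / r) ^ (k - 1) * (q r / r) := by
        rw [← pow_succ]; congr 1; omega
      have hr0 : r ≠ 0 := hr.1.ne'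
      simp only [hF, hγ, h1, h2]
      generalize (q r / r) ^ (k - 1) = A
      generalize r ^ (n - 1) = B
      field_simp
    have i1 := integrable_mul_of_tsupport_subset hlF hψcont hψc hψs
    have i2 := integrable_mul_of_tsupport_subset hlI hψcont hψc hψs
    have i3 : IntegrableOn (fun r => γ r * θ r) (Ioo 0 1) := by
      obtain ⟨C, hC⟩ := (isCompact_Icc (a := (0 : ℝ)) (b := 1)).exists_bound_of_continuousOn
        hθs.continuous.continuousOn
      refine hγi.mul_bdd (c := C) hθs.continuous.aestronglyMeasurable ?_
      filter_upwards [ae_restrict_mem measurableSet_Ioo] with r hr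
      exact hC r ⟨hr.1.le, hr.2.le⟩
    have e5 : ∫ r in Ioo (0 : ℝ) 1, γ r * θ r = -∫ r in Ioo (0 : ℝ) 1, I r * ψ r := by
      have h1 := hIac.integral_mul_deriv_eq_deriv_mul
        ((hθs.contDiffOn).absolutelyContinuousOnInterval (a := 0) (b := 1))
      have h2 : ∫ x in (0 : ℝ)..1, deriv I x * θ x = ∫ x in (0 : ℝ)..1, γ x * θ x := by
        refine intervalIntegral.integral_congr_ae ?_
        filter_upwards [hId] with r hr hr1
        rw [(hr (uIoc_subset_uIcc hr1)).deriv]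
      have hI0 : I 0 = 0 := intervalIntegral.integral_same
      rw [h2, hθb 1 hb.le, hI0, hθ', intervalIntegral.integral_of_le zero_le_one,
        intervalIntegral.integral_of_le zero_le_one, integral_Ioc_eq_integral_Ioo,
        integral_Ioc_eq_integral_Ioo] at h1
      linarith
    rw [e4, integral_add i1.integrableOn i3, e5] at e3
    have e6 : ∀ r, ψ r • (F r - I r) = F r * ψ r - I r * ψ r := fun r => by
      rw [smul_eq_mul]; ring
    simp only [e6]
    rw [integral_sub i1 i2, ← setIntegral_mul_of_tsupport_subset _ hψs,
      ← setIntegral_mul_of_tsupport_subset I hψs]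
    linarith
  refine ⟨hγi, ?_⟩
  have h1 : F =ᵐ[volume.restrict (Ioo (0 : ℝ) 1)] I := by
    rw [Filter.EventuallyEq, ae_restrict_iff' measurableSet_Ioo]
    filter_upwards [key] with r hr hr1
    linarith [hr hr1]
  exact fun r hr => Measure.eqOn_open_of_ae_eq h1 isOpen_Ioo hFc hIc hr

end IsRadialJet

/-! ### Monotonicity of radial solutions -/

theorem exists_bound_deriv_of_locallyLipschitz {g : ℝ → ℝ} (hg : LocallyLipschitz g) (t : ℝ) :
    ∃ L : ℝ, 0 ≤ L ∧ ∀ᶠ s in nhds t, |deriv g s| ≤ L := by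
  obtain ⟨K, U, hU, hK⟩ := hg t
  obtain ⟨V, hVU, hVo, hV⟩ := _root_.mem_nhds_iff.1 hU
  refine ⟨K, K.2, ?_⟩
  filter_upwards [hVo.mem_nhds hV] with s hs
  exact norm_deriv_le_of_lipschitzOn (Filter.mem_of_superset (hVo.mem_nhds hs) hVU) hK

theorem locallyIntegrableOn_deriv_comp {g v : ℝ → ℝ} (hg : LocallyLipschitz g)
    (hv : ContinuousOn v (Ioo 0 1)) :
    LocallyIntegrableOn (fun r => deriv g (v r)) (Ioo 0 1) := by
  intro r hr
  obtain ⟨L, -, hL⟩ := exists_bound_deriv_of_locallyLipschitz hg (v r)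
  have h1 : ∀ᶠ s in nhdsWithin r (Ioo 0 1), |deriv g (v s)| ≤ L := (hv r hr).eventually hL
  have hm : AEStronglyMeasurable (fun r => deriv g (v r)) (volume.restrict (Ioo 0 1)) :=
    ((measurable_deriv g).comp_aemeasurable
      (hv.aemeasurable measurableSet_Ioo)).aestronglyMeasurable
  rw [eventually_nhdsWithin_iff, Metric.eventually_nhds_iff_ball] at h1
  obtain ⟨ε, hε, h2⟩ := h1
  refine ⟨ball r ε ∩ Ioo 0 1, ?_, ?_⟩
  · exact Filter.inter_mem (mem_nhdsWithin_of_mem_nhds (ball_mem_nhds r hε)) self_mem_nhdsWithin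
  · have hfin : volume (ball r ε ∩ Ioo 0 1) < ⊤ :=
      (measure_mono inter_subset_right).trans_lt (by simp)
    have : IsFiniteMeasure (volume.restrict (ball r ε ∩ Ioo (0 : ℝ) 1)) :=
      ⟨by rwa [Measure.restrict_apply_univ]⟩
    refine Integrable.of_bound (C := L) (hm.mono_set inter_subset_right) ?_
    filter_upwards [ae_restrict_mem (measurableSet_ball.inter measurableSet_Ioo)] with s hs
    exact h2 s hs.1 hs.2

theorem integrable_sq_of_hasCompactSupport {f : ℝ → ℝ} (hf : Continuous f)
    (hfc : HasCompactSupport f) : Integrable (fun s => f s ^ 2) := by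
  have h1 : HasCompactSupport (fun s => f s ^ 2) :=
    hfc.comp_left (g := fun x : ℝ => x ^ 2) (by simp)
  exact (hf.pow 2).integrable_of_hasCompactSupport h1

theorem exists_bump : ∃ ψ : ℝ → ℝ, ContDiff ℝ 1 ψ ∧ HasCompactSupport ψ ∧
    (∀ s, 1 / 2 < |s| → ψ s = 0) ∧ ψ 0 = 1 := by
  let B : ContDiffBump (0 : ℝ) := ⟨1 / 4, 1 / 2, by norm_num, by norm_num⟩
  refine ⟨fun s => B s, B.contDiff, B.hasCompactSupport, fun s hs => ?_, ?_⟩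
  · exact B.zero_of_le_dist (by rw [dist_zero_right, Real.norm_eq_abs]; exact hs.le)
  · exact B.one_of_mem_closedBall (mem_closedBall_self (by norm_num [B]))

/-- If the second variation is nonnegative then its leading coefficient is nonnegative: concentrated
test functions make the gradient term dominate. -/
theorem leading_coefficient_nonneg {a b : ℝ → ℝ} (ha : ContinuousOn a (Ioo 0 1))
    (hb : LocallyIntegrableOn b (Ioo 0 1))
    (hbd : ∀ r ∈ Ioo (0 : ℝ) 1, ∃ L : ℝ, ∀ᶠ s in nhds r, b s ≤ L)
    (hs : ∀ κ : ℝ → ℝ, ContDiff ℝ 1 κ → HasCompactSupport κ → tsupport κ ⊆ Ioo 0 1 →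
      0 ≤ ∫ r in Ioo (0 : ℝ) 1, (a r * deriv κ r ^ 2 + b r * κ r ^ 2))
    {r : ℝ} (hr : r ∈ Ioo (0 : ℝ) 1) : 0 ≤ a r := by
  by_contra hneg
  rw [not_le] at hneg
  obtain ⟨L, hL⟩ := hbd r hr
  have h1 : ∀ᶠ s in nhds r, a s < a r / 2 :=
    (ha.continuousAt (isOpen_Ioo.mem_nhds hr)).eventually_lt_const (by linarith)
  obtain ⟨ε, hε, h2⟩ := Metric.eventually_nhds_iff_ball.1
    ((h1.and hL).and (isOpen_Ioo.mem_nhds hr))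
  obtain ⟨ψ, hψs, hψc, hψt, hψ0⟩ := exists_bump
  have hdc : Continuous (deriv ψ) := hψs.continuous_deriv le_rfl
  have hdk : HasCompactSupport (deriv ψ) := hψc.deriv
  set A := ∫ s, deriv ψ s ^ 2 with hA
  set A₀ := ∫ s, ψ s ^ 2 with hA₀
  have hdsq : ∀ f : ℝ → ℝ, Continuous f → HasCompactSupport f → Integrable (fun s => f s ^ 2) :=
    fun f => integrable_sq_of_hasCompactSupport
  have hApos : 0 < A := by
    have hne : ∃ s, deriv ψ s ≠ 0 := by
      by_contra hcon
      push Not at hcon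
      have hconst := is_const_of_deriv_eq_zero (hψs.differentiable one_ne_zero) hcon 0 1
      have e2 : ψ 1 = 0 := hψt 1 (by norm_num)
      linarith [hψ0]
    obtain ⟨s, hs0⟩ := hne
    refine Continuous.integral_pos_of_hasCompactSupport_nonneg_nonzero (x := s) (hdc.pow 2) ?_
      (fun s => sq_nonneg _) (pow_ne_zero 2 hs0)
    exact hdk.comp_left (g := fun x : ℝ => x ^ 2) (by simp)
  -- Rescaled bumps concentrated at `r`.
  have key : ∀ N : ℝ, 1 / ε < N → 0 ≤ a r / 2 * (N * A) + |L| * (N⁻¹ * A₀) := by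
    intro N hN
    have hN0 : 0 < N := lt_trans (by positivity) hN
    set κ : ℝ → ℝ := fun s => ψ (N * (s - r)) with hκ
    have hκs : ContDiff ℝ 1 κ := hψs.comp (by fun_prop)
    have hκz : ∀ s, ε / 2 < |s - r| → κ s = 0 := by
      intro s hs
      refine hψt _ ?_
      rw [abs_mul, abs_of_pos hN0]
      rw [div_lt_iff₀ hε] at hN
      nlinarith
    have hκt : tsupport κ ⊆ closedBall r (ε / 2) := by
      refine closure_minimal (fun s hs => ?_) isClosed_closedBall
      by_contra h
      rw [mem_closedBall, Real.dist_eq, not_le] at h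
      exact hs (hκz s h)
    have hκball : tsupport κ ⊆ ball r ε :=
      hκt.trans (closedBall_subset_ball (by linarith))
    have hκI : tsupport κ ⊆ Ioo 0 1 := fun s hs => (h2 s (hκball hs)).2
    have hκc : HasCompactSupport κ :=
      (isCompact_closedBall r (ε / 2)).of_isClosed_subset (isClosed_tsupport _) hκt
    have hκd : ∀ s, deriv κ s = N * deriv ψ (N * (s - r)) := by
      intro s
      have h3 : HasDerivAt (fun s : ℝ => N * (s - r)) N s := by
        simpa using ((hasDerivAt_id s).sub_const r).const_mul N
      have h4 := (hψs.differentiable one_ne_zero (N * (s - r))).hasDerivAt.comp s h3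
      rw [mul_comm]
      exact h4.deriv
    have hκdc : Continuous (deriv κ) := hκs.continuous_deriv le_rfl
    have i1 : Integrable (fun s => a s * deriv κ s ^ 2) := by
      refine integrable_mul_of_tsupport_subset (ha.locallyIntegrableOn measurableSet_Ioo)
        (hκdc.pow 2) ?_ ?_
      · exact (hκc.deriv).comp_left (g := fun x : ℝ => x ^ 2) (by simp)
      · refine (closure_mono ?_).trans ((fun _ h => hκI (tsupport_deriv_subset h) :
          tsupport (deriv κ) ⊆ Ioo 0 1))
        intro s hs h0
        exact hs (by simp [h0])
    have i2 : Integrable (fun s => b s * κ s ^ 2) := by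
      refine integrable_mul_of_tsupport_subset hb (hκs.continuous.pow 2) ?_ ?_
      · exact hκc.comp_left (g := fun x : ℝ => x ^ 2) (by simp)
      · refine (closure_mono ?_).trans hκI
        intro s hs h0
        exact hs (by simp [h0])
    have e0 := hs κ hκs hκc hκI
    rw [setIntegral_eq_integral_of_forall_compl_eq_zero] at e0
    swap
    · intro s hs
      rw [image_eq_zero_of_notMem_tsupport fun h => hs (hκI h),
        image_eq_zero_of_notMem_tsupport fun h => hs (hκI (tsupport_deriv_subset h))]
      simp
    have j1 : Integrable (fun s => a r / 2 * deriv κ s ^ 2) :=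
      (hdsq _ hκdc hκc.deriv).const_mul _
    have j2 : Integrable (fun s => |L| * κ s ^ 2) := (hdsq _ hκs.continuous hκc).const_mul _
    have e1 : ∫ s, (a s * deriv κ s ^ 2 + b s * κ s ^ 2)
        ≤ ∫ s, (a r / 2 * deriv κ s ^ 2 + |L| * κ s ^ 2) := by
      refine integral_mono (i1.add i2) (j1.add j2) fun s => ?_
      by_cases hs : s ∈ tsupport κ
      · obtain ⟨⟨h3, h4⟩, -⟩ := h2 s (hκball hs)
        exact add_le_add (mul_le_mul_of_nonneg_right h3.le (sq_nonneg _))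
          (mul_le_mul_of_nonneg_right (h4.trans (le_abs_self _)) (sq_nonneg _))
      · simp only [image_eq_zero_of_notMem_tsupport hs,
          image_eq_zero_of_notMem_tsupport fun h => hs (tsupport_deriv_subset h)]
        simp
    rw [integral_add j1 j2, integral_const_mul, integral_const_mul] at e1
    have scale : ∀ f : ℝ → ℝ, ∫ s, f (N * (s - r)) = N⁻¹ * ∫ s, f s := by
      intro f
      rw [integral_sub_right_eq_self (fun s => f (N * s)) r, Measure.integral_comp_mul_left,
        abs_of_pos (inv_pos.2 hN0), smul_eq_mul]
    have e2 : ∫ s, deriv κ s ^ 2 = N * A := by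
      have : ∀ s, deriv κ s ^ 2 = N ^ 2 * (fun t => deriv ψ t ^ 2) (N * (s - r)) := fun s => by
        rw [hκd]; ring
      simp only [this]
      rw [integral_const_mul, scale (fun t => deriv ψ t ^ 2), hA]
      field_simp
    have e3 : ∫ s, κ s ^ 2 = N⁻¹ * A₀ := scale (fun t => ψ t ^ 2)
    rw [e2, e3] at e1
    exact e0.trans e1
  have hA₀0 : 0 ≤ A₀ := integral_nonneg fun s => sq_nonneg _
  set N := 1 / ε + 1 + 2 * (|L| * A₀ + 1) / (-(a r) * A) with hNdef
  have hden : 0 < -(a r) * A := mul_pos (by linarith) hApos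
  have hN1 : 1 / ε < N := by
    have : 0 < 2 * (|L| * A₀ + 1) / (-(a r) * A) := by positivity
    rw [hNdef]; linarith
  have hN2 : 1 ≤ N := by
    have : 0 < 2 * (|L| * A₀ + 1) / (-(a r) * A) := by positivity
    have : 0 < 1 / ε := by positivity
    rw [hNdef]; linarith
  have hN3 : 2 * (|L| * A₀ + 1) ≤ N * (-(a r) * A) := by
    rw [← div_le_iff₀ hden, hNdef]
    have : 0 < 1 / ε := by positivity
    linarith
  have h5 := key N hN1
  have h6 : |L| * (N⁻¹ * A₀) ≤ |L| * A₀ := by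
    refine mul_le_mul_of_nonneg_left ?_ (abs_nonneg _)
    exact mul_le_of_le_one_left hA₀0 (inv_le_one_of_one_le₀ hN2)
  nlinarith

/-- The one-dimensional problem solved by the profile `v` of a semistable radial solution, where
`q = v'`: the profile is nondecreasing, the flux `r^n (q/r)^k` satisfies the equation, and the
second variation is nonnegative on radial test functions. -/
structure IsRadialSolution (n k : ℕ) (g v q : ℝ → ℝ) : Prop where
  hasDerivAt : ∀ r ∈ Ioo (0 : ℝ) 1, HasDerivAt v (q r) r
  continuousOn : ContinuousOn q (Ioo 0 1)
  nonneg : ∀ r ∈ Ioo (0 : ℝ) 1, 0 ≤ q r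
  flux : ∀ r ∈ Ioo (0 : ℝ) 1, HasDerivAt (fun r => r ^ n * (q r / r) ^ k)
    (k / ((n - 1).choose (k - 1) : ℝ) * (r ^ (n - 1) * g (v r))) r
  stable : ∀ κ : ℝ → ℝ, ContDiff ℝ 1 κ → HasCompactSupport κ → tsupport κ ⊆ Ioo 0 1 →
    0 ≤ ∫ r in Ioo (0 : ℝ) 1, r ^ (n - 1) * (((n - 1).choose (k - 1) : ℝ) * (q r / r) ^ (k - 1)
      * deriv κ r ^ 2 + deriv g (v r) * κ r ^ 2)

theorem choose_pred_pos {n k : ℕ} (hk : 1 ≤ k) (hkn : k ≤ n) :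
    (0 : ℝ) < ((n - 1).choose (k - 1) : ℝ) :=
  Nat.cast_pos.2 (Nat.choose_pos (by omega))

namespace IsRadialJet

variable {n : ℕ} {u : E n → ℝ} {G : E n → E n} {H : E n → Matrix (Fin n) (Fin n) ℝ}
  {v q p' : ℝ → ℝ}

theorem continuousOn_profile (J : IsRadialJet u G H v q p') : ContinuousOn v (Ioo 0 1) :=
  fun r hr => (J.hasDerivAt r hr).continuousAt.continuousWithinAt

theorem continuousOn_div (J : IsRadialJet u G H v q p') :
    ContinuousOn (fun r => q r / r) (Ioo 0 1) :=
  J.continuousOn.div continuousOn_id fun _ hr => hr.1.ne'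

theorem isRadialSolution_of_isWeakSolution [Nontrivial (E n)] (J : IsRadialJet u G H v q p')
    {k : ℕ} (hk : 1 ≤ k) (hkn : k ≤ n) {g : ℝ → ℝ} (hg0 : ∀ t, 0 ≤ g t) (hg : LocallyLipschitz g)
    (hw : IsWeakSolution k g u G H) (hs : IsSemistable k g u H) : IsRadialSolution n k g v q := by
  have hc := choose_pred_pos hk hkn
  obtain ⟨hγ, hflux⟩ := J.flux_eq hk hw
  have hk0 : (0 : ℝ) < k := by exact_mod_cast hk
  have hpk : ∀ r ∈ Ioo (0 : ℝ) 1, 0 ≤ (q r / r) ^ k := by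
    intro r hr
    have h1 : 0 ≤ ∫ s in (0 : ℝ)..r, s ^ (n - 1) * g (v s) :=
      intervalIntegral.integral_nonneg hr.1.le fun s hs => mul_nonneg (pow_nonneg hs.1 _) (hg0 _)
    rw [← hflux r hr] at h1
    have h2 : 0 ≤ r ^ n * (q r / r) ^ k := nonneg_of_mul_nonneg_right h1 (by positivity)
    exact nonneg_of_mul_nonneg_right h2 (pow_pos hr.1 _)
  have hpk1 : ∀ r ∈ Ioo (0 : ℝ) 1, 0 ≤ (q r / r) ^ (k - 1) := by
    intro r hr
    have hrp : 0 < r ^ (n - 1) * ((n - 1).choose (k - 1) : ℝ) := mul_pos (pow_pos hr.1 _) hc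
    refine nonneg_of_mul_nonneg_right (leading_coefficient_nonneg
      (a := fun r => r ^ (n - 1) * ((n - 1).choose (k - 1) : ℝ) * (q r / r) ^ (k - 1))
      (b := fun r => deriv g (v r) * r ^ (n - 1)) ?_ ?_ ?_ ?_ hr) hrp
    · exact ContinuousOn.mul (by fun_prop) (J.continuousOn_div.pow _)
    · exact (locallyIntegrableOn_deriv_comp hg J.continuousOn_profile).mul_continuousOn
        (by fun_prop) isOpen_Ioo.isLocallyClosed
    · intro t ht
      obtain ⟨L, hL0, hL⟩ := exists_bound_deriv_of_locallyLipschitz hg (v t)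
      refine ⟨L, ?_⟩
      filter_upwards [(J.hasDerivAt t ht).continuousAt.eventually hL, isOpen_Ioo.mem_nhds ht]
        with s h1 h2
      have h3 : s ^ (n - 1) ≤ 1 := pow_le_one₀ h2.1.le h2.2.le
      have h4 : 0 ≤ s ^ (n - 1) := pow_nonneg h2.1.le _
      exact (mul_le_mul_of_nonneg_right ((le_abs_self _).trans h1) h4).trans
        (mul_le_of_le_one_right hL0 h3)
    · intro κ h1 h2 h3
      refine (J.radial_stability hk hs h1 h2 h3).trans (le_of_eq ?_)
      exact integral_congr_ae (Filter.Eventually.of_forall fun r => by simp only; ring)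
  refine ⟨J.hasDerivAt, J.continuousOn, fun r hr => ?_, fun r hr => ?_,
    fun κ h1 h2 h3 => J.radial_stability hk hs h1 h2 h3⟩
  · -- `p ^ k` and `p ^ (k - 1)` are both nonnegative, and one of the exponents is odd.
    have hp : 0 ≤ q r / r := by
      rcases Nat.even_or_odd k with he | ho
      · have : Odd (k - 1) := Nat.Even.sub_odd hk he odd_one
        exact this.pow_nonneg_iff.1 (hpk1 r hr)
      · exact ho.pow_nonneg_iff.1 (hpk r hr)
    have := mul_nonneg hp hr.1.le
    rwa [div_mul_cancel₀ _ hr.1.ne'] at this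
  · have hγc : ContinuousOn (fun s => s ^ (n - 1) * g (v s)) (Ioo 0 1) :=
      ContinuousOn.mul (by fun_prop) (hg.continuous.comp_continuousOn J.continuousOn_profile)
    have hγi : IntervalIntegrable (fun s => s ^ (n - 1) * g (v s)) volume 0 r := by
      rw [intervalIntegrable_iff_integrableOn_Ioo_of_le hr.1.le]
      exact hγ.mono_set (Ioo_subset_Ioo_right hr.2.le)
    have h1 := (intervalIntegral.integral_hasDerivAt_right hγi
      (hγc.stronglyMeasurableAtFilter isOpen_Ioo r hr)
      (hγc.continuousAt (isOpen_Ioo.mem_nhds hr))).const_mul (k / ((n - 1).choose (k - 1) : ℝ))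
    refine h1.congr_of_eventuallyEq ?_
    filter_upwards [isOpen_Ioo.mem_nhds hr] with s hs1
    rw [← hflux s hs1]
    field_simp

end IsRadialJet

theorem absolutelyContinuousOnInterval_pow {f : ℝ → ℝ} {a b : ℝ}
    (hf : AbsolutelyContinuousOnInterval f a b) (j : ℕ) :
    AbsolutelyContinuousOnInterval (fun r => f r ^ j) a b := by
  induction j with
  | zero =>
    simp only [pow_zero]
    exact (contDiff_const (c := (1 : ℝ))).contDiffOn.absolutelyContinuousOnInterval
  | succ j ih => simpa only [pow_succ] using ih.fun_mul hf

theorem IsClassicalSolution.ae_gradient_hessian {n : ℕ} [Nontrivial (E n)] {k : ℕ} {g : ℝ → ℝ}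
    {u : E n → ℝ} {G : E n → E n} {H : E n → Matrix (Fin n) (Fin n) ℝ}
    (hc : IsClassicalSolution k g u) (hG : HasWeakGradient (unitBall n \ {0}) u G)
    (hH : HasWeakJacobian (unitBall n \ {0}) G H) :
    ∀ᵐ x ∂(volume.restrict (unitBall n)),
      (∀ i, G x i = partialDeriv i u x) ∧ H x = hessian u x := by
  have hΩ := isOpen_punctured n
  have h1 : ContDiffOn ℝ 2 u (unitBall n \ {0}) := hc.contDiffOn.mono sdiff_subset
  have h2 : ∀ i, ContDiffOn ℝ 1 (partialDeriv i u) (unitBall n \ {0}) := fun i =>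
    (h1.fderiv_of_isOpen hΩ (m := 1) (by norm_num)).clm_apply contDiffOn_const
  have h3 : ∀ i, (fun x => G x i) =ᵐ[volume.restrict (unitBall n \ {0})] partialDeriv i u :=
    fun i => HasWeakPartialDeriv.ae_unique hΩ Filter.EventuallyEq.rfl (hG i)
      (hasWeakPartialDeriv_of_contDiffOn hΩ (h1.of_le (by norm_num)) i)
  have h4 : ∀ i j, (fun x => H x i j) =ᵐ[volume.restrict (unitBall n \ {0})]
      partialDeriv j (partialDeriv i u) :=
    fun i j => HasWeakPartialDeriv.ae_unique hΩ (h3 i) (hH i j)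
      (hasWeakPartialDeriv_of_contDiffOn hΩ (h2 i) j)
  rw [← restrict_punctured]
  have h5 := ae_all_iff.2 h3
  have h6 := ae_all_iff.2 fun i => ae_all_iff.2 (h4 i)
  filter_upwards [h5, h6] with x h7 h8
  exact ⟨h7, by ext i j; exact h8 i j⟩

namespace IsRadialJet

variable {n : ℕ} {u : E n → ℝ} {G : E n → E n} {H : E n → Matrix (Fin n) (Fin n) ℝ}
  {v q p' : ℝ → ℝ}

/-- `S_j(D²u)` is the derivative of the flux `r ^ n (q / r) ^ j`, up to the weight `r ^ (n - 1)` and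
a constant. -/
theorem integral_Sk (J : IsRadialJet u G H v q p') {j : ℕ} (hj : 1 ≤ j) (hn : 1 ≤ n)
    {σ : ℝ → ℝ} (hσ : ∀ᵐ r ∂(volume.restrict (Ioo (0 : ℝ) 1)), σ r
      = (n.choose j : ℝ) * (q r / r) ^ j
        + ((n - 1).choose (j - 1) : ℝ) * (q r / r) ^ (j - 1) * (r * p' r))
    {a b : ℝ} (ha : a ∈ Ioo (0 : ℝ) 1) (hb : b ∈ Ioo (0 : ℝ) 1) :
    ((n - 1).choose (j - 1) : ℝ) * (b ^ n * (q b / b) ^ j - a ^ n * (q a / a) ^ j)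
      = j * ∫ r in a..b, r ^ (n - 1) * σ r := by
  have hAC : AbsolutelyContinuousOnInterval (fun r => r ^ n * (q r / r) ^ j) a b :=
    ((contDiff_id.pow n).contDiffOn.absolutelyContinuousOnInterval
      (f := fun r : ℝ => r ^ n)).fun_mul
      (absolutelyContinuousOnInterval_pow (J.absolutelyContinuous a ha b hb) j)
  rw [← hAC.integral_deriv_eq_sub, ← intervalIntegral.integral_const_mul,
    ← intervalIntegral.integral_const_mul]
  refine intervalIntegral.integral_congr_ae ?_
  rw [ae_restrict_iff' measurableSet_Ioo] at hσ
  have hd := J.ae_hasDerivAt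
  rw [ae_restrict_iff' measurableSet_Ioo] at hd
  filter_upwards [hσ, hd] with r h1 h2 h3
  have hr := uIcc_subset_unit ha hb (uIoc_subset_uIcc h3)
  have hF : HasDerivAt (fun r => r ^ n * (q r / r) ^ j) _ r :=
    (hasDerivAt_pow n r).mul ((h2 hr).pow j)
  rw [h1 hr, hF.deriv]
  obtain ⟨m, rfl⟩ : ∃ m, n = m + 1 := ⟨n - 1, by omega⟩
  obtain ⟨i, rfl⟩ : ∃ i, j = i + 1 := ⟨j - 1, by omega⟩
  have h4 : ((m + 1 : ℕ) : ℝ) * (m.choose i : ℝ)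
      = ((m + 1).choose (i + 1) : ℝ) * ((i + 1 : ℕ) : ℝ) := by
    exact_mod_cast Nat.add_one_mul_choose_eq m i
  simp only [Nat.add_sub_cancel]
  generalize q r / r = p at *
  linear_combination (r ^ m * p ^ (i + 1)) * h4

theorem isRadialSolution_of_isClassicalSolution [Nontrivial (E n)] (J : IsRadialJet u G H v q p')
    (hn : 2 ≤ n) {k : ℕ} (hk : 1 ≤ k) (hkn : k ≤ n) {g : ℝ → ℝ} (hg : Continuous g)
    (hG : HasWeakGradient (unitBall n \ {0}) u G)
    (hH : HasWeakJacobian (unitBall n \ {0}) G H) (hc : IsClassicalSolution k g u)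
    (hs : IsSemistable k g u H) : IsRadialSolution n k g v q := by
  have hc0 := choose_pred_pos hk hkn
  have hae := hc.ae_gradient_hessian hG hH
  have hmem : ∀ᵐ x ∂(volume.restrict (unitBall n)), x ∈ unitBall n \ {0} := by
    rw [← restrict_punctured]; exact ae_restrict_mem (isOpen_punctured n).measurableSet
  have hSk : ∀ᵐ r ∂(volume.restrict (Ioo (0 : ℝ) 1)), g (v r)
      = (n.choose k : ℝ) * (q r / r) ^ k
        + ((n - 1).choose (k - 1) : ℝ) * (q r / r) ^ (k - 1) * (r * p' r) := by
    refine ae_Ioo_of_ae_ball (n := n) ?_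
    filter_upwards [hae, J.ae_Sk hk, hmem, J.ae_eq] with x h1 h2 h3 h4
    rw [← h2, h1.2, hc.equation x h3.1, h4]
  have hS1 : ∀ᵐ r ∂(volume.restrict (Ioo (0 : ℝ) 1)), 0 ≤ (n.choose 1 : ℝ) * (q r / r) ^ 1
        + ((n - 1).choose (1 - 1) : ℝ) * (q r / r) ^ (1 - 1) * (r * p' r) := by
    refine ae_Ioo_of_ae_ball (n := n) ?_
    filter_upwards [hae, J.ae_Sk le_rfl, hmem] with x h1 h2 h3
    rw [← h2, h1.2]
    exact (hc.admissible x h3.1 1 le_rfl hk).le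
  -- The gradient is bounded near the origin.
  obtain ⟨M, hM0, hM⟩ : ∃ M : ℝ, 0 ≤ M ∧ ∀ r ∈ Ioo (0 : ℝ) (1 / 2), q r ^ 2 ≤ M := by
    have h1 : ∀ i, ContinuousOn (partialDeriv i u) (closedBall 0 (1 / 2)) := fun i =>
      ((hc.contDiffOn.continuousOn_fderiv_of_isOpen isOpen_ball (by norm_num)).clm_apply
        continuousOn_const).mono (closedBall_subset_ball (by norm_num))
    have h2 : ContinuousOn (fun x => ∑ i, partialDeriv i u x ^ 2) (closedBall 0 (1 / 2)) :=
      continuousOn_finsetSum _ fun i _ => (h1 i).pow 2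
    obtain ⟨M, hM⟩ := (isCompact_closedBall (0 : E n) (1 / 2)).exists_bound_of_continuousOn h2
    have h3 : ∀ᵐ r ∂(volume.restrict (Ioo (0 : ℝ) 1)), r < 1 / 2 → q r ^ 2 ≤ M := by
      refine ae_Ioo_of_ae_ball (n := n) ?_
      filter_upwards [hae, J.ae_gradient, hmem] with x h4 h5 h6 h7
      have h8 : q ‖x‖ ^ 2 = ∑ i, partialDeriv i u x ^ 2 := by
        have h9 : ∀ i, partialDeriv i u x ^ 2 = q ‖x‖ ^ 2 / ‖x‖ ^ 2 * x i ^ 2 := fun i => by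
          rw [← h4.1 i, h5 i]; ring
        simp only [h9]
        rw [← Finset.mul_sum, sum_sq_eq_norm_sq, div_mul_cancel₀]
        exact pow_ne_zero 2 (norm_mem_Ioo h6).1.ne'
      rw [h8]
      exact (le_abs_self _).trans (hM x (mem_closedBall_zero_iff.2 h7.le))
    have h4 : (fun r => max (q r ^ 2) M) =ᵐ[volume.restrict (Ioo (0 : ℝ) (1 / 2))] fun _ => M := by
      have h5 := ae_restrict_of_ae_restrict_of_subset
        (Ioo_subset_Ioo_right (by norm_num : (1 / 2 : ℝ) ≤ 1)) h3
      filter_upwards [h5, ae_restrict_mem measurableSet_Ioo] with r h6 h7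
      exact max_eq_right (h6 h7.2)
    have h5 : ContinuousOn q (Ioo 0 (1 / 2)) :=
      J.continuousOn.mono (Ioo_subset_Ioo_right (by norm_num))
    have h6 := Measure.eqOn_open_of_ae_eq h4 isOpen_Ioo
      ((h5.pow 2).sup continuousOn_const) continuousOn_const
    have h7 : ∀ r ∈ Ioo (0 : ℝ) (1 / 2), q r ^ 2 ≤ M := fun r hr => by
      exact (le_max_left _ _).trans (h6 hr).le
    exact ⟨M, (sq_nonneg _).trans (h7 (1 / 4) (by norm_num)), h7⟩
  refine ⟨J.hasDerivAt, J.continuousOn, fun r hr => ?_, fun r hr => ?_,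
    fun κ h1 h2 h3 => J.radial_stability hk hs h1 h2 h3⟩
  · -- `r ^ (n - 1) q` is nondecreasing and tends to `0` at the origin.
    have hmono : ∀ s ∈ Ioo (0 : ℝ) 1, s ≤ r → s ^ (n - 1) * q s ≤ r ^ (n - 1) * q r := by
      intro s hs1 hsr
      have h1 := J.integral_Sk le_rfl (by omega)
        (Filter.Eventually.of_forall fun _ => rfl) hs1 hr
      have h2 : 0 ≤ ∫ t in s..r, t ^ (n - 1) * ((n.choose 1 : ℝ) * (q t / t) ^ 1
          + ((n - 1).choose (1 - 1) : ℝ) * (q t / t) ^ (1 - 1) * (t * p' t)) := by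
        refine intervalIntegral.integral_nonneg_of_ae_restrict hsr ?_
        have h3 : Icc s r ⊆ Ioo 0 1 := Icc_subset_unit hs1.1 hr.2
        filter_upwards [ae_restrict_of_ae_restrict_of_subset h3 hS1,
          ae_restrict_mem measurableSet_Icc] with t h4 h5
        exact mul_nonneg (pow_nonneg (h3 h5).1.le _) h4
      have h6 : ∀ t ∈ Ioo (0 : ℝ) 1, t ^ n * (q t / t) ^ 1 = t ^ (n - 1) * q t := by
        intro t ht
        have h7 : t ^ n = t ^ (n - 1) * t := by rw [← pow_succ]; congr 1; omega
        rw [h7, pow_one]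
        field_simp [ht.1.ne']
      rw [h6 s hs1, h6 r hr] at h1
      simp only [Nat.sub_self, Nat.choose_zero_right, Nat.cast_one, one_mul] at h1 h2
      linarith
    have hlim : ∀ᶠ s in nhdsWithin (0 : ℝ) (Ioi 0),
        -(s ^ (n - 1) * √M) ≤ r ^ (n - 1) * q r := by
      filter_upwards [Ioo_mem_nhdsGT (lt_min hr.1 (by norm_num : (0 : ℝ) < 1 / 2))] with s hs1
      have hs2 := lt_min_iff.1 hs1.2
      refine le_trans ?_ (hmono s ⟨hs1.1, hs2.1.trans hr.2⟩ hs2.1.le)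
      have h3 := Real.abs_le_sqrt (hM s ⟨hs1.1, hs2.2⟩)
      have h4 := (abs_le.1 h3).1
      have h5 : 0 ≤ s ^ (n - 1) := pow_nonneg hs1.1.le _
      nlinarith
    have hlim2 : Filter.Tendsto (fun s : ℝ => -(s ^ (n - 1) * √M)) (nhdsWithin 0 (Ioi 0))
        (nhds 0) := by
      have h3 : Continuous (fun s : ℝ => -(s ^ (n - 1) * √M)) := by fun_prop
      have h4 := h3.tendsto 0
      rw [zero_pow (by omega), zero_mul, neg_zero] at h4
      exact h4.mono_left nhdsWithin_le_nhds
    exact nonneg_of_mul_nonneg_right (le_of_tendsto hlim2 hlim)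
      (pow_pos hr.1 (n - 1))
  · have hγc : ContinuousOn (fun s => s ^ (n - 1) * g (v s)) (Ioo 0 1) :=
      ContinuousOn.mul (by fun_prop) (hg.comp_continuousOn J.continuousOn_profile)
    have hγi : IntervalIntegrable (fun s => s ^ (n - 1) * g (v s)) volume (1 / 2) r :=
      (hγc.mono (uIcc_subset_unit half_mem_unit hr)).intervalIntegrable
    have h1 := ((intervalIntegral.integral_hasDerivAt_right hγi
      (hγc.stronglyMeasurableAtFilter isOpen_Ioo r hr)
      (hγc.continuousAt (isOpen_Ioo.mem_nhds hr))).const_mul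
        (k / ((n - 1).choose (k - 1) : ℝ))).const_add ((1 / 2) ^ n * (q (1 / 2) / (1 / 2)) ^ k)
    refine h1.congr_of_eventuallyEq ?_
    filter_upwards [isOpen_Ioo.mem_nhds hr] with s hs1
    have h2 := J.integral_Sk hk (by omega) hSk half_mem_unit hs1
    rw [div_mul_eq_mul_div, ← h2]
    field_simp
    ring

end IsRadialJet

/-! ### The weighted Hardy inequality obtained from semistability -/

theorem contDiffOn_one_of_hasDerivAt {f f' : ℝ → ℝ} {U : Set ℝ} (hU : IsOpen U)
    (hf : ∀ x ∈ U, HasDerivAt f (f' x) x) (hf' : ContinuousOn f' U) : ContDiffOn ℝ 1 f U := by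
  have h := contDiffOn_succ_iff_deriv_of_isOpen (𝕜 := ℝ) (f := f) (n := 0) hU
  rw [zero_add] at h
  exact h.2 ⟨fun x hx => (hf x hx).differentiableAt.differentiableWithinAt, by simp,
    contDiffOn_zero.2 (hf'.congr fun x hx => (hf x hx).deriv)⟩

/-- At a point where `v` is a local `C¹` diffeomorphism, `g` is differentiable as soon as `g ∘ v`
is, so the chain rule holds although `g` is merely locally Lipschitz. -/
theorem deriv_comp_of_ne_zero {g v q : ℝ → ℝ} {r : ℝ} (hv : ∀ᶠ s in nhds r, HasDerivAt v (q s) s)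
    (hq : ContinuousAt q r) (h0 : q r ≠ 0) (hd : DifferentiableAt ℝ (fun s => g (v s)) r) :
    deriv (fun s => g (v s)) r = deriv g (v r) * q r := by
  have hs : HasStrictDerivAt v (q r) r := hasStrictDerivAt_of_hasDerivAt_of_continuousAt hv hq
  have h1 := hs.to_localInverse h0
  have h2 : hs.localInverse v (q r) r h0 (v r) = r :=
    (hs.eventually_left_inverse h0).self_of_nhds
  have h3 : HasDerivAt (fun t => g (v (hs.localInverse v (q r) r h0 t))) _ (v r) :=
    HasDerivAt.comp (h₂ := fun s => g (v s)) (v r) (by rw [h2]; exact hd.hasDerivAt) h1.hasDerivAt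
  have h4 : HasDerivAt g _ (v r) := h3.congr_of_eventuallyEq <| by
    filter_upwards [hs.eventually_right_inverse h0] with t ht
    rw [ht]
  have h5 : HasDerivAt (fun s => g (v s)) _ r :=
    (h4.differentiableAt.hasDerivAt).comp r hv.self_of_nhds
  exact h5.deriv

theorem absolutelyContinuousOnInterval_comp {g v : ℝ → ℝ} (hg : LocallyLipschitz g) {α β : ℝ}
    (hv : ContDiffOn ℝ 1 v (uIcc α β)) :
    AbsolutelyContinuousOnInterval (fun r => g (v r)) α β := by
  obtain ⟨K, hK⟩ := hv.exists_lipschitzOnWith (by decide) (convex_Icc _ _) isCompact_Icc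
  obtain ⟨L, hL⟩ := LocallyLipschitzOn.exists_lipschitzOnWith_of_compact
    (isCompact_uIcc.image_of_continuousOn hv.continuousOn)
    (hg.locallyLipschitzOn (s := v '' uIcc α β))
  exact (hL.comp hK (mapsTo_image _ _)).absolutelyContinuousOnInterval

namespace IsRadialSolution

variable {n k : ℕ} {g v q : ℝ → ℝ}

theorem isOpen_pos (S : IsRadialSolution n k g v q) : IsOpen {r | r ∈ Ioo (0 : ℝ) 1 ∧ 0 < q r} :=
  S.continuousOn.isOpen_inter_preimage isOpen_Ioo isOpen_Ioi

theorem continuousOn_profile (S : IsRadialSolution n k g v q) : ContinuousOn v (Ioo 0 1) :=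
  fun r hr => (S.hasDerivAt r hr).continuousAt.continuousWithinAt

/-- Where `q` does not vanish, `q / r` is a smooth function of the flux and of `r`. -/
theorem contDiffOn_div (S : IsRadialSolution n k g v q) (hk : 1 ≤ k) (hg : Continuous g) :
    ContDiffOn ℝ 1 (fun r => q r / r) {r | r ∈ Ioo (0 : ℝ) 1 ∧ 0 < q r} := by
  have h1 : ContDiffOn ℝ 1 (fun r => r ^ n * (q r / r) ^ k) (Ioo 0 1) := by
    refine contDiffOn_one_of_hasDerivAt isOpen_Ioo S.flux ?_
    exact continuousOn_const.mul (ContinuousOn.mul (by fun_prop)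
      (hg.comp_continuousOn S.continuousOn_profile))
  have h2 : ContDiffOn ℝ 1 (fun r => (r ^ n * (q r / r) ^ k / r ^ n) ^ ((k : ℝ)⁻¹))
      {r | r ∈ Ioo (0 : ℝ) 1 ∧ 0 < q r} := by
    refine ContDiffOn.rpow_const_of_ne (ContDiffOn.div (h1.mono fun r hr => hr.1)
      (contDiff_id.pow n).contDiffOn fun r hr => pow_ne_zero _ hr.1.1.ne') fun r hr => ?_
    have := hr.1.1
    have := hr.2
    positivity
  refine h2.congr fun r hr => ?_
  have h3 := hr.1.1
  rw [mul_div_cancel_left₀ _ (pow_ne_zero n h3.ne'),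
    Real.pow_rpow_inv_natCast (div_pos hr.2 h3).le (by omega)]

/-- Semistability tested with `q η`. Since `q = v'` solves the linearized equation up to lower order
terms, all derivatives of `q` disappear after integration by parts. -/
theorem weighted_hardy (S : IsRadialSolution n k g v q) (hk : 1 ≤ k) (hkn : k ≤ n)
    (hg : LocallyLipschitz g) {α β : ℝ} (hα : 0 < α) (hαβ : α ≤ β) (hβ : β < 1)
    (hpos : ∀ r ∈ Icc α β, 0 < q r) {η : ℝ → ℝ} (hη : ContDiff ℝ 1 η)
    (hz : ∀ r, r ∉ Icc α β → η r = 0) :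
    0 ≤ ∫ r in α..β, (q r / r) ^ (k + 1) * (r ^ (n + 1) * deriv η r ^ 2
      + 2 * ((k - 1) / (k + 1)) * r ^ n * η r * deriv η r
      - (2 * n - k - 1) / (k + 1) * r ^ (n - 1) * η r ^ 2) := by
  have hc := choose_pred_pos hk hkn
  set c : ℝ := ((n - 1).choose (k - 1) : ℝ) with hcdef
  set U : Set ℝ := {r | r ∈ Ioo (0 : ℝ) 1 ∧ 0 < q r} with hU
  have hUo : IsOpen U := S.isOpen_pos
  have hsub : Icc α β ⊆ U := fun r hr => ⟨Icc_subset_unit hα hβ hr, hpos r hr⟩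
  have hsub' : uIcc α β ⊆ U := by rwa [uIcc_of_le hαβ]
  set p : ℝ → ℝ := fun r => q r / r with hp
  have hpC : ContDiffOn ℝ 1 p U := S.contDiffOn_div hk hg.continuous
  have hpd : ∀ r ∈ U, HasDerivAt p (deriv p r) r := fun r hr =>
    ((hpC.differentiableOn one_ne_zero r hr).differentiableAt (hUo.mem_nhds hr)).hasDerivAt
  have hpc : ContinuousOn p (uIcc α β) := hpC.continuousOn.mono hsub'
  have hdpc : ContinuousOn (deriv p) (uIcc α β) :=
    (hpC.continuousOn_deriv_of_isOpen hUo le_rfl).mono hsub'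
  have hηd : ∀ r, HasDerivAt η (deriv η r) r := fun r =>
    (hη.differentiable one_ne_zero r).hasDerivAt
  have hηc : Continuous η := hη.continuous
  have hdηc : Continuous (deriv η) := hη.continuous_deriv le_rfl
  have hqp : ∀ r ∈ U, q r = r * p r := fun r hr => by
    have := hr.1.1.ne'
    simp only [hp]; field_simp
  have hηt : tsupport η ⊆ Icc α β :=
    closure_minimal (fun r hr => by_contra fun h => hr (hz r h)) isClosed_Icc
  have hηα : η α = 0 := by
    have h1 : closure (Iio α) ⊆ {r | η r = 0} :=
      (isClosed_eq hηc continuous_const).closure_subset_iff.2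
        fun r hr => hz r fun h => (not_le.2 hr) h.1
    exact h1 (by rw [closure_Iio]; exact self_mem_Iic)
  have hηβ : η β = 0 := by
    have h1 : closure (Ioi β) ⊆ {r | η r = 0} :=
      (isClosed_eq hηc continuous_const).closure_subset_iff.2
        fun r hr => hz r fun h => (not_le.2 hr) h.2
    exact h1 (by rw [closure_Ioi]; exact self_mem_Ici)
  -- The test function `κ = q η`.
  set κ : ℝ → ℝ := fun r => η r * (r * p r) with hκ
  have hκC : ContDiff ℝ 1 κ := contDiff_mul_of_tsupport_subset hUo hη.contDiffOn
    (hηt.trans hsub) (contDiff_id.contDiffOn.mul hpC)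
  have hκt : tsupport κ ⊆ Icc α β :=
    closure_minimal (fun r hr => by_contra fun h => hr (by simp [hκ, hz r h])) isClosed_Icc
  have hκd : ∀ r ∈ U, deriv κ r = deriv η r * (r * p r) + η r * (p r + r * deriv p r) :=
    fun r hr => by
      have h1 : HasDerivAt κ _ r := (hηd r).mul ((hasDerivAt_id r).mul (hpd r hr))
      rw [h1.deriv]; simp
  have e0 := S.stable κ hκC (isCompact_Icc.of_isClosed_subset (isClosed_tsupport _) hκt)
    (hκt.trans fun r hr => (hsub hr).1)
  rw [setIntegral_eq_of_subset_of_forall_sdiff_eq_zero measurableSet_Ioo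
    (fun r hr => (hsub hr).1 : Icc α β ⊆ Ioo 0 1)] at e0
  swap
  · intro r hr
    rw [image_eq_zero_of_notMem_tsupport fun h => hr.2 (hκt h),
      image_eq_zero_of_notMem_tsupport fun h => hr.2 (hκt (tsupport_deriv_subset h))]
    simp
  rw [integral_Icc_eq_integral_Ioc, ← intervalIntegral.integral_of_le hαβ] at e0
  -- Integration by parts in the zeroth order term.
  have hgv : AbsolutelyContinuousOnInterval (fun r => g (v r)) α β :=
    absolutelyContinuousOnInterval_comp hg <|
      (contDiffOn_one_of_hasDerivAt isOpen_Ioo S.hasDerivAt S.continuousOn).mono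
        fun r hr => (hsub' hr).1
  set w : ℝ → ℝ := fun r => r ^ n * p r * η r ^ 2 with hw
  have hwC : ContDiffOn ℝ 1 w U :=
    (((contDiff_id.pow n).contDiffOn).mul hpC).mul (hη.contDiffOn.pow 2)
  have hwAC : AbsolutelyContinuousOnInterval w α β :=
    (hwC.mono hsub').absolutelyContinuousOnInterval
  have hwd : ∀ r ∈ U, deriv w r = (n * r ^ (n - 1) * p r + r ^ n * deriv p r) * η r ^ 2
      + r ^ n * p r * (2 * η r * deriv η r) := fun r hr => by
    have h1 : HasDerivAt w _ r :=
      ((hasDerivAt_pow n r).mul (hpd r hr)).mul ((hηd r).pow 2)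
    rw [h1.deriv]
    simp only [Pi.mul_apply, Nat.cast_ofNat, Nat.add_one_sub_one, pow_one]
  have hparts := hgv.integral_mul_deriv_eq_deriv_mul hwAC
  have hwα : w α = 0 := by simp [hw, hηα]
  have hwβ : w β = 0 := by simp [hw, hηβ]
  rw [hwα, hwβ, mul_zero, mul_zero, sub_zero, zero_sub] at hparts
  have hB : ∀ᵐ r, r ∈ uIoc α β → deriv (fun r => g (v r)) r * w r
      = r ^ (n - 1) * (deriv g (v r) * κ r ^ 2) := by
    filter_upwards [hgv.ae_differentiableAt] with r h1 h2
    have h3 := hsub' (uIoc_subset_uIcc h2)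
    rw [deriv_comp_of_ne_zero
      (Filter.eventually_of_mem (isOpen_Ioo.mem_nhds h3.1) S.hasDerivAt)
      (S.continuousOn.continuousAt (isOpen_Ioo.mem_nhds h3.1)) h3.2.ne'
      (h1 (uIoc_subset_uIcc h2)), hqp r h3]
    have h4 : r ^ n = r ^ (n - 1) * r := by rw [← pow_succ]; congr 1; omega
    simp only [hw, hκ, h4]
    ring
  have iB' : IntervalIntegrable (fun r => deriv (fun r => g (v r)) r * w r) volume α β :=
    hgv.intervalIntegrable_deriv.mul_continuousOn hwAC.continuousOn
  have iB : IntervalIntegrable (fun r => r ^ (n - 1) * (deriv g (v r) * κ r ^ 2)) volume α β :=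
    iB'.congr_ae ((ae_restrict_iff' measurableSet_uIoc).2 hB)
  have eB := intervalIntegral.integral_congr_ae hB
  have iA : IntervalIntegrable (fun r => r ^ (n - 1) * (c * p r ^ (k - 1) * deriv κ r ^ 2))
      volume α β := by
    have h1 : Continuous (deriv κ) := hκC.continuous_deriv le_rfl
    exact ContinuousOn.intervalIntegrable (by fun_prop)
  have iG : IntervalIntegrable (fun r => g (v r) * deriv w r) volume α β :=
    (hgv.continuousOn.mul ((hwC.continuousOn_deriv_of_isOpen hUo le_rfl).mono
      hsub')).intervalIntegrable
  have e1 : 0 ≤ ∫ r in α..β, (r ^ (n - 1) * (c * p r ^ (k - 1) * deriv κ r ^ 2)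
      - g (v r) * deriv w r) := by
    rw [intervalIntegral.integral_sub iA iG, hparts, eB, sub_neg_eq_add,
      ← intervalIntegral.integral_add iA iB]
    refine e0.trans_eq (intervalIntegral.integral_congr fun r _ => ?_)
    simp only [hp]
    ring
  -- The remaining terms containing a derivative of `q` form a total derivative.
  set Φ : ℝ → ℝ := fun r => r ^ n * p r ^ (k + 1) * η r ^ 2 with hΦ
  have hΦC : ContDiffOn ℝ 1 Φ U :=
    (((contDiff_id.pow n).contDiffOn).mul (hpC.pow (k + 1))).mul (hη.contDiffOn.pow 2)
  have hΦd : ∀ r ∈ U, deriv Φ r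
      = (n * r ^ (n - 1) * p r ^ (k + 1) + r ^ n * ((k + 1) * p r ^ k * deriv p r)) * η r ^ 2
      + r ^ n * p r ^ (k + 1) * (2 * η r * deriv η r) := fun r hr => by
    have h1 : HasDerivAt Φ _ r :=
      ((hasDerivAt_pow n r).mul ((hpd r hr).pow (k + 1))).mul ((hηd r).pow 2)
    rw [h1.deriv]
    simp only [Pi.mul_apply, Pi.pow_apply, Nat.cast_ofNat, Nat.add_one_sub_one, pow_one,
      Nat.cast_add, Nat.cast_one]
  have eΦ : ∫ r in α..β, deriv Φ r = 0 := by
    rw [((hΦC.mono hsub').absolutelyContinuousOnInterval).integral_deriv_eq_sub]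
    simp [hΦ, hηα, hηβ]
  have iΦ : IntervalIntegrable (deriv Φ) volume α β :=
    ((hΦC.continuousOn_deriv_of_isOpen hUo le_rfl).mono hsub').intervalIntegrable
  set T : ℝ → ℝ := fun r => p r ^ (k + 1) * (r ^ (n + 1) * deriv η r ^ 2
      + 2 * ((k - 1) / (k + 1)) * r ^ n * η r * deriv η r
      - (2 * n - k - 1) / (k + 1) * r ^ (n - 1) * η r ^ 2) with hT
  have iT : IntervalIntegrable T volume α β := ContinuousOn.intervalIntegrable (by fun_prop)
  have e2 : ∫ r in α..β, (r ^ (n - 1) * (c * p r ^ (k - 1) * deriv κ r ^ 2)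
      - g (v r) * deriv w r)
      = ∫ r in α..β, (c * T r - c * ((n * (k + 1) - 2 * k) / (k * (k + 1))) * deriv Φ r) := by
    refine intervalIntegral.integral_congr fun r hr => ?_
    have hrU := hsub' hr
    have hr0 : r ≠ 0 := hrU.1.1.ne'
    have h1 : HasDerivAt (fun r => r ^ n * (q r / r) ^ k) _ r :=
      (hasDerivAt_pow n r).mul ((hpd r hrU).pow k)
    have h2 := (S.flux r hrU.1).unique h1
    have hk0 : (k : ℝ) ≠ 0 := by exact_mod_cast (by omega : k ≠ 0)
    have hk1 : (k : ℝ) + 1 ≠ 0 := by positivity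
    have h4 : r ^ n = r ^ (n - 1) * r := by rw [← pow_succ]; congr 1; omega
    have h5 : p r ^ k = p r ^ (k - 1) * p r := by rw [← pow_succ]; congr 1; omega
    simp only [hΦd r hrU, hwd r hrU, hκd r hrU, hT]
    have hR : r ^ (n - 1) ≠ 0 := pow_ne_zero _ hr0
    have h6 : g (v r) = c / k * (n * p r ^ k + r * (k * p r ^ (k - 1) * deriv p r)) := by
      rw [div_mul_eq_mul_div, div_eq_iff hc.ne'] at h2
      have h7 : (k : ℝ) * g (v r) = c * (n * p r ^ k + r * (k * p r ^ (k - 1) * deriv p r)) := by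
        refine mul_left_cancel₀ hR ?_
        linear_combination h2 + c * (k * p r ^ (k - 1) * deriv p r) * h4
      rw [div_mul_eq_mul_div, ← h7]
      field_simp
    rw [h6, pow_succ r n, pow_succ (p r) k, h4, h5]
    generalize r ^ (n - 1) = R
    generalize p r ^ (k - 1) = P
    field_simp
    ring
  rw [e2, intervalIntegral.integral_sub (iT.const_mul c) (iΦ.const_mul _),
    intervalIntegral.integral_const_mul, intervalIntegral.integral_const_mul, eΦ, mul_zero,
    sub_zero] at e1
  exact nonneg_of_mul_nonneg_right e1 hc

end IsRadialSolution

namespace IsRadialSolution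

variable {n k : ℕ} {g v q : ℝ → ℝ}

theorem ratio_nonneg (S : IsRadialSolution n k g v q) {r : ℝ} (hr : r ∈ Ioo (0 : ℝ) 1) :
    0 ≤ q r / r :=
  div_nonneg (S.nonneg r hr) hr.1.le

theorem flux_mono (S : IsRadialSolution n k g v q) (hg0 : ∀ t, 0 ≤ g t) :
    MonotoneOn (fun r => r ^ n * (q r / r) ^ k) (Ioo 0 1) := by
  refine monotoneOn_of_deriv_nonneg (convex_Ioo 0 1)
    (fun r hr => (S.flux r hr).continuousAt.continuousWithinAt) ?_ ?_
  · rw [interior_Ioo]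
    exact fun r hr => (S.flux r hr).differentiableAt.differentiableWithinAt
  · rw [interior_Ioo]
    intro r hr
    rw [(S.flux r hr).deriv]
    have := pow_nonneg hr.1.le (n - 1)
    have := hg0 (v r)
    positivity

theorem flux_pos_iff (S : IsRadialSolution n k g v q) (hk : 1 ≤ k) {r : ℝ}
    (hr : r ∈ Ioo (0 : ℝ) 1) : 0 < r ^ n * (q r / r) ^ k ↔ 0 < q r := by
  constructor
  · intro h
    refine (S.nonneg r hr).lt_of_ne fun h0 => ?_
    rw [← h0, zero_div, zero_pow (by omega), mul_zero] at h
    exact lt_irrefl _ h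
  · intro h
    have := hr.1
    positivity

theorem pos_of_le (S : IsRadialSolution n k g v q) (hk : 1 ≤ k) (hg0 : ∀ t, 0 ≤ g t) {r s : ℝ}
    (hr : r ∈ Ioo (0 : ℝ) 1) (hs : s ∈ Ioo (0 : ℝ) 1) (hrs : r ≤ s) (h : 0 < q r) : 0 < q s :=
  (S.flux_pos_iff hk hs).1 (((S.flux_pos_iff hk hr).2 h).trans_le (S.flux_mono hg0 hr hs hrs))

/-- The profile is constant up to some radius `a`, and strictly increasing afterwards. -/
theorem exists_threshold (S : IsRadialSolution n k g v q) (hk : 1 ≤ k) (hg0 : ∀ t, 0 ≤ g t)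
    {ρ : ℝ} (hρ : ρ ∈ Ioo (0 : ℝ) 1) (hq : 0 < q ρ) :
    ∃ a, 0 ≤ a ∧ a < ρ ∧ (∀ r ∈ Ioo a 1, 0 < q r) ∧ (0 < a → q a = 0) := by
  set Z : Set ℝ := {r | r = 0 ∨ (r ∈ Ioo (0 : ℝ) 1 ∧ q r = 0)} with hZ
  have hZρ : ∀ r ∈ Z, r ≤ ρ := by
    rintro r (rfl | ⟨hr, h0⟩)
    · exact hρ.1.le
    · by_contra h
      exact (S.pos_of_le hk hg0 hρ hr (not_le.1 h).le hq).ne' h0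
  have hZb : BddAbove Z := ⟨ρ, hZρ⟩
  have h0Z : (0 : ℝ) ∈ Z := Or.inl rfl
  have ha0 : 0 ≤ sSup Z := le_csSup hZb h0Z
  have haρ : sSup Z ≤ ρ := csSup_le ⟨0, h0Z⟩ hZρ
  have hqa : 0 < sSup Z → q (sSup Z) = 0 := by
    intro hpos
    have ha1 : sSup Z ∈ Ioo (0 : ℝ) 1 := ⟨hpos, haρ.trans_lt hρ.2⟩
    by_contra hne
    have hpa : 0 < q (sSup Z) := (S.nonneg _ ha1).lt_of_ne (Ne.symm hne)
    obtain ⟨ε, hε, hball⟩ := Metric.isOpen_iff.1 S.isOpen_pos _ ⟨ha1, hpa⟩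
    have hlt : max 0 (sSup Z - ε) < sSup Z := max_lt hpos (by linarith)
    obtain ⟨z, hz, hz1⟩ := exists_lt_of_lt_csSup ⟨0, h0Z⟩ hlt
    have hz2 := le_csSup hZb hz
    have hz3 := max_lt_iff.1 hz1
    have hzU := hball (show z ∈ ball (sSup Z) ε by
      rw [mem_ball, Real.dist_eq, abs_lt]; constructor <;> linarith)
    rcases hz with rfl | hz
    · exact lt_irrefl _ hz3.1
    · exact hzU.2.ne' hz.2
  refine ⟨sSup Z, ha0, haρ.lt_of_ne fun h => ?_, fun r hr => ?_, hqa⟩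
  · rw [h] at hqa
    exact hq.ne' (hqa hρ.1)
  · have hr1 : r ∈ Ioo (0 : ℝ) 1 := ⟨ha0.trans_lt hr.1, hr.2⟩
    refine (S.nonneg r hr1).lt_of_ne fun h => ?_
    exact not_le.2 hr.1 (le_csSup hZb (Or.inr ⟨hr1, h.symm⟩))

theorem continuousOn_energy (S : IsRadialSolution n k g v q) :
    ContinuousOn (fun r => r ^ (n + 1) * (q r / r) ^ (k + 1)) (Ioo 0 1) :=
  ContinuousOn.mul (by fun_prop)
    ((S.continuousOn.div continuousOn_id fun _ hr => hr.1.ne').pow _)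

/-- The cost of cutting off near the threshold `a` can be made arbitrarily small. If `a = 0` this is
the integrability of the energy; if `a > 0` then `g (v a) = 0`, and the Lipschitz continuity of `g`
makes the flux vanish to second order at `a`. -/
theorem exists_small_collar (S : IsRadialSolution n k g v q) (hk : 1 ≤ k) (hkn : k ≤ n)
    (hg : LocallyLipschitz g)
    (hm : IntegrableOn (fun r => r ^ (n + 1) * (q r / r) ^ (k + 1)) (Ioo 0 1)) {a ρ : ℝ}
    (ha : 0 ≤ a) (haρ : a < ρ) (hρ : ρ < 1) (h0 : 0 < a → q a = 0) {δ : ℝ} (hδ : 0 < δ) :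
    ∃ ε, 0 < ε ∧ a + 2 * ε < ρ ∧
      ∫ r in (a + ε)..(a + 2 * ε), r ^ (n + 1) * (q r / r) ^ (k + 1) * (1 + r / ε) ^ 2 ≤ δ := by
  set M : ℝ → ℝ := fun r => r ^ (n + 1) * (q r / r) ^ (k + 1) with hM
  have hM0 : ∀ r ∈ Ioo (0 : ℝ) 1, 0 ≤ M r := fun r hr => by
    have := S.ratio_nonneg hr
    have := hr.1
    positivity
  have hint : ∀ ε, 0 < ε → a + 2 * ε < ρ → IntervalIntegrable
      (fun r => M r * (1 + r / ε) ^ 2) volume (a + ε) (a + 2 * ε) := by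
    intro ε hε hερ
    refine ContinuousOn.intervalIntegrable (ContinuousOn.mul (S.continuousOn_energy.mono ?_)
      (by fun_prop))
    exact uIcc_subset_unit ⟨by linarith, by linarith⟩ ⟨by linarith, by linarith⟩
  rcases ha.eq_or_lt with rfl | ha0
  · have hm' : IntervalIntegrable M volume 0 1 := by
      rwa [intervalIntegrable_iff_integrableOn_Ioo_of_le zero_le_one]
    have hc : ContinuousOn (fun x => ∫ r in (0 : ℝ)..x, M r) (uIcc 0 1) :=
      intervalIntegral.continuousOn_primitive_interval' hm' left_mem_uIcc
    have h1 : ∀ᶠ x in nhdsWithin (0 : ℝ) (uIcc 0 1), ∫ r in (0 : ℝ)..x, M r < δ / 9 := by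
      have h2 : Filter.Tendsto _ _ _ := hc 0 left_mem_uIcc
      simp only [intervalIntegral.integral_same] at h2
      exact h2.eventually_lt_const (by positivity)
    rw [uIcc_of_le zero_le_one, eventually_nhdsWithin_iff, Metric.eventually_nhds_iff_ball] at h1
    obtain ⟨η, hη, h3⟩ := h1
    set x := min (η / 2) (ρ / 2) with hx
    have hx0 : 0 < x := lt_min (by positivity) (by positivity)
    have hx1 : x ≤ η / 2 := min_le_left _ _
    have hx2 : x ≤ ρ / 2 := min_le_right _ _
    have h4 := h3 x (by rw [mem_ball, Real.dist_eq, abs_lt]; constructor <;> linarith)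
      ⟨hx0.le, by linarith⟩
    refine ⟨x / 2, by positivity, by linarith, ?_⟩
    have e1 : (0 : ℝ) + 2 * (x / 2) = x := by ring
    have e2 : (0 : ℝ) + x / 2 = x / 2 := by ring
    have h5 := hint (x / 2) (by positivity) (by linarith)
    rw [e1, e2] at h5 ⊢
    have hMi : IntervalIntegrable M volume 0 x := hm'.mono_set (by
      rw [uIcc_of_le hx0.le, uIcc_of_le zero_le_one]; exact Icc_subset_Icc_right (by linarith))
    have hMi2 : IntervalIntegrable M volume (x / 2) x := hMi.mono_set (by
      rw [uIcc_of_le hx0.le, uIcc_of_le (by linarith)]; exact Icc_subset_Icc_left (by linarith))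
    have hMi1 : IntervalIntegrable M volume 0 (x / 2) := hMi.mono_set (by
      rw [uIcc_of_le hx0.le, uIcc_of_le (by linarith)]; exact Icc_subset_Icc_right (by linarith))
    have h6 : ∫ r in (x / 2)..x, M r * (1 + r / (x / 2)) ^ 2 ≤ ∫ r in (x / 2)..x, 9 * M r := by
      refine intervalIntegral.integral_mono_on (by linarith) h5 (hMi2.const_mul 9) fun r hr => ?_
      have h7 : r / (x / 2) ≤ 2 := by rw [div_le_iff₀ (by positivity)]; linarith [hr.2]
      have h8 : 0 ≤ r / (x / 2) := div_nonneg (by linarith [hr.1]) (by positivity)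
      have h9 := hM0 r ⟨by linarith [hr.1], by linarith [hr.2]⟩
      have h12 : (1 + r / (x / 2)) ^ 2 ≤ 3 ^ 2 := pow_le_pow_left₀ (by linarith) (by linarith) 2
      linarith [mul_le_mul_of_nonneg_left h12 h9]
    rw [intervalIntegral.integral_const_mul] at h6
    have h10 : 0 ≤ ∫ r in (0 : ℝ)..(x / 2), M r :=
      intervalIntegral.integral_nonneg_of_ae_restrict (by linarith) <| by
        filter_upwards [ae_restrict_mem measurableSet_Icc,
          ae_restrict_of_ae (Measure.ae_ne volume (0 : ℝ))] with r hr hr0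
        exact hM0 r ⟨hr.1.lt_of_ne (Ne.symm hr0), by linarith [hr.2]⟩
    have h11 := intervalIntegral.integral_add_adjacent_intervals hMi1 hMi2
    linarith
  · have haI : a ∈ Ioo (0 : ℝ) 1 := ⟨ha0, haρ.trans hρ⟩
    have hc := choose_pred_pos hk hkn
    set F : ℝ → ℝ := fun r => r ^ n * (q r / r) ^ k with hF
    have hF0 : ∀ r ∈ Ioo (0 : ℝ) 1, 0 ≤ F r := fun r hr => by
      have := S.ratio_nonneg hr
      have := hr.1
      positivity
    have hFa : F a = 0 := by simp only [hF, h0 ha0, zero_div, zero_pow (by omega : k ≠ 0), mul_zero]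
    have hga : g (v a) = 0 := by
      have h1 : IsLocalMin F a := by
        filter_upwards [isOpen_Ioo.mem_nhds haI] with r hr
        rw [hFa]; exact hF0 r hr
      have h2 := h1.hasDerivAt_eq_zero (S.flux a haI)
      have hk0 : (k : ℝ) ≠ 0 := by exact_mod_cast (by omega : k ≠ 0)
      have h3 : (k : ℝ) / ((n - 1).choose (k - 1) : ℝ) ≠ 0 := div_ne_zero hk0 hc.ne'
      have h4 := (mul_eq_zero.1 h2).resolve_left h3
      exact (mul_eq_zero.1 h4).resolve_left (pow_ne_zero _ ha0.ne')
    obtain ⟨L, V, hV, hL⟩ := hg (v a)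
    obtain ⟨C, hC0, hC⟩ := (S.hasDerivAt a haI).isBigO_sub.exists_pos
    have hqa : ∀ᶠ r in nhds a, q r < 1 :=
      (S.continuousOn.continuousAt (isOpen_Ioo.mem_nhds haI)).eventually_lt_const
        (by rw [h0 ha0]; exact one_pos)
    obtain ⟨η, hη, h1⟩ := Metric.eventually_nhds_iff_ball.1
      (((hC.bound.and hqa).and ((S.hasDerivAt a haI).continuousAt.eventually hV)).and
        (isOpen_Ioo.mem_nhds haI))
    set B : ℝ := k / ((n - 1).choose (k - 1) : ℝ) * (L * C) with hB
    have hB0 : 0 ≤ B := by have := L.2; positivity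
    have hgB : ∀ r ∈ ball a η, g (v r) ≤ L * C * |r - a| := by
      intro r hr
      have h2 := h1 r hr
      have h3 := hL.dist_le_mul _ h2.1.2 _ (mem_of_mem_nhds hV)
      rw [hga, Real.dist_eq, Real.dist_eq, sub_zero] at h3
      have h4 := h2.1.1.1
      rw [Real.norm_eq_abs, Real.norm_eq_abs] at h4
      calc g (v r) ≤ |g (v r)| := le_abs_self _
        _ ≤ L * |v r - v a| := h3
        _ ≤ L * (C * |r - a|) := mul_le_mul_of_nonneg_left h4 L.2
        _ = L * C * |r - a| := by ring
    -- The flux vanishes to second order at `a`.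
    have hFB : ∀ r ∈ Ioo a (a + η), F r ≤ B * (r - a) ^ 2 := by
      intro r hr
      have hs : Icc a r ⊆ ball a η := fun s hs => by
        rw [mem_ball, Real.dist_eq, abs_of_nonneg (by linarith [hs.1])]
        linarith [hs.2, hr.2]
      have h2 : ∀ s ∈ Icc a r, s ∈ Ioo (0 : ℝ) 1 := fun s hs' => (h1 s (hs hs')).2
      have h3 := (convex_Icc a r).image_sub_le_mul_sub_of_deriv_le (f := F) (C := B * (r - a))
        (fun s hs' => (S.flux s (h2 s hs')).continuousAt.continuousWithinAt)
        (fun s hs' =>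
          (S.flux s (h2 s (interior_subset hs'))).differentiableAt.differentiableWithinAt)
        (fun s hs' => by
          have hs1 := interior_subset hs'
          have hs2 := h2 s hs1
          rw [(S.flux s hs2).deriv]
          have h4 := hgB s (hs hs1)
          rw [abs_of_nonneg (by linarith [hs1.1])] at h4
          have h5 : s ^ (n - 1) ≤ 1 := pow_le_one₀ hs2.1.le hs2.2.le
          have h6 : 0 ≤ s ^ (n - 1) := pow_nonneg hs2.1.le _
          have h7 : (0 : ℝ) ≤ L * C := mul_nonneg L.2 hC0.le
          rw [hB, mul_assoc]
          refine mul_le_mul_of_nonneg_left ?_ (by positivity)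
          calc s ^ (n - 1) * g (v s) ≤ s ^ (n - 1) * (L * C * (r - a)) := by
                refine mul_le_mul_of_nonneg_left (h4.trans ?_) h6
                exact mul_le_mul_of_nonneg_left (by linarith [hs1.2]) h7
            _ ≤ 1 * (L * C * (r - a)) :=
                mul_le_mul_of_nonneg_right h5 (mul_nonneg h7 (by linarith [hr.1]))
            _ = L * C * (r - a) := one_mul _)
        a (left_mem_Icc.2 hr.1.le) r (right_mem_Icc.2 hr.1.le) hr.1.le
      rw [hFa] at h3
      linarith
    set ε := min (min (η / 4) ((ρ - a) / 4)) (min 1 (δ / (16 * B + 1))) with hε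
    have hε0 : 0 < ε :=
      lt_min (lt_min (by positivity) (by linarith)) (lt_min one_pos (by positivity))
    have hε1 : ε ≤ η / 4 := (min_le_left _ _).trans (min_le_left _ _)
    have hε2 : ε ≤ (ρ - a) / 4 := (min_le_left _ _).trans (min_le_right _ _)
    have hε3 : ε ≤ 1 := (min_le_right _ _).trans (min_le_left _ _)
    have hε4 : ε ≤ δ / (16 * B + 1) := (min_le_right _ _).trans (min_le_right _ _)
    refine ⟨ε, hε0, by linarith, ?_⟩
    have h2 : ∫ r in (a + ε)..(a + 2 * ε), M r * (1 + r / ε) ^ 2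
        ≤ ∫ r in (a + ε)..(a + 2 * ε), 16 * B := by
      refine intervalIntegral.integral_mono_on (by linarith) (hint ε hε0 (by linarith))
        intervalIntegrable_const fun r hr => ?_
      have hra : r ∈ Ioo a (a + η) := ⟨by linarith [hr.1], by linarith [hr.2]⟩
      have hrb : r ∈ ball a η := by
        rw [mem_ball, Real.dist_eq, abs_of_nonneg (by linarith [hra.1])]; linarith [hra.2]
      have hr1 := (h1 r hrb).2
      have h3 : M r = F r * q r := by
        simp only [hM, hF]
        have := hr1.1.ne'
        rw [pow_succ, pow_succ]
        field_simp
      have h4 : M r ≤ B * (2 * ε) ^ 2 := by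
        rw [h3]
        calc F r * q r ≤ F r * 1 := mul_le_mul_of_nonneg_left (h1 r hrb).1.1.2.le (hF0 r hr1)
          _ ≤ B * (r - a) ^ 2 := by rw [mul_one]; exact hFB r hra
          _ ≤ B * (2 * ε) ^ 2 := by
            refine mul_le_mul_of_nonneg_left (pow_le_pow_left₀ (by linarith [hra.1]) ?_ 2) hB0
            linarith [hr.2]
      have h5 : (1 + r / ε) ^ 2 ≤ (2 / ε) ^ 2 := by
        refine pow_le_pow_left₀ (by have := hr1.1; positivity) ?_ 2
        rw [← sub_nonneg]
        have : 2 / ε - (1 + r / ε) = (2 - ε - r) / ε := by field_simp; ring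
        rw [this]
        exact div_nonneg (by linarith [hr1.2]) hε0.le
      calc M r * (1 + r / ε) ^ 2 ≤ B * (2 * ε) ^ 2 * (2 / ε) ^ 2 :=
            mul_le_mul h4 h5 (sq_nonneg _) (by positivity)
        _ = 16 * B := by field_simp; ring
    rw [intervalIntegral.integral_const, smul_eq_mul] at h2
    rw [le_div_iff₀ (by positivity)] at hε4
    nlinarith

end IsRadialSolution

/-! ### Decay of the energy on dyadic annuli -/

/-- A cutoff between `a + ε` and `3/4`, equal to `1` between `a + 2ε` and `1/2`; the constant `K`
does not depend on `a` and `ε`. -/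
theorem exists_cutoff : ∃ K : ℝ, 0 ≤ K ∧ ∀ a ε : ℝ, 0 < ε → a + 2 * ε < 1 / 2 →
    ∃ τ : ℝ → ℝ, ContDiff ℝ 1 τ ∧ (∀ r, 0 ≤ τ r ∧ τ r ≤ 1) ∧
      (∀ r, r ∉ Icc (a + ε) (3 / 4) → τ r = 0) ∧
      (∀ r ∈ Ioo (a + ε) (a + 2 * ε), |deriv τ r| ≤ K / ε) ∧
      (∀ r ∈ Ioo (a + 2 * ε) (1 / 2), τ r = 1 ∧ deriv τ r = 0) ∧
      ∀ r ∈ Ioo (1 / 2 : ℝ) (3 / 4), |deriv τ r| ≤ K := by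
  set θ := Real.smoothTransition with hθ
  have hθC : ContDiff ℝ 1 θ := Real.smoothTransition.contDiff (n := 1)
  have hθd : ∀ x, HasDerivAt θ (deriv θ x) x := fun x =>
    (hθC.differentiable one_ne_zero x).hasDerivAt
  have hθ1 : ∀ x, 1 < x → deriv θ x = 0 := by
    intro x hx
    have h1 : θ =ᶠ[nhds x] fun _ => 1 := by
      filter_upwards [Ioi_mem_nhds hx] with y hy
      exact Real.smoothTransition.one_of_one_le (le_of_lt hy)
    rw [h1.deriv_eq, deriv_const]
  obtain ⟨K, hK⟩ := (isCompact_Icc (a := (0 : ℝ)) (b := 1)).exists_bound_of_continuousOn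
    (hθC.continuous_deriv le_rfl).continuousOn
  have hK0 : 0 ≤ K := (norm_nonneg _).trans (hK 0 (by simp))
  refine ⟨4 * K, by positivity, fun a ε hε haε => ?_⟩
  set τ : ℝ → ℝ := fun r => θ ((r - a - ε) / ε) * θ (3 - 4 * r) with hτ
  have hτd : ∀ r, deriv τ r = deriv θ ((r - a - ε) / ε) / ε * θ (3 - 4 * r)
      - 4 * (θ ((r - a - ε) / ε) * deriv θ (3 - 4 * r)) := by
    intro r
    have h1 : HasDerivAt (fun r => (r - a - ε) / ε) (1 / ε) r :=
      (((hasDerivAt_id r).sub_const a).sub_const ε).div_const ε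
    have h2 : HasDerivAt (fun r => 3 - 4 * r) (-(4 * 1)) r :=
      ((hasDerivAt_id r).const_mul 4).const_sub 3
    have h3 : HasDerivAt τ _ r := ((hθd _).comp r h1).mul ((hθd _).comp r h2)
    rw [h3.deriv]
    simp only [Function.comp_apply]
    ring
  have hθa : ∀ x, |θ x| ≤ 1 := fun x => by
    rw [abs_of_nonneg (Real.smoothTransition.nonneg x)]
    exact Real.smoothTransition.le_one x
  refine ⟨τ, ?_, fun r => ⟨?_, ?_⟩, fun r hr => ?_, fun r hr => ?_, fun r hr => ⟨?_, ?_⟩,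
    fun r hr => ?_⟩
  · exact (hθC.comp (by fun_prop)).mul (hθC.comp (by fun_prop))
  · exact mul_nonneg (Real.smoothTransition.nonneg _) (Real.smoothTransition.nonneg _)
  · exact mul_le_one₀ (Real.smoothTransition.le_one _) (Real.smoothTransition.nonneg _)
      (Real.smoothTransition.le_one _)
  · rw [mem_Icc, not_and_or, not_le, not_le] at hr
    rcases hr with hr | hr
    · have h1 : θ ((r - a - ε) / ε) = 0 := Real.smoothTransition.zero_of_nonpos
        (div_nonpos_of_nonpos_of_nonneg (by linarith) hε.le)
      simp only [hτ, h1, zero_mul]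
    · have h1 : θ (3 - 4 * r) = 0 := Real.smoothTransition.zero_of_nonpos (by linarith)
      simp only [hτ, h1, mul_zero]
  · rw [hτd, hθ1 (3 - 4 * r) (by linarith [hr.2]), mul_zero, mul_zero, sub_zero, abs_mul, abs_div,
      abs_of_pos hε]
    have h1 : |deriv θ ((r - a - ε) / ε)| ≤ K := hK _
      ⟨div_nonneg (by linarith [hr.1]) hε.le, by rw [div_le_one hε]; linarith [hr.2]⟩
    calc |deriv θ ((r - a - ε) / ε)| / ε * |θ (3 - 4 * r)|
        ≤ K / ε * 1 := by
          refine mul_le_mul ?_ (hθa _) (abs_nonneg _) (by positivity)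
          exact div_le_div_of_nonneg_right h1 hε.le
      _ ≤ 4 * K / ε := by
          rw [mul_one]
          exact div_le_div_of_nonneg_right (by linarith) hε.le
  · have h1 : θ ((r - a - ε) / ε) = 1 := Real.smoothTransition.one_of_one_le
      (by rw [le_div_iff₀ hε]; linarith [hr.1])
    have h2 : θ (3 - 4 * r) = 1 := Real.smoothTransition.one_of_one_le (by linarith [hr.2])
    simp only [hτ, h1, h2, one_mul]
  · rw [hτd, hθ1 (3 - 4 * r) (by linarith [hr.2]), hθ1 ((r - a - ε) / ε)
      (by rw [lt_div_iff₀ hε]; linarith [hr.1])]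
    simp
  · rw [hτd, hθ1 ((r - a - ε) / ε) (by rw [lt_div_iff₀ hε]; linarith [hr.1]), zero_div, zero_mul,
      zero_sub, abs_neg, abs_mul, abs_mul, abs_of_pos (by norm_num : (0 : ℝ) < 4)]
    have h1 : |deriv θ (3 - 4 * r)| ≤ K := hK _ ⟨by linarith [hr.2], by linarith [hr.1]⟩
    have h2 : |θ ((r - a - ε) / ε)| * |deriv θ (3 - 4 * r)| ≤ 1 * K :=
      mul_le_mul (hθa _) h1 (abs_nonneg _) one_pos.le
    linarith

/-- The exponent `α` for which `r ^ (-α)` is an extremal of the quadratic form of the weighted Hardy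
inequality; it is minus the negative root of `X² + 2bX - (2n - k - 1) / (k + 1)`, where
`b = (k - 1) / (k + 1)`. -/
noncomputable def hardyExponent (n k : ℕ) : ℝ :=
  ((k : ℝ) - 1 + √(2 * ((k : ℝ) + 1) * n - 4 * k)) / (k + 1)

theorem hardyExponent_mul {n k : ℕ} (hk : 1 ≤ k) (h2k : 2 * k ≤ n) :
    hardyExponent n k * (hardyExponent n k - 2 * (((k : ℝ) - 1) / (k + 1)))
      = (2 * n - k - 1) / (k + 1) := by
  have h1 : (1 : ℝ) ≤ k := by exact_mod_cast hk
  have h2 : (2 : ℝ) * k ≤ n := by exact_mod_cast h2k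
  have h3 := Real.sq_sqrt (show 0 ≤ 2 * ((k : ℝ) + 1) * n - 4 * k by nlinarith)
  have h4 : (k : ℝ) + 1 ≠ 0 := by positivity
  rw [hardyExponent]
  set s := √(2 * ((k : ℝ) + 1) * n - 4 * k)
  field_simp
  linear_combination h3

/-- The positive root of the quadratic polynomial is at least `1` exactly when `n ≥ 2k`. -/
theorem one_le_hardyExponent_sub {n k : ℕ} (h2k : 2 * k ≤ n) :
    1 ≤ hardyExponent n k - 2 * (((k : ℝ) - 1) / (k + 1)) := by
  have h2 : (2 : ℝ) * k ≤ n := by exact_mod_cast h2k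
  have h4 : (0 : ℝ) < (k : ℝ) + 1 := by positivity
  have h5 : 2 * (k : ℝ) ≤ √(2 * ((k : ℝ) + 1) * n - 4 * k) := by
    apply Real.le_sqrt_of_sq_le
    have : (0 : ℝ) ≤ (k : ℝ) := Nat.cast_nonneg k
    nlinarith
  have h6 : hardyExponent n k - 2 * (((k : ℝ) - 1) / (k + 1))
      = (√(2 * ((k : ℝ) + 1) * n - 4 * k) - (k - 1)) / (k + 1) := by
    rw [hardyExponent]; field_simp; ring
  rw [h6, le_div_iff₀ h4]
  linarith

/-- The quadratic form where the cutoff is `1`: here `t = r / (ρ + r)`, and `1 - (1 + e) t` is the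
logarithmic derivative of `r / (ρ + r) ^ (1 + e)` with respect to `log r`. -/
theorem hardyForm_le_of_plateau {b e t : ℝ} (hf : 1 ≤ e - 2 * b) (he : 0 ≤ e) (ht0 : 0 ≤ t)
    (ht1 : t ≤ 1) :
    (1 - (1 + e) * t) ^ 2 + 2 * b * (1 - (1 + e) * t) - e * (e - 2 * b) ≤ -(t * (1 - t)) := by
  have h1 : (1 - (1 + e) * t) ^ 2 + 2 * b * (1 - (1 + e) * t) - e * (e - 2 * b)
      = -((1 + e) * (1 - t) * ((e - 2 * b) - 1 + (1 + e) * t)) := by ring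
  rw [h1, neg_le_neg_iff]
  have h2 : t ≤ (e - 2 * b) - 1 + (1 + e) * t := by nlinarith
  have h3 : 1 - t ≤ (1 + e) * (1 - t) := by nlinarith
  calc t * (1 - t) = (1 - t) * t := mul_comm _ _
    _ ≤ _ := mul_le_mul h3 h2 ht0 (by nlinarith)

/-- The quadratic form in the transition regions of the cutoff, whose value is `T` and whose
derivative with respect to `log r` is `y`. -/
theorem hardyForm_le_of_cutoff {b e t T y Y : ℝ} (hb0 : 0 ≤ b) (hb1 : b ≤ 1)
    (hf : 1 ≤ e - 2 * b) (he : 0 ≤ e) (ht0 : 0 ≤ t) (ht1 : t ≤ 1) (hT0 : 0 ≤ T) (hT1 : T ≤ 1)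
    (hy : |y| ≤ Y) :
    ((1 - (1 + e) * t) * T + y) ^ 2 + 2 * b * T * ((1 - (1 + e) * t) * T + y)
      - e * (e - 2 * b) * T ^ 2 ≤ 3 * (1 + e + Y) ^ 2 := by
  have hY : 0 ≤ Y := (abs_nonneg _).trans hy
  have hx : |1 - (1 + e) * t| ≤ 1 + e := by rw [abs_le]; constructor <;> nlinarith
  set z := (1 - (1 + e) * t) * T + y with hz
  have hzb : |z| ≤ 1 + e + Y := by
    refine (abs_add_le _ _).trans (add_le_add ?_ hy)
    rw [abs_mul, abs_of_nonneg hT0]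
    calc |1 - (1 + e) * t| * T ≤ (1 + e) * 1 := mul_le_mul hx hT1 hT0 (by linarith)
      _ = 1 + e := mul_one _
  have h1 : z ^ 2 ≤ (1 + e + Y) ^ 2 := sq_le_sq' (abs_le.1 hzb).1 (abs_le.1 hzb).2
  have h2 : b * T * z ≤ (1 + e + Y) ^ 2 := by
    have h3 : b * T ≤ 1 := mul_le_one₀ hb1 hT0 hT1
    have h4 : 0 ≤ b * T := mul_nonneg hb0 hT0
    calc b * T * z ≤ b * T * |z| := mul_le_mul_of_nonneg_left (le_abs_self _) h4
      _ ≤ 1 * |z| := mul_le_mul_of_nonneg_right h3 (abs_nonneg _)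
      _ ≤ (1 + e + Y) ^ 2 := by nlinarith
  have h5 : 0 ≤ e * (e - 2 * b) * T ^ 2 := by
    have : 0 ≤ e - 2 * b := by linarith
    positivity
  linarith

namespace IsRadialSolution

set_option maxHeartbeats 1000000 in
/-- The weighted Hardy inequality is tested with `r / (ρ + r) ^ (1 + α)`, cut off near the threshold
of the profile and near the boundary. This function interpolates between `r`, which lies on the
good side of the positive root because `n ≥ 2k`, and `r ^ (-α)`; the form is negative on both sides,
and strictly so at the scale `ρ`. -/
theorem exists_energy_decay {n k : ℕ} (hk : 1 ≤ k) (h2k : 2 * k ≤ n) :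
    ∃ K : ℝ, 0 ≤ K ∧ ∀ g v q : ℝ → ℝ, IsRadialSolution n k g v q → (∀ t, 0 ≤ g t) →
      LocallyLipschitz g → IntegrableOn (fun r => r ^ (n + 1) * (q r / r) ^ (k + 1)) (Ioo 0 1) →
      ∀ ρ, 0 < ρ → ρ ≤ 1 / 4 → 0 < q ρ →
        ∫ r in ρ..(2 * ρ), r ^ (n + 1) * (q r / r) ^ (k + 1)
          ≤ K * (ρ ^ (1 + hardyExponent n k)) ^ 2
            * ∫ r in (1 / 2 : ℝ)..(3 / 4), r ^ (n + 1) * (q r / r) ^ (k + 1) := by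
  obtain ⟨K, hK0, hcut⟩ := exists_cutoff
  set e := hardyExponent n k with hedef
  set b : ℝ := ((k : ℝ) - 1) / (k + 1) with hbdef
  have hk1 : (1 : ℝ) ≤ k := by exact_mod_cast hk
  have hb0 : 0 ≤ b := div_nonneg (by linarith) (by positivity)
  have hb1 : b ≤ 1 := by rw [hbdef, div_le_one (by positivity)]; linarith
  have hf : 1 ≤ e - 2 * b := one_le_hardyExponent_sub h2k
  have he : 0 ≤ e := by linarith
  have hcc : e * (e - 2 * b) = (2 * n - k - 1) / (k + 1) := hardyExponent_mul hk h2k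
  set K₁ : ℝ := 3 * (1 + e + K) ^ 2 with hK₁
  set c₁ : ℝ := 2 / 9 * ((3 : ℝ) ^ (-(1 + e))) ^ 2 with hc₁
  have hc₁0 : 0 < c₁ := by positivity
  have hK₁0 : 0 < K₁ := by positivity
  set K₂ : ℝ := K₁ * ((1 / 2 : ℝ) ^ (-(1 + e))) ^ 2 with hK₂
  refine ⟨K₂ / c₁, by positivity, fun g v q S hg0 hg hm ρ hρ0 hρ4 hqρ => ?_⟩
  have hρI : ρ ∈ Ioo (0 : ℝ) 1 := ⟨hρ0, by linarith⟩
  obtain ⟨a, ha0, haρ, hpos, hqa⟩ := S.exists_threshold hk hg0 hρI hqρ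
  set M : ℝ → ℝ := fun r => r ^ (n + 1) * (q r / r) ^ (k + 1) with hM
  have hM0 : ∀ r ∈ Ioo (0 : ℝ) 1, 0 ≤ M r := fun r hr => by
    have := S.ratio_nonneg hr
    have := hr.1
    positivity
  have hMc : ContinuousOn M (Ioo 0 1) := S.continuousOn_energy
  set R : ℝ := ρ ^ (-(1 + e)) with hR
  have hR0 : 0 < R := Real.rpow_pos_of_pos hρ0 _
  set ψ : ℝ → ℝ := fun r => (ρ + r) ^ (-(1 + e)) with hψ
  have hψanti : ∀ x y : ℝ, 0 < x → x ≤ y → y ^ (-(1 + e)) ≤ x ^ (-(1 + e)) := fun x y hx hxy =>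
    Real.rpow_le_rpow_of_nonpos hx hxy (by linarith)
  have hψpos : ∀ r, 0 < r → 0 < ψ r := fun r hr => Real.rpow_pos_of_pos (by linarith) _
  have hψd : ∀ r, 0 < r → HasDerivAt ψ (-(1 + e) * (ψ r / (ρ + r))) r := fun r hr => by
    have h1 : ρ + r ≠ 0 := by positivity
    have h2 : HasDerivAt ψ (1 * -(1 + e) * (ρ + r) ^ (-(1 + e) - 1)) r :=
      ((hasDerivAt_id r).const_add ρ).rpow_const (Or.inl h1)
    rwa [one_mul, Real.rpow_sub_one h1] at h2
  have hψC : ContDiffOn ℝ 1 ψ (Ioi 0) := by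
    refine ContDiffOn.rpow_const_of_ne (by fun_prop) fun r hr => ?_
    have : 0 < r := hr
    positivity
  have key : ∀ δ : ℝ, 0 < δ → c₁ * R ^ 2 * ∫ r in ρ..(2 * ρ), M r
      ≤ K₂ * (∫ r in (1 / 2 : ℝ)..(3 / 4), M r) + K₁ * R ^ 2 * δ := by
    intro δ hδ
    obtain ⟨ε, hε, haε, hcollar⟩ := S.exists_small_collar hk (by omega) hg hm ha0 haρ hρI.2 hqa hδ
    obtain ⟨τ, hτC, hτ01, hτz, hτ1, hτ2, hτ3⟩ := hcut a ε hε (by linarith)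
    set η : ℝ → ℝ := fun r => τ r * (r * ψ r) with hη
    have hτs : tsupport τ ⊆ Ioi 0 := by
      have h1 : tsupport τ ⊆ Icc (a + ε) (3 / 4) :=
        closure_minimal (fun r hr => by_contra fun h => hr (hτz r h)) isClosed_Icc
      exact h1.trans fun r hr => lt_of_lt_of_le (by linarith : (0 : ℝ) < a + ε) hr.1
    have hηC : ContDiff ℝ 1 η := contDiff_mul_of_tsupport_subset isOpen_Ioi hτC.contDiffOn hτs
      (contDiff_id.contDiffOn.mul hψC)
    have hηd : ∀ r, 0 < r → r * deriv η r
        = r * ψ r * ((1 - (1 + e) * (r / (ρ + r))) * τ r + r * deriv τ r) := fun r hr => by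
      have h1 : HasDerivAt η _ r := ((hτC.differentiable one_ne_zero r).hasDerivAt).mul
        ((hasDerivAt_id r).mul (hψd r hr))
      rw [h1.deriv]
      simp only [id]
      have : ρ + r ≠ 0 := by positivity
      field_simp
      ring
    have h0 := S.weighted_hardy hk (by omega) hg (α := a + ε) (β := 3 / 4) (by linarith)
      (by linarith) (by norm_num) (fun r hr => hpos r ⟨by linarith [hr.1], by linarith [hr.2]⟩) hηC
      (fun r hr => by simp only [hη, hτz r hr, zero_mul])
    set J : ℝ → ℝ := fun r => (q r / r) ^ (k + 1) * (r ^ (n + 1) * deriv η r ^ 2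
      + 2 * b * r ^ n * η r * deriv η r
      - (2 * n - k - 1) / (k + 1) * r ^ (n - 1) * η r ^ 2) with hJ
    have hJQ : ∀ r, 0 < r → J r = M r * ψ r ^ 2 *
        (((1 - (1 + e) * (r / (ρ + r))) * τ r + r * deriv τ r) ^ 2
          + 2 * b * τ r * ((1 - (1 + e) * (r / (ρ + r))) * τ r + r * deriv τ r)
          - e * (e - 2 * b) * τ r ^ 2) := by
      intro r hr
      have h1 : r ^ n = r ^ (n - 1) * r := by rw [← pow_succ]; congr 1; omega
      have h2 : J r = (q r / r) ^ (k + 1) * r ^ (n - 1) * ((r * deriv η r) ^ 2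
          + 2 * b * η r * (r * deriv η r) - e * (e - 2 * b) * η r ^ 2) := by
        simp only [hJ]
        rw [hcc, pow_succ r n, h1]
        ring
      rw [h2, hηd r hr]
      simp only [hM, hη]
      rw [pow_succ r n, h1]
      ring
    have ht : ∀ r, 0 < r → 0 ≤ r / (ρ + r) ∧ r / (ρ + r) ≤ 1 := fun r hr =>
      ⟨by positivity, by rw [div_le_one (by positivity)]; linarith⟩
    have hMψ : ∀ r ∈ Ioo (0 : ℝ) 1, 0 ≤ M r * ψ r ^ 2 := fun r hr =>
      mul_nonneg (hM0 r hr) (sq_nonneg _)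
    -- The form is nonpositive wherever the cutoff equals `1`.
    have hplateau : ∀ r ∈ Ioo (a + 2 * ε) (1 / 2),
        J r ≤ -(M r * ψ r ^ 2 * (r / (ρ + r) * (1 - r / (ρ + r)))) := by
      intro r hr
      have hr0 : 0 < r := by linarith [hr.1]
      rw [hJQ r hr0, (hτ2 r hr).1, (hτ2 r hr).2, ← mul_neg]
      refine mul_le_mul_of_nonneg_left ?_ (hMψ r ⟨hr0, by linarith [hr.2]⟩)
      have h1 := hardyForm_le_of_plateau hf he (ht r hr0).1 (ht r hr0).2
      simpa using h1
    have hplateau0 : ∀ r ∈ Ioo (a + 2 * ε) (1 / 2), J r ≤ 0 := by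
      intro r hr
      have hr0 : 0 < r := by linarith [hr.1]
      refine (hplateau r hr).trans (neg_nonpos.2 ?_)
      exact mul_nonneg (hMψ r ⟨hr0, by linarith [hr.2]⟩)
        (mul_nonneg (ht r hr0).1 (by linarith [(ht r hr0).2]))
    have hcutoff : ∀ r ∈ Ioo (0 : ℝ) 1, ∀ Y P, |r * deriv τ r| ≤ Y → ψ r ≤ P →
        J r ≤ M r * P ^ 2 * (3 * (1 + e + Y) ^ 2) := by
      intro r hr Y P hY hP
      rw [hJQ r hr.1]
      have h1 := hardyForm_le_of_cutoff hb0 hb1 hf he (ht r hr.1).1 (ht r hr.1).2 (hτ01 r).1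
        (hτ01 r).2 hY
      have h2 : M r * ψ r ^ 2 ≤ M r * P ^ 2 :=
        mul_le_mul_of_nonneg_left (pow_le_pow_left₀ (hψpos r hr.1).le hP 2) (hM0 r hr)
      exact (mul_le_mul_of_nonneg_left h1 (hMψ r hr)).trans
        (mul_le_mul_of_nonneg_right h2 (by positivity))
    have hunit : ∀ x y : ℝ, a + ε ≤ x → x ≤ y → y ≤ 3 / 4 → uIcc x y ⊆ Ioo 0 1 :=
      fun x y h1 h2 h3 => uIcc_subset_unit ⟨by linarith, by linarith⟩ ⟨by linarith, by linarith⟩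
    have iM : ∀ x y : ℝ, a + ε ≤ x → x ≤ y → y ≤ 3 / 4 → IntervalIntegrable M volume x y :=
      fun x y h1 h2 h3 => (hMc.mono (hunit x y h1 h2 h3)).intervalIntegrable
    have hJc : ContinuousOn J (Ioo 0 1) := by
      have h1 : Continuous (deriv η) := hηC.continuous_deriv le_rfl
      have h2 : Continuous η := hηC.continuous
      refine ContinuousOn.mul ((S.continuousOn.div continuousOn_id fun _ hr => hr.1.ne').pow _) ?_
      fun_prop
    have iJ : ∀ x y : ℝ, a + ε ≤ x → x ≤ y → y ≤ 3 / 4 → IntervalIntegrable J volume x y :=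
      fun x y h1 h2 h3 => (hJc.mono (hunit x y h1 h2 h3)).intervalIntegrable
    have a1 := intervalIntegral.integral_add_adjacent_intervals
      (iJ (a + ε) (a + 2 * ε) (by linarith) (by linarith) (by linarith))
      (iJ (a + 2 * ε) (3 / 4) (by linarith) (by linarith) (by linarith))
    have a2 := intervalIntegral.integral_add_adjacent_intervals
      (iJ (a + 2 * ε) ρ (by linarith) (by linarith) (by linarith))
      (iJ ρ (3 / 4) (by linarith) (by linarith) (by linarith))
    have a3 := intervalIntegral.integral_add_adjacent_intervals
      (iJ ρ (2 * ρ) (by linarith) (by linarith) (by linarith))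
      (iJ (2 * ρ) (3 / 4) (by linarith) (by linarith) (by linarith))
    have a4 := intervalIntegral.integral_add_adjacent_intervals
      (iJ (2 * ρ) (1 / 2) (by linarith) (by linarith) (by linarith))
      (iJ (1 / 2) (3 / 4) (by linarith) (by linarith) (by linarith))
    have b1 : ∫ r in (a + ε)..(a + 2 * ε), J r ≤ K₁ * R ^ 2 * δ := by
      refine le_trans ?_ (mul_le_mul_of_nonneg_left hcollar (by positivity))
      rw [← intervalIntegral.integral_const_mul]
      refine intervalIntegral.integral_mono_on_of_le_Ioo (by linarith)
        (iJ _ _ (by linarith) (by linarith) (by linarith)) ?_ fun r hr => ?_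
      · refine ContinuousOn.intervalIntegrable (continuousOn_const.mul
          ((hMc.mono (hunit _ _ (by linarith) (by linarith) (by linarith))).mul (by fun_prop)))
      · have hr0 : 0 < r := by linarith [hr.1]
        have hr1 : r ∈ Ioo (0 : ℝ) 1 := ⟨hr0, by linarith [hr.2]⟩
        have h1 : |r * deriv τ r| ≤ K * (r / ε) := by
          rw [abs_mul, abs_of_pos hr0]
          calc r * |deriv τ r| ≤ r * (K / ε) := mul_le_mul_of_nonneg_left (hτ1 r hr) hr0.le
            _ = K * (r / ε) := by ring
        refine (hcutoff r hr1 _ R h1 (hψanti _ _ hρ0 (by linarith))).trans ?_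
        have h2 : (1 + e + K * (r / ε)) ^ 2 ≤ ((1 + e + K) * (1 + r / ε)) ^ 2 := by
          have h3 : 0 ≤ r / ε := by positivity
          refine pow_le_pow_left₀ (by positivity) ?_ 2
          have h5 : (1 + e + K) * (1 + r / ε) = 1 + e + K * (r / ε) + (K + (1 + e) * (r / ε)) := by
            ring
          rw [h5]
          exact le_add_of_nonneg_right (by positivity)
        have h4 := mul_le_mul_of_nonneg_left h2
          (mul_nonneg (mul_nonneg (hM0 r hr1) (sq_nonneg R)) (by norm_num : (0 : ℝ) ≤ 3))
        refine le_of_eq_of_le ?_ (h4.trans_eq ?_)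
        · ring
        · rw [hK₁]; ring
    have b2 : ∫ r in (a + 2 * ε)..ρ, J r ≤ 0 := by
      have := intervalIntegral.integral_mono_on_of_le_Ioo (by linarith)
        (iJ (a + 2 * ε) ρ (by linarith) (by linarith) (by linarith))
        (intervalIntegrable_const (c := (0 : ℝ)))
        fun r hr => hplateau0 r ⟨hr.1, by linarith [hr.2]⟩
      simpa using this
    have b4 : ∫ r in (2 * ρ)..(1 / 2), J r ≤ 0 := by
      have := intervalIntegral.integral_mono_on_of_le_Ioo (by linarith)
        (iJ (2 * ρ) (1 / 2) (by linarith) (by linarith) (by linarith))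
        (intervalIntegrable_const (c := (0 : ℝ)))
        fun r hr => hplateau0 r ⟨by linarith [hr.1], hr.2⟩
      simpa using this
    have b3 : ∫ r in ρ..(2 * ρ), J r ≤ -(c₁ * R ^ 2) * ∫ r in ρ..(2 * ρ), M r := by
      rw [← intervalIntegral.integral_const_mul]
      refine intervalIntegral.integral_mono_on_of_le_Ioo (by linarith)
        (iJ _ _ (by linarith) (by linarith) (by linarith))
        ((iM _ _ (by linarith) (by linarith) (by linarith)).const_mul _) fun r hr => ?_
      have hr0 : 0 < r := by linarith [hr.1]
      have hr1 : r ∈ Ioo (0 : ℝ) 1 := ⟨hr0, by linarith [hr.2]⟩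
      refine (hplateau r ⟨by linarith [hr.1], by linarith [hr.2]⟩).trans ?_
      rw [neg_mul, neg_le_neg_iff]
      have h1 : 2 / 9 ≤ r / (ρ + r) * (1 - r / (ρ + r)) := by
        have h2 : 1 / 2 ≤ r / (ρ + r) := by rw [le_div_iff₀ (by positivity)]; linarith [hr.1]
        have h3 : r / (ρ + r) ≤ 2 / 3 := by rw [div_le_iff₀ (by positivity)]; linarith [hr.2]
        nlinarith
      have h4 : (3 : ℝ) ^ (-(1 + e)) * R ≤ ψ r := by
        rw [hR, ← Real.mul_rpow (by norm_num) hρ0.le]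
        exact hψanti _ _ (by positivity) (by linarith [hr.2])
      have h5 : ((3 : ℝ) ^ (-(1 + e)) * R) ^ 2 ≤ ψ r ^ 2 := pow_le_pow_left₀ (by positivity) h4 2
      calc c₁ * R ^ 2 * M r = M r * ((3 : ℝ) ^ (-(1 + e)) * R) ^ 2 * (2 / 9) := by
            rw [hc₁]; ring
        _ ≤ M r * ψ r ^ 2 * (r / (ρ + r) * (1 - r / (ρ + r))) :=
            mul_le_mul (mul_le_mul_of_nonneg_left h5 (hM0 r hr1)) h1 (by norm_num) (hMψ r hr1)
    have b5 : ∫ r in (1 / 2 : ℝ)..(3 / 4), J r ≤ K₂ * ∫ r in (1 / 2 : ℝ)..(3 / 4), M r := by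
      rw [← intervalIntegral.integral_const_mul]
      refine intervalIntegral.integral_mono_on_of_le_Ioo (by norm_num)
        (iJ _ _ (by linarith) (by norm_num) le_rfl)
        ((iM _ _ (by linarith) (by norm_num) le_rfl).const_mul _) fun r hr => ?_
      have hr0 : 0 < r := by linarith [hr.1]
      have hr1 : r ∈ Ioo (0 : ℝ) 1 := ⟨hr0, by linarith [hr.2]⟩
      have h1 : |r * deriv τ r| ≤ K := by
        rw [abs_mul, abs_of_pos hr0]
        calc r * |deriv τ r| ≤ 1 * K := mul_le_mul hr1.2.le (hτ3 r hr) (abs_nonneg _) one_pos.le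
          _ = K := one_mul K
      refine (hcutoff r hr1 _ _ h1
        (hψanti (1 / 2) _ (by norm_num) (by linarith [hr.1]))).trans_eq ?_
      rw [hK₂, hK₁]
      ring
    linarith
  have hfin : c₁ * R ^ 2 * ∫ r in ρ..(2 * ρ), M r ≤ K₂ * ∫ r in (1 / 2 : ℝ)..(3 / 4), M r := by
    refine le_of_forall_pos_le_add fun δ hδ => ?_
    have h1 := key (δ / (K₁ * R ^ 2)) (by positivity)
    rwa [mul_div_cancel₀ _ (by positivity : K₁ * R ^ 2 ≠ 0)] at h1
  have hRinv : R = (ρ ^ (1 + e))⁻¹ := Real.rpow_neg hρ0.le _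
  have hρe : 0 < ρ ^ (1 + e) := Real.rpow_pos_of_pos hρ0 _
  rw [hRinv, inv_pow] at hfin
  calc ∫ r in ρ..(2 * ρ), M r
      = (c₁ * ((ρ ^ (1 + e)) ^ 2)⁻¹ * ∫ r in ρ..(2 * ρ), M r) * ((ρ ^ (1 + e)) ^ 2 / c₁) := by
        field_simp
    _ ≤ (K₂ * ∫ r in (1 / 2 : ℝ)..(3 / 4), M r) * ((ρ ^ (1 + e)) ^ 2 / c₁) :=
        mul_le_mul_of_nonneg_right hfin (by positivity)
    _ = K₂ / c₁ * (ρ ^ (1 + e)) ^ 2 * ∫ r in (1 / 2 : ℝ)..(3 / 4), M r := by ring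

end IsRadialSolution

/-! ### Pointwise bounds for the derivative of the profile -/

theorem delta_eq (n k : ℕ) :
    delta n k = (2 * hardyExponent n k + 2 + 2 * k - n) / (k + 1) := by
  have h4 : (k : ℝ) + 1 ≠ 0 := by positivity
  rw [delta, hardyExponent]
  field_simp
  ring

/-- The sign of `δ_{n,k}` is read off from
`(k + 1) ^ 2 * δ_{n,k} = -(s - (2k + 4)) (s + 2k) / 2`, where `s ^ 2 = 2(k + 1)n - 4k`. -/
theorem delta_mul_eq {n k : ℕ} (hk : 1 ≤ k) (h2k : 2 * k ≤ n) :
    ((k : ℝ) + 1) ^ 2 * delta n k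
      = -((√(2 * ((k : ℝ) + 1) * n - 4 * k) - (2 * k + 4))
        * (√(2 * ((k : ℝ) + 1) * n - 4 * k) + 2 * k)) / 2 := by
  have h1 : (1 : ℝ) ≤ k := by exact_mod_cast hk
  have h2 : (2 : ℝ) * k ≤ n := by exact_mod_cast h2k
  have h3 := Real.sq_sqrt (show 0 ≤ 2 * ((k : ℝ) + 1) * n - 4 * k by nlinarith)
  rw [delta, mul_div_cancel₀ _ (by positivity)]
  set s := √(2 * ((k : ℝ) + 1) * n - 4 * k)
  linear_combination (1 / 2) * h3

theorem delta_pos {n k : ℕ} (hk : 1 ≤ k) (h2k : 2 * k ≤ n) (hn : n < 2 * k + 8) :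
    0 < delta n k := by
  have h1 : (1 : ℝ) ≤ k := by exact_mod_cast hk
  have h2 : (n : ℝ) < 2 * k + 8 := by exact_mod_cast hn
  have h3 := delta_mul_eq hk h2k
  have h4 : √(2 * ((k : ℝ) + 1) * n - 4 * k) < 2 * k + 4 := by
    rw [Real.sqrt_lt' (by positivity)]
    nlinarith
  have h5 := Real.sqrt_nonneg (2 * ((k : ℝ) + 1) * n - 4 * k)
  have h6 : 0 < ((k : ℝ) + 1) ^ 2 * delta n k := by
    rw [h3]
    have := mul_pos (sub_pos.2 h4) (show 0 < √(2 * ((k : ℝ) + 1) * n - 4 * k) + 2 * k by positivity)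
    linarith
  exact pos_of_mul_pos_right h6 (by positivity)

theorem delta_eq_zero {n k : ℕ} (hk : 1 ≤ k) (hn : n = 2 * k + 8) : delta n k = 0 := by
  have h2 : (n : ℝ) = 2 * k + 8 := by exact_mod_cast hn
  have h3 := delta_mul_eq hk (by omega : 2 * k ≤ n)
  have h4 : √(2 * ((k : ℝ) + 1) * n - 4 * k) = 2 * k + 4 := by
    rw [Real.sqrt_eq_iff_mul_self_eq (by rw [h2]; ring_nf; positivity) (by positivity), h2]
    ring
  rw [h4, sub_self, zero_mul, neg_zero, zero_div] at h3
  exact (mul_eq_zero.1 h3).resolve_left (by positivity)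

theorem delta_neg {n k : ℕ} (hk : 1 ≤ k) (hn : 2 * k + 8 < n) : delta n k < 0 := by
  have h1 : (1 : ℝ) ≤ k := by exact_mod_cast hk
  have h2 : 2 * (k : ℝ) + 8 < n := by exact_mod_cast hn
  have h3 := delta_mul_eq hk (by omega : 2 * k ≤ n)
  have h4 : 2 * (k : ℝ) + 4 < √(2 * ((k : ℝ) + 1) * n - 4 * k) := by
    apply Real.lt_sqrt_of_sq_lt
    nlinarith
  have h6 : ((k : ℝ) + 1) ^ 2 * delta n k < 0 := by
    rw [h3]
    have := mul_pos (sub_pos.2 h4) (show 0 < √(2 * ((k : ℝ) + 1) * n - 4 * k) + 2 * k by positivity)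
    linarith
  exact neg_of_mul_neg_right h6 (by positivity)

namespace IsRadialSolution

variable {n k : ℕ} {g v q : ℝ → ℝ}

theorem ratio_le (S : IsRadialSolution n k g v q) (hk : 1 ≤ k) (hg0 : ∀ t, 0 ≤ g t) {ρ r : ℝ}
    (hρ : ρ ∈ Ioo (0 : ℝ) 1) (hr : r ∈ Ioo (0 : ℝ) 1) (hρr : ρ ≤ r) :
    q ρ / ρ ≤ (r / ρ) ^ n * (q r / r) := by
  have h1 : ρ ^ n * (q ρ / ρ) ^ k ≤ r ^ n * (q r / r) ^ k := S.flux_mono hg0 hρ hr hρr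
  have h2 := S.ratio_nonneg hρ
  have h3 := S.ratio_nonneg hr
  have hρ0 := hρ.1
  have h4 : 1 ≤ (r / ρ) ^ n := one_le_pow₀ (by rwa [one_le_div hρ0])
  refine le_of_pow_le_pow_left₀ (by omega : k ≠ 0) (by positivity) ?_
  calc (q ρ / ρ) ^ k ≤ (r / ρ) ^ n * (q r / r) ^ k := by
        rw [div_pow r ρ n, div_mul_eq_mul_div, le_div_iff₀ (by positivity)]
        linarith
    _ ≤ ((r / ρ) ^ n) ^ k * (q r / r) ^ k :=
        mul_le_mul_of_nonneg_right (le_self_pow₀ h4 (by omega)) (by positivity)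
    _ = _ := (mul_pow _ _ _).symm

/-- A bound below for the energy on `[x, y]` in terms of `q / r` at a comparable smaller radius. -/
theorem ratio_pow_le_energy (S : IsRadialSolution n k g v q) (hk : 1 ≤ k) (hg0 : ∀ t, 0 ≤ g t)
    {ρ x y c : ℝ} (hρ : 0 < ρ) (hρx : ρ ≤ x) (hxy : x ≤ y) (hy : y < 1) (hyc : y ≤ c * ρ) :
    (y - x) * (x ^ (n + 1) * (q ρ / ρ) ^ (k + 1))
      ≤ (c ^ n) ^ (k + 1) * ∫ r in x..y, r ^ (n + 1) * (q r / r) ^ (k + 1) := by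
  have hx0 : 0 < x := hρ.trans_le hρx
  have hρI : ρ ∈ Ioo (0 : ℝ) 1 := ⟨hρ, by linarith⟩
  rw [← intervalIntegral.integral_const_mul, ← smul_eq_mul, ← intervalIntegral.integral_const]
  refine intervalIntegral.integral_mono_on hxy intervalIntegrable_const ?_ fun r hr => ?_
  · exact ((S.continuousOn_energy.mono (uIcc_subset_unit ⟨hx0, by linarith⟩
      ⟨by linarith, hy⟩)).intervalIntegrable).const_mul _
  · have hrI : r ∈ Ioo (0 : ℝ) 1 := ⟨by linarith [hr.1], by linarith [hr.2]⟩
    have h2 := S.ratio_nonneg hρI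
    have h3 := S.ratio_nonneg hrI
    have hr0 := hrI.1
    have h1 : q ρ / ρ ≤ c ^ n * (q r / r) := by
      refine (S.ratio_le hk hg0 hρI hrI (hρx.trans hr.1)).trans
        (mul_le_mul_of_nonneg_right (pow_le_pow_left₀ (by positivity) ?_ n) h3)
      rw [div_le_iff₀ hρ]
      exact hr.2.trans hyc
    calc x ^ (n + 1) * (q ρ / ρ) ^ (k + 1) ≤ r ^ (n + 1) * (c ^ n * (q r / r)) ^ (k + 1) :=
          mul_le_mul (pow_le_pow_left₀ hx0.le hr.1 _) (pow_le_pow_left₀ h2 h1 _) (by positivity)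
            (by positivity)
      _ = (c ^ n) ^ (k + 1) * (r ^ (n + 1) * (q r / r) ^ (k + 1)) := by rw [mul_pow]; ring

theorem exists_ratio_bound {n k : ℕ} (hk : 1 ≤ k) :
    ∃ K : ℝ, 0 ≤ K ∧ ∀ g v q : ℝ → ℝ, IsRadialSolution n k g v q → (∀ t, 0 ≤ g t) → ∀ l : ℝ, 0 ≤ l →
      ∫ r in (1 / 2 : ℝ)..(3 / 4), r ^ (n + 1) * (q r / r) ^ (k + 1) ≤ l ^ (k + 1) →
      ∀ ρ ∈ Icc (1 / 4 : ℝ) (1 / 2), q ρ / ρ ≤ K * l := by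
  refine ⟨4 * 2 ^ (n + 1) * 3 ^ n, by positivity, fun g v q S hg0 l hl hE ρ hρ => ?_⟩
  have h1 := S.ratio_pow_le_energy hk hg0 (ρ := ρ) (x := 1 / 2) (y := 3 / 4) (c := 3)
    (by linarith [hρ.1]) hρ.2 (by norm_num) (by norm_num) (by linarith [hρ.1])
  have h2 : (q ρ / ρ) ^ (k + 1) ≤ 4 * 2 ^ (n + 1) * (3 ^ n * l) ^ (k + 1) := by
    have h3 := h1.trans (mul_le_mul_of_nonneg_left hE (by positivity))
    rw [← mul_pow] at h3
    have h4 : (3 / 4 - 1 / 2 : ℝ) * ((1 / 2) ^ (n + 1) * (q ρ / ρ) ^ (k + 1))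
        = (q ρ / ρ) ^ (k + 1) / (4 * 2 ^ (n + 1)) := by
      rw [div_pow, one_pow]; field_simp; norm_num
    rw [h4, div_le_iff₀ (by positivity)] at h3
    linarith
  refine le_of_pow_le_pow_left₀ (by omega : k + 1 ≠ 0) (by positivity) (h2.trans ?_)
  have h5 : (1 : ℝ) ≤ 4 * 2 ^ (n + 1) := by
    have : (1 : ℝ) ≤ 2 ^ (n + 1) := one_le_pow₀ (by norm_num)
    linarith
  calc 4 * 2 ^ (n + 1) * (3 ^ n * l) ^ (k + 1)
      ≤ (4 * 2 ^ (n + 1)) ^ (k + 1) * (3 ^ n * l) ^ (k + 1) :=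
        mul_le_mul_of_nonneg_right (le_self_pow₀ h5 (by omega)) (by positivity)
    _ = (4 * 2 ^ (n + 1) * 3 ^ n * l) ^ (k + 1) := by rw [← mul_pow]; ring

/-- For `n ≥ 2k` the decay of the energy and the monotonicity of the flux give
`q ≤ C r ^ (δ_{n,k} - 1)`. -/
theorem exists_deriv_bound_of_two_mul_le {n k : ℕ} (hk : 1 ≤ k) (h2k : 2 * k ≤ n) :
    ∃ K : ℝ, 0 ≤ K ∧ ∀ g v q : ℝ → ℝ, IsRadialSolution n k g v q → (∀ t, 0 ≤ g t) →
      LocallyLipschitz g → IntegrableOn (fun r => r ^ (n + 1) * (q r / r) ^ (k + 1)) (Ioo 0 1) →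
      ∀ l : ℝ, 0 ≤ l →
      ∫ r in (1 / 2 : ℝ)..(3 / 4), r ^ (n + 1) * (q r / r) ^ (k + 1) ≤ l ^ (k + 1) →
      ∀ ρ ∈ Ioc (0 : ℝ) (1 / 2), q ρ ≤ K * l * ρ ^ (delta n k - 1) := by
  obtain ⟨K₁, hK₁, hbd⟩ := exists_ratio_bound (n := n) hk
  obtain ⟨K₂, hK₂, hdec⟩ := exists_energy_decay hk h2k
  have hB : (0 : ℝ) < (1 / 4) ^ |delta n k - 1| := Real.rpow_pos_of_pos (by norm_num) _
  refine ⟨2 ^ n * (K₂ + 1) + K₁ / (1 / 4) ^ |delta n k - 1|, by positivity,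
    fun g v q S hg0 hg hm l hl hE ρ hρ => ?_⟩
  have hρ0 := hρ.1
  have hρI : ρ ∈ Ioo (0 : ℝ) 1 := ⟨hρ0, by linarith [hρ.2]⟩
  have hP : 0 < ρ ^ (delta n k - 1) := Real.rpow_pos_of_pos hρ0 _
  have hsplit : (2 ^ n * (K₂ + 1) + K₁ / (1 / 4) ^ |delta n k - 1|) * l * ρ ^ (delta n k - 1)
      = 2 ^ n * (K₂ + 1) * l * ρ ^ (delta n k - 1)
        + K₁ * l * (ρ ^ (delta n k - 1) / (1 / 4) ^ |delta n k - 1|) := by ring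
  rw [hsplit]
  have hn1 : 0 ≤ 2 ^ n * (K₂ + 1) * l * ρ ^ (delta n k - 1) := by positivity
  have hn2 : 0 ≤ K₁ * l * (ρ ^ (delta n k - 1) / (1 / 4) ^ |delta n k - 1|) := by positivity
  rcases le_or_gt (1 / 4) ρ with h4 | h4
  · have h1 := hbd g v q S hg0 l hl hE ρ ⟨h4, hρ.2⟩
    have h2 : q ρ ≤ K₁ * l := by
      rw [div_le_iff₀ hρ0] at h1
      exact h1.trans (mul_le_of_le_one_right (by positivity) hρI.2.le)
    have h3 : (1 / 4 : ℝ) ^ |delta n k - 1| ≤ ρ ^ (delta n k - 1) :=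
      (Real.rpow_le_rpow (by norm_num) h4 (abs_nonneg _)).trans
        (Real.rpow_le_rpow_of_exponent_ge hρ0 hρI.2.le (le_abs_self _))
    have h5 : 1 ≤ ρ ^ (delta n k - 1) / (1 / 4) ^ |delta n k - 1| := by rwa [one_le_div hB]
    have h6 := le_mul_of_one_le_right (mul_nonneg hK₁ hl) h5
    linarith
  · suffices h : q ρ ≤ 2 ^ n * (K₂ + 1) * l * ρ ^ (delta n k - 1) by linarith
    rcases (S.nonneg ρ hρI).eq_or_lt with h0 | hqpos
    · rw [← h0]; exact hn1
    have h1 := S.ratio_pow_le_energy hk hg0 (x := ρ) (y := 2 * ρ) (c := 2) hρ0 le_rfl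
      (by linarith) (by linarith) le_rfl
    have h2 := hdec g v q S hg0 hg hm ρ hρ0 h4.le hqpos
    have h3 := h1.trans (mul_le_mul_of_nonneg_left (h2.trans
      (mul_le_mul_of_nonneg_left hE (by positivity))) (by positivity))
    -- Both sides are now compared as powers of `ρ` with real exponents.
    have h5 : (ρ ^ (1 + hardyExponent n k)) ^ 2 * ρ ^ (k + 1)
        = ρ ^ (n + 2) * (ρ ^ (delta n k - 1)) ^ (k + 1) := by
      rw [← Real.rpow_natCast (ρ ^ (1 + hardyExponent n k)), ← Real.rpow_mul hρ0.le,
        ← Real.rpow_natCast (ρ ^ (delta n k - 1)), ← Real.rpow_mul hρ0.le,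
        ← Real.rpow_natCast ρ (k + 1), ← Real.rpow_natCast ρ (n + 2), ← Real.rpow_add hρ0,
        ← Real.rpow_add hρ0, delta_eq]
      congr 1
      push_cast
      have : (k : ℝ) + 1 ≠ 0 := by positivity
      field_simp
      ring
    have h6 : ρ ^ (n + 2) * q ρ ^ (k + 1)
        ≤ ρ ^ (n + 2) * (K₂ * (2 ^ n * l * ρ ^ (delta n k - 1)) ^ (k + 1)) := by
      calc ρ ^ (n + 2) * q ρ ^ (k + 1)
          = (2 * ρ - ρ) * (ρ ^ (n + 1) * (q ρ / ρ) ^ (k + 1)) * ρ ^ (k + 1) := by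
            rw [div_pow]; field_simp; ring
        _ ≤ (2 ^ n) ^ (k + 1) * (K₂ * (ρ ^ (1 + hardyExponent n k)) ^ 2 * l ^ (k + 1))
            * ρ ^ (k + 1) := mul_le_mul_of_nonneg_right h3 (by positivity)
        _ = (2 ^ n) ^ (k + 1) * K₂ * l ^ (k + 1)
            * ((ρ ^ (1 + hardyExponent n k)) ^ 2 * ρ ^ (k + 1)) := by ring
        _ = _ := by rw [h5, mul_pow, mul_pow]; ring
    have h7 := le_of_mul_le_mul_left h6 (by positivity)
    refine le_of_pow_le_pow_left₀ (by omega : k + 1 ≠ 0) (by positivity) (h7.trans ?_)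
    calc K₂ * (2 ^ n * l * ρ ^ (delta n k - 1)) ^ (k + 1)
        ≤ (K₂ + 1) ^ (k + 1) * (2 ^ n * l * ρ ^ (delta n k - 1)) ^ (k + 1) := by
          refine mul_le_mul_of_nonneg_right ?_ (by positivity)
          exact (by linarith : K₂ ≤ K₂ + 1).trans (le_self_pow₀ (by linarith) (by omega))
      _ = _ := by rw [← mul_pow]; congr 1; ring

/-- For `n < 2k` the monotonicity of the flux alone makes `q` integrable at the origin. -/
theorem exists_deriv_bound_of_lt_two_mul {n k : ℕ} (hk : 1 ≤ k) :
    ∃ K : ℝ, 0 ≤ K ∧ ∀ g v q : ℝ → ℝ, IsRadialSolution n k g v q → (∀ t, 0 ≤ g t) →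
      ∀ l : ℝ, 0 ≤ l →
      ∫ r in (1 / 2 : ℝ)..(3 / 4), r ^ (n + 1) * (q r / r) ^ (k + 1) ≤ l ^ (k + 1) →
      ∀ ρ ∈ Ioc (0 : ℝ) (1 / 2), q ρ ≤ K * l * ρ ^ ((2 * k - n : ℝ) / k - 1) := by
  obtain ⟨K₁, hK₁, hbd⟩ := exists_ratio_bound (n := n) hk
  refine ⟨K₁, hK₁, fun g v q S hg0 l hl hE ρ hρ => ?_⟩
  have hρ0 := hρ.1
  have hρI : ρ ∈ Ioo (0 : ℝ) 1 := ⟨hρ0, by linarith [hρ.2]⟩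
  have h1 := hbd g v q S hg0 l hl hE (1 / 2) (by norm_num)
  have h2 : ρ ^ n * (q ρ / ρ) ^ k ≤ (1 / 2) ^ n * (q (1 / 2) / (1 / 2)) ^ k :=
    S.flux_mono hg0 hρI half_mem_unit hρ.2
  have h3 : ρ ^ n * (q ρ / ρ) ^ k ≤ (K₁ * l) ^ k := by
    refine h2.trans ?_
    calc (1 / 2 : ℝ) ^ n * (q (1 / 2) / (1 / 2)) ^ k ≤ 1 * (K₁ * l) ^ k :=
          mul_le_mul (pow_le_one₀ (by norm_num) (by norm_num))
            (pow_le_pow_left₀ (S.ratio_nonneg half_mem_unit) h1 k)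
            (pow_nonneg (S.ratio_nonneg half_mem_unit) _) zero_le_one
      _ = _ := one_mul _
  have hP : 0 < ρ ^ ((2 * k - n : ℝ) / k - 1) := Real.rpow_pos_of_pos hρ0 _
  refine le_of_pow_le_pow_left₀ (by omega : k ≠ 0) (by positivity) ?_
  have hk0 : (k : ℝ) ≠ 0 := by exact_mod_cast (by omega : k ≠ 0)
  have h5 : ρ ^ n * (ρ ^ ((2 * k - n : ℝ) / k - 1)) ^ k = ρ ^ k := by
    rw [← Real.rpow_natCast (ρ ^ ((2 * k - n : ℝ) / k - 1)), ← Real.rpow_mul hρ0.le,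
      ← Real.rpow_natCast ρ n, ← Real.rpow_natCast ρ k, ← Real.rpow_add hρ0]
    congr 1
    field_simp
    ring
  refine le_of_mul_le_mul_left ?_ (pow_pos hρ0 n)
  calc ρ ^ n * q ρ ^ k = ρ ^ n * (q ρ / ρ) ^ k * ρ ^ k := by rw [div_pow]; field_simp
    _ ≤ (K₁ * l) ^ k * ρ ^ k := mul_le_mul_of_nonneg_right h3 (by positivity)
    _ = ρ ^ n * (K₁ * l * ρ ^ ((2 * k - n : ℝ) / k - 1)) ^ k := by rw [mul_pow, ← h5]; ring

end IsRadialSolution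

/-! ### Pointwise bounds for the profile -/

namespace IsRadialSolution

variable {n k : ℕ} {g v q : ℝ → ℝ}

theorem integral_deriv (S : IsRadialSolution n k g v q) {x y : ℝ} (hx : x ∈ Ioo (0 : ℝ) 1)
    (hy : y ∈ Ioo (0 : ℝ) 1) : ∫ r in x..y, q r = v y - v x :=
  intervalIntegral.integral_eq_sub_of_hasDerivAt
    (fun r hr => S.hasDerivAt r (uIcc_subset_unit hx hy hr))
    ((S.continuousOn.mono (uIcc_subset_unit hx hy)).intervalIntegrable)

theorem monotoneOn_profile (S : IsRadialSolution n k g v q) : MonotoneOn v (Ioo 0 1) := by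
  intro x hx y hy hxy
  have h1 := S.integral_deriv hx hy
  have h2 : 0 ≤ ∫ r in x..y, q r := intervalIntegral.integral_nonneg hxy
    fun r hr => S.nonneg r (Icc_subset_unit hx.1 hy.2 hr)
  linarith

/-- On `[1/2, 1)` the profile is controlled by its norm in `W^{1,k+1}(1/2, 1)`. -/
theorem exists_profile_bound_outer (n k : ℕ) :
    ∃ K : ℝ, 0 ≤ K ∧ ∀ g v q : ℝ → ℝ, IsRadialSolution n k g v q → ∀ l : ℝ, 0 < l →
      IntegrableOn (fun r => r ^ (n - 1) * |v r| ^ (k + 1)) (Ioo (1 / 2) 1) →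
      IntegrableOn (fun r => r ^ (n + 1) * (q r / r) ^ (k + 1)) (Ioo (1 / 2) 1) →
      ∫ r in Ioo (1 / 2 : ℝ) 1, r ^ (n - 1) * |v r| ^ (k + 1) ≤ l ^ (k + 1) →
      ∫ r in Ioo (1 / 2 : ℝ) 1, r ^ (n + 1) * (q r / r) ^ (k + 1) ≤ l ^ (k + 1) →
      ∀ r ∈ Ico (1 / 2 : ℝ) 1, |v r| ≤ K * l := by
  refine ⟨2 * 2 ^ (n - 1) + (1 + 2 ^ (n + 1)), by positivity,
    fun g v q S l hl hiv hiM hv hM r hr => ?_⟩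
  have hvol : volume.real (Ioo (1 / 2 : ℝ) 1) = 1 / 2 := by
    rw [Measure.real, Real.volume_Ioo, ENNReal.toReal_ofReal (by norm_num)]; norm_num
  -- The profile at some radius is at most its mean.
  obtain ⟨r₀, hr₀, hle⟩ := exists_le_setAverage (μ := volume) (by simp; norm_num)
    (by simp) hiv
  rw [setAverage_eq, hvol, smul_eq_mul] at hle
  have h1 : |v r₀| ≤ 2 * 2 ^ (n - 1) * l := by
    have h2 : (1 / 2 : ℝ) ^ (n - 1) * |v r₀| ^ (k + 1) ≤ 2 * l ^ (k + 1) := by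
      calc (1 / 2 : ℝ) ^ (n - 1) * |v r₀| ^ (k + 1) ≤ r₀ ^ (n - 1) * |v r₀| ^ (k + 1) :=
            mul_le_mul_of_nonneg_right (pow_le_pow_left₀ (by norm_num) hr₀.1.le _) (by positivity)
        _ ≤ _ := hle
        _ ≤ (1 / 2)⁻¹ * l ^ (k + 1) := mul_le_mul_of_nonneg_left hv (by norm_num)
        _ = 2 * l ^ (k + 1) := by norm_num
    have h3 : |v r₀| ^ (k + 1) ≤ 2 * 2 ^ (n - 1) * l ^ (k + 1) := by
      rw [div_pow, one_pow, div_mul_eq_mul_div, one_mul, div_le_iff₀ (by positivity)] at h2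
      linarith
    refine le_of_pow_le_pow_left₀ (by omega : k + 1 ≠ 0) (by positivity) (h3.trans ?_)
    have h5 : (1 : ℝ) ≤ 2 * 2 ^ (n - 1) := by
      have : (1 : ℝ) ≤ 2 ^ (n - 1) := one_le_pow₀ (by norm_num)
      linarith
    rw [mul_pow _ l]
    exact mul_le_mul_of_nonneg_right (le_self_pow₀ h5 (by omega)) (by positivity)
  set B : ℝ → ℝ := fun r => l + 2 ^ (n + 1) / l ^ k * (r ^ (n + 1) * (q r / r) ^ (k + 1)) with hB
  have hBi : IntegrableOn B (Ioo (1 / 2) 1) :=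
    (integrableOn_const (by simp)).add (hiM.const_mul _)
  have hqB : ∀ s ∈ Ioo (1 / 2 : ℝ) 1, q s ≤ B s := by
    intro s hs
    have hs1 : s ∈ Ioo (0 : ℝ) 1 := ⟨by linarith [hs.1], hs.2⟩
    have hs0 := hs1.1
    have hq0 := S.nonneg s hs1
    have hp0 := S.ratio_nonneg hs1
    have h2 : q s ^ (k + 1) ≤ 2 ^ (n + 1) * (s ^ (n + 1) * (q s / s) ^ (k + 1)) := by
      have h3 : q s ≤ q s / s := by
        rw [le_div_iff₀ hs0]; exact mul_le_of_le_one_right hq0 hs1.2.le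
      have h4 : (1 : ℝ) ≤ 2 ^ (n + 1) * s ^ (n + 1) := by
        rw [← mul_pow]; exact one_le_pow₀ (by linarith [hs.1])
      rw [← mul_assoc]
      exact (pow_le_pow_left₀ hq0 h3 _).trans (le_mul_of_one_le_left (by positivity) h4)
    have h5 : q s ≤ l + q s ^ (k + 1) / l ^ k := by
      rcases le_or_gt (q s) l with h | h
      · have : 0 ≤ q s ^ (k + 1) / l ^ k := by positivity
        linarith
      · have : q s ≤ q s ^ (k + 1) / l ^ k := by
          rw [le_div_iff₀ (by positivity), pow_succ, mul_comm]
          exact mul_le_mul_of_nonneg_right (pow_le_pow_left₀ hl.le h.le k) hq0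
        linarith
    refine h5.trans ?_
    rw [hB, add_le_add_iff_left, div_mul_eq_mul_div]
    exact div_le_div_of_nonneg_right h2 (by positivity)
  have hBint : ∫ s in Ioo (1 / 2 : ℝ) 1, B s ≤ (1 + 2 ^ (n + 1)) * l := by
    have hci : Integrable (fun _ => l) (volume.restrict (Ioo (1 / 2 : ℝ) 1)) :=
      integrableOn_const (by simp)
    rw [hB, integral_add hci (hiM.const_mul _), setIntegral_const, hvol,
      integral_const_mul, smul_eq_mul]
    have h2 : 2 ^ (n + 1) / l ^ k
        * ∫ r in Ioo (1 / 2 : ℝ) 1, r ^ (n + 1) * (q r / r) ^ (k + 1)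
        ≤ 2 ^ (n + 1) / l ^ k * l ^ (k + 1) := mul_le_mul_of_nonneg_left hM (by positivity)
    have h3 : 2 ^ (n + 1) / l ^ k * l ^ (k + 1) = 2 ^ (n + 1) * l := by
      rw [pow_succ l]; field_simp
    linarith
  have hosc : ∀ x y : ℝ, 1 / 2 ≤ x → x ≤ y → y < 1 →
      0 ≤ v y - v x ∧ v y - v x ≤ (1 + 2 ^ (n + 1)) * l := by
    intro x y hx hxy hy
    have hxI : x ∈ Ioo (0 : ℝ) 1 := ⟨by linarith, by linarith⟩
    have hyI : y ∈ Ioo (0 : ℝ) 1 := ⟨by linarith, hy⟩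
    have hsub : Ioo x y ⊆ Ioo (1 / 2 : ℝ) 1 := Ioo_subset_Ioo hx hy.le
    refine ⟨by linarith [S.monotoneOn_profile hxI hyI hxy], ?_⟩
    rw [← S.integral_deriv hxI hyI, intervalIntegral.integral_of_le hxy,
      integral_Ioc_eq_integral_Ioo]
    have hqi : IntegrableOn q (Ioo x y) :=
      ((S.continuousOn.mono (Icc_subset_unit hxI.1 hy)).integrableOn_Icc).mono_set
        Ioo_subset_Icc_self
    refine (setIntegral_mono_on hqi (hBi.mono_set hsub) measurableSet_Ioo
      fun s hs => hqB s (hsub hs)).trans (le_trans ?_ hBint)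
    refine setIntegral_mono_set hBi ?_ hsub.eventuallyLE
    filter_upwards [ae_restrict_mem measurableSet_Ioo] with s hs
    exact (S.nonneg s ⟨by linarith [hs.1], hs.2⟩).trans (hqB s hs)
  have h6 : |v r - v r₀| ≤ (1 + 2 ^ (n + 1)) * l := by
    rcases le_total r r₀ with h | h
    · have := hosc r r₀ hr.1 h hr₀.2
      rw [abs_sub_comm, abs_of_nonneg this.1]; exact this.2
    · have := hosc r₀ r hr₀.1.le h hr.2
      rw [abs_of_nonneg this.1]; exact this.2
  have h7 : |v r| ≤ |v r₀| + |v r - v r₀| := by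
    have := abs_add_le (v r₀) (v r - v r₀)
    rwa [add_sub_cancel] at this
  linarith

theorem abs_profile_le_of_deriv_le (S : IsRadialSolution n k g v q) {B σ : ℝ}
    (hq : ∀ ρ ∈ Ioc (0 : ℝ) (1 / 2), q ρ ≤ B * ρ ^ (σ - 1)) {r : ℝ} (hr : r ∈ Ioc (0 : ℝ) (1 / 2)) :
    |v r| ≤ |v (1 / 2)| + B * ∫ s in r..(1 / 2 : ℝ), s ^ (σ - 1) := by
  have hrI : r ∈ Ioo (0 : ℝ) 1 := ⟨hr.1, by linarith [hr.2]⟩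
  have h1 := S.monotoneOn_profile hrI half_mem_unit hr.2
  have h2 : v (1 / 2) - v r ≤ B * ∫ s in r..(1 / 2 : ℝ), s ^ (σ - 1) := by
    rw [← S.integral_deriv hrI half_mem_unit, ← intervalIntegral.integral_const_mul]
    refine intervalIntegral.integral_mono_on hr.2
      ((S.continuousOn.mono (uIcc_subset_unit hrI half_mem_unit)).intervalIntegrable) ?_
      fun s hs => hq s ⟨hr.1.trans_le hs.1, hs.2⟩
    refine (intervalIntegral.intervalIntegrable_rpow (Or.inr fun h => ?_)).const_mul _
    exact lt_irrefl _ (uIcc_subset_unit hrI half_mem_unit h).1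
  have h3 : |v r| ≤ |v (1 / 2)| + |v r - v (1 / 2)| := by
    have := abs_add_le (v (1 / 2)) (v r - v (1 / 2))
    rwa [add_sub_cancel] at this
  rw [abs_sub_comm, abs_of_nonneg (sub_nonneg.2 h1)] at h3
  linarith

/-- The hypotheses on `l` say that the `W^{1,k+1}` norm of the profile on the annulus
`1/2 < r < 1` is at most `l`, up to a constant. -/
theorem exists_profile_bound {n k : ℕ} (hk : 1 ≤ k) :
    ∃ K : ℝ, 0 ≤ K ∧ ∀ g v q : ℝ → ℝ, IsRadialSolution n k g v q → (∀ t, 0 ≤ g t) →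
      LocallyLipschitz g → IntegrableOn (fun r => r ^ (n - 1) * |v r| ^ (k + 1)) (Ioo 0 1) →
      IntegrableOn (fun r => r ^ (n + 1) * (q r / r) ^ (k + 1)) (Ioo 0 1) → ∀ l : ℝ, 0 < l →
      ∫ r in Ioo (1 / 2 : ℝ) 1, r ^ (n - 1) * |v r| ^ (k + 1) ≤ l ^ (k + 1) →
      ∫ r in Ioo (1 / 2 : ℝ) 1, r ^ (n + 1) * (q r / r) ^ (k + 1) ≤ l ^ (k + 1) →
      ∀ r ∈ Ioo (0 : ℝ) 1, (1 / 2 ≤ r → |v r| ≤ K * l) ∧ (n < 2 * k + 8 → |v r| ≤ K * l) ∧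
        (n = 2 * k + 8 → |v r| ≤ K * l * (|Real.log r| + 1)) ∧
        (2 * k + 8 < n → |v r| ≤ K * l * r ^ delta n k) := by
  obtain ⟨K₁, hK₁, houter⟩ := exists_profile_bound_outer n k
  obtain ⟨σ, K₂, hK₂, hσ1, hσ2, hder⟩ : ∃ σ K : ℝ, 0 ≤ K ∧ (n < 2 * k + 8 → 0 < σ) ∧
      (2 * k + 8 ≤ n → σ = delta n k) ∧ ∀ g v q : ℝ → ℝ, IsRadialSolution n k g v q →
      (∀ t, 0 ≤ g t) → LocallyLipschitz g →
      IntegrableOn (fun r => r ^ (n + 1) * (q r / r) ^ (k + 1)) (Ioo 0 1) → ∀ l : ℝ, 0 ≤ l →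
      ∫ r in (1 / 2 : ℝ)..(3 / 4), r ^ (n + 1) * (q r / r) ^ (k + 1) ≤ l ^ (k + 1) →
      ∀ ρ ∈ Ioc (0 : ℝ) (1 / 2), q ρ ≤ K * l * ρ ^ (σ - 1) := by
    rcases le_or_gt (2 * k) n with h2k | h2k
    · obtain ⟨K, hK, h⟩ := exists_deriv_bound_of_two_mul_le hk h2k
      exact ⟨delta n k, K, hK, fun h8 => delta_pos hk h2k h8, fun _ => rfl, h⟩
    · obtain ⟨K, hK, h⟩ := exists_deriv_bound_of_lt_two_mul (n := n) hk
      refine ⟨(2 * k - n : ℝ) / k, K, hK, fun _ => ?_, fun h8 => by omega,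
        fun g v q S hg0 _ _ => h g v q S hg0⟩
      have h1 : (n : ℝ) < 2 * k := by exact_mod_cast h2k
      have h3 : (0 : ℝ) < k := by exact_mod_cast hk
      exact div_pos (by linarith) h3
  have hσK : 0 ≤ K₂ / |σ| := by positivity
  refine ⟨K₁ + K₂ + K₂ / |σ|, by positivity, fun g v q S hg0 hg hiv hiM l hl hv hM r hr => ?_⟩
  have hsub : Ioo (1 / 2 : ℝ) 1 ⊆ Ioo 0 1 := Ioo_subset_Ioo_left (by norm_num)
  have hout := houter g v q S l hl (hiv.mono_set hsub) (hiM.mono_set hsub) hv hM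
  have hE : ∫ r in (1 / 2 : ℝ)..(3 / 4), r ^ (n + 1) * (q r / r) ^ (k + 1) ≤ l ^ (k + 1) := by
    rw [intervalIntegral.integral_of_le (by norm_num), integral_Ioc_eq_integral_Ioo]
    refine (setIntegral_mono_set (hiM.mono_set hsub) ?_
      (Ioo_subset_Ioo_right (by norm_num : (3 / 4 : ℝ) ≤ 1)).eventuallyLE).trans hM
    filter_upwards [ae_restrict_mem measurableSet_Ioo] with s hs
    have := S.ratio_nonneg (hsub hs)
    have := (hsub hs).1
    positivity
  have hq := hder g v q S hg0 hg hiM l hl.le hE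
  have hl1 : 0 ≤ K₁ * l := by positivity
  have hl2 : 0 ≤ K₂ * l := by positivity
  have hl3 : 0 ≤ K₂ / |σ| * l := by positivity
  have hr0 := hr.1
  rcases lt_or_ge r (1 / 2) with hr2 | hr2
  · have h1 := S.abs_profile_le_of_deriv_le hq ⟨hr.1, hr2.le⟩
    have h2 := hout (1 / 2) (by norm_num)
    have hzero : (0 : ℝ) ∉ uIcc r (1 / 2) := fun h =>
      lt_irrefl _ (uIcc_subset_unit hr half_mem_unit h).1
    refine ⟨fun h => absurd hr2 (not_lt.2 h), fun h8 => ?_, fun h8 => ?_, fun h8 => ?_⟩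
    · have hσ := hσ1 h8
      rw [integral_rpow (Or.inl (by linarith)), sub_add_cancel] at h1
      have h3 : ((1 / 2 : ℝ) ^ σ - r ^ σ) / σ ≤ 1 / |σ| := by
        rw [abs_of_pos hσ]
        refine div_le_div_of_nonneg_right ?_ hσ.le
        have h4 : (1 / 2 : ℝ) ^ σ ≤ 1 := Real.rpow_le_one (by norm_num) (by norm_num) hσ.le
        have h5 := Real.rpow_nonneg hr0.le σ
        linarith
      have h6 := mul_le_mul_of_nonneg_left h3 hl2
      have h7 : K₂ * l * (1 / |σ|) = K₂ / |σ| * l := by ring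
      linarith
    · have hσ : σ = 0 := (hσ2 h8.ge).trans (delta_eq_zero hk h8)
      simp only [hσ, zero_sub, Real.rpow_neg_one] at h1
      rw [integral_inv_of_pos hr0 (by norm_num), Real.log_div (by norm_num) hr0.ne'] at h1
      have h3 : Real.log (1 / 2) ≤ 0 := Real.log_nonpos (by norm_num) (by norm_num)
      have h4 := neg_le_abs (Real.log r)
      have h5 : K₂ * l * (Real.log (1 / 2) - Real.log r) ≤ K₂ * l * |Real.log r| :=
        mul_le_mul_of_nonneg_left (by linarith) hl2
      have h6 := mul_nonneg (add_nonneg hl1 hl3) (abs_nonneg (Real.log r))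
      have h7 : (K₁ + K₂ + K₂ / |σ|) * l * (|Real.log r| + 1)
          = (K₁ * l + K₂ / |σ| * l) * |Real.log r| + K₂ * l * |Real.log r|
            + K₁ * l + K₂ * l + K₂ / |σ| * l := by ring
      linarith
    · have hσd := hσ2 h8.le
      have hσ : σ < 0 := hσd ▸ delta_neg hk h8
      rw [integral_rpow (Or.inr ⟨by linarith, hzero⟩), sub_add_cancel] at h1
      rw [← hσd]
      have h5 : 1 ≤ r ^ σ := Real.one_le_rpow_of_pos_of_le_one_of_nonpos hr0 hr.2.le hσ.le
      have h3 : ((1 / 2 : ℝ) ^ σ - r ^ σ) / σ ≤ r ^ σ / |σ| := by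
        rw [abs_of_neg hσ, ← neg_div_neg_eq ((1 / 2 : ℝ) ^ σ - r ^ σ)]
        refine div_le_div_of_nonneg_right ?_ (by linarith)
        have h4 := Real.rpow_nonneg (by norm_num : (0 : ℝ) ≤ 1 / 2) σ
        linarith
      have h6 := mul_le_mul_of_nonneg_left h3 hl2
      have h7 : (K₁ + K₂ + K₂ / |σ|) * l * r ^ σ
          = K₁ * l * r ^ σ + K₂ * l * r ^ σ + K₂ * l * (r ^ σ / |σ|) := by ring
      have h8 := le_mul_of_one_le_right hl1 h5
      have h9 : 0 ≤ K₂ * l * r ^ σ := by positivity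
      linarith
  · have h1 := hout r ⟨hr2, hr.2⟩
    have h2 : |v r| ≤ (K₁ + K₂ + K₂ / |σ|) * l := by linarith
    have h3 : 0 ≤ (K₁ + K₂ + K₂ / |σ|) * l := by positivity
    refine ⟨fun _ => h2, fun _ => h2, fun _ => h2.trans (le_mul_of_one_le_right h3 ?_),
      fun h8 => h2.trans (le_mul_of_one_le_right h3 ?_)⟩
    · linarith [abs_nonneg (Real.log r)]
    · exact Real.one_le_rpow_of_pos_of_le_one_of_nonpos hr0 hr.2.le (delta_neg hk h8).le

end IsRadialSolution

/-! ### The norm on the annulus and the final estimate -/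

theorem setIntegral_annulus_fun_norm {n : ℕ} [Nontrivial (E n)] (f : ℝ → ℝ) :
    ∫ x in ball (0 : E n) 1 \ closedBall 0 (1 / 2), f ‖x‖
      = sphereArea n * ∫ r in Ioo (1 / 2 : ℝ) 1, r ^ (n - 1) * f r := by
  have h1 : ball (0 : E n) 1 \ closedBall 0 (1 / 2)
      = unitBall n ∩ (fun x => ‖x‖) ⁻¹' Ioi (1 / 2 : ℝ) := by
    ext x; simp
  have h2 : Ioo (1 / 2 : ℝ) 1 = Ioo 0 1 ∩ Ioi (1 / 2) := by
    ext r; simp only [mem_Ioo, mem_inter_iff, mem_Ioi]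
    constructor
    · rintro ⟨h3, h4⟩; exact ⟨⟨by linarith, h4⟩, h3⟩
    · rintro ⟨⟨-, h4⟩, h3⟩; exact ⟨h3, h4⟩
  rw [h1, ← setIntegral_indicator (measurable_norm measurableSet_Ioi), h2,
    ← setIntegral_indicator measurableSet_Ioi]
  have h3 := setIntegral_ball_fun_norm (n := n) ((Ioi (1 / 2 : ℝ)).indicator f)
  have h4 : ∀ r, r ^ (n - 1) * (Ioi (1 / 2 : ℝ)).indicator f r
      = (Ioi (1 / 2 : ℝ)).indicator (fun r => r ^ (n - 1) * f r) r := fun r => by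
    by_cases hr : r ∈ Ioi (1 / 2 : ℝ)
    · rw [indicator_of_mem hr, indicator_of_mem hr]
    · rw [indicator_of_notMem hr, indicator_of_notMem hr, mul_zero]
  simp only [h4] at h3
  rw [← h3]
  rfl

namespace IsRadialJet

variable {n : ℕ} {u : E n → ℝ} {G : E n → E n} {H : E n → Matrix (Fin n) (Fin n) ℝ}
  {v q p' : ℝ → ℝ}

theorem ae_weight_mul_gradient [Nontrivial (E n)] (J : IsRadialJet u G H v q p')
    (hq : ∀ r ∈ Ioo (0 : ℝ) 1, 0 ≤ q r) (k : ℕ) :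
    ∀ᵐ x ∂(volume.restrict (unitBall n)), ‖x‖ ^ (1 - (k : ℝ)) * ‖G x‖ ^ (k + 1)
      = ‖x‖ ^ 2 * (q ‖x‖ / ‖x‖) ^ (k + 1) := by
  have h0 : ∀ᵐ x ∂(volume.restrict (unitBall n)), x ∈ unitBall n \ {0} := by
    rw [← restrict_punctured]; exact ae_restrict_mem (isOpen_punctured n).measurableSet
  filter_upwards [J.ae_gradient, h0] with x h1 h2
  have hx := norm_mem_Ioo h2
  have hx0 := hx.1
  have h3 : G x = (q ‖x‖ / ‖x‖) • x := by
    ext i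
    rw [h1 i, PiLp.smul_apply, smul_eq_mul]
    ring
  have h4 : ‖G x‖ = q ‖x‖ := by
    rw [h3, norm_smul, Real.norm_eq_abs, abs_of_nonneg (div_nonneg (hq _ hx) hx0.le),
      div_mul_cancel₀ _ hx0.ne']
  rw [h4, Real.rpow_sub hx0, Real.rpow_one, Real.rpow_natCast, div_pow]
  field_simp
  ring

theorem integrableOn_pow_profile [Nontrivial (E n)] (J : IsRadialJet u G H v q p') {k : ℕ}
    (hu : MemLp u ((k : ENNReal) + 1) (volume.restrict (unitBall n))) :
    IntegrableOn (fun r => r ^ (n - 1) * |v r| ^ (k + 1)) (Ioo 0 1) := by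
  refine integrableOn_ball_fun_norm.1
    (?_ : IntegrableOn (fun x : E n => |v ‖x‖| ^ (k + 1)) (unitBall n))
  have h1 : MemLp u ((k + 1 : ℕ) : ENNReal) (volume.restrict (unitBall n)) := by
    push_cast; exact hu
  refine (h1.integrable_norm_pow (by omega)).congr ?_
  filter_upwards [J.ae_eq] with x hx
  rw [hx, Real.norm_eq_abs]

theorem pow_mul_energy (hn : 1 ≤ n) (k : ℕ) (r : ℝ) :
    r ^ (n - 1) * (r ^ 2 * (q r / r) ^ (k + 1)) = r ^ (n + 1) * (q r / r) ^ (k + 1) := by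
  rw [← mul_assoc, ← pow_add]
  congr 2
  omega

theorem integrableOn_energy [Nontrivial (E n)] (hn : 1 ≤ n) (J : IsRadialJet u G H v q p')
    (hq : ∀ r ∈ Ioo (0 : ℝ) 1, 0 ≤ q r) {k : ℕ}
    (hG : IntegrableOn (fun x => ‖x‖ ^ (1 - (k : ℝ)) * ‖G x‖ ^ (k + 1)) (unitBall n)) :
    IntegrableOn (fun r => r ^ (n + 1) * (q r / r) ^ (k + 1)) (Ioo 0 1) := by
  simp only [← pow_mul_energy (q := q) hn k]
  refine integrableOn_ball_fun_norm.1
    (?_ : IntegrableOn (fun x : E n => ‖x‖ ^ 2 * (q ‖x‖ / ‖x‖) ^ (k + 1)) (unitBall n))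
  exact hG.congr (J.ae_weight_mul_gradient hq k)

theorem weightedSobolevNorm_annulus [Nontrivial (E n)] (hn : 1 ≤ n)
    (J : IsRadialJet u G H v q p') (hq : ∀ r ∈ Ioo (0 : ℝ) 1, 0 ≤ q r) (k : ℕ) :
    weightedSobolevNorm k (ball 0 1 \ closedBall 0 (1 / 2)) u G
      = (sphereArea n * ((∫ r in Ioo (1 / 2 : ℝ) 1, r ^ (n - 1) * |v r| ^ (k + 1))
        + ∫ r in Ioo (1 / 2 : ℝ) 1, r ^ (n + 1) * (q r / r) ^ (k + 1))) ^ (1 / ((k : ℝ) + 1)) := by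
  have hsub : ball (0 : E n) 1 \ closedBall 0 (1 / 2) ⊆ unitBall n := sdiff_subset
  rw [weightedSobolevNorm, mul_add]
  congr 2
  · rw [← setIntegral_annulus_fun_norm (n := n) (fun r => |v r| ^ (k + 1))]
    refine integral_congr_ae ?_
    filter_upwards [ae_restrict_of_ae_restrict_of_subset hsub J.ae_eq] with x hx
    rw [hx]
  · simp only [← pow_mul_energy (q := q) hn k]
    rw [← setIntegral_annulus_fun_norm (n := n) (fun r => r ^ 2 * (q r / r) ^ (k + 1))]
    refine integral_congr_ae ?_
    filter_upwards [ae_restrict_of_ae_restrict_of_subset hsub (J.ae_weight_mul_gradient hq k)]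
      with x hx
    rw [hx]

end IsRadialJet

theorem le_on_Ioc_of_le_on_Ioo {f h : ℝ → ℝ} (hf : ContinuousOn f (Ioc 0 1))
    (hh : ContinuousOn h (Ioc 0 1)) (hle : ∀ r ∈ Ioo (0 : ℝ) 1, f r ≤ h r) :
    ∀ r ∈ Ioc (0 : ℝ) 1, f r ≤ h r := by
  intro r hr
  rcases hr.2.lt_or_eq with h1 | rfl
  · exact hle r ⟨hr.1, h1⟩
  · have h2 : (nhdsWithin (1 : ℝ) (Ioo 0 1)).NeBot := right_nhdsWithin_Ioo_neBot one_pos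
    have h3 : nhdsWithin (1 : ℝ) (Ioo 0 1) ≤ nhdsWithin 1 (Ioc 0 1) :=
      nhdsWithin_mono _ Ioo_subset_Ioc_self
    exact le_of_tendsto_of_tendsto ((hf 1 hr).mono_left h3) ((hh 1 hr).mono_left h3)
      (Filter.eventually_of_mem self_mem_nhdsWithin hle)

theorem le_mul_of_forall_gt_le_mul {x a b c : ℝ} (h : ∀ l, b < l → x ≤ a * l * c) :
    x ≤ a * b * c := by
  have h1 : Continuous fun l : ℝ => a * l * c := by fun_prop
  exact ge_of_tendsto ((h1.tendsto b).mono_left nhdsWithin_le_nhds)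
    (Filter.eventually_of_mem (self_mem_nhdsWithin (s := Ioi b)) h)

end KHessian

theorem theorem1p7 (n k : ℕ) (hn : 2 ≤ n) (hk : 1 ≤ k) (hkn : k ≤ n) :
    ∃ D : ℝ, ∀ (g : ℝ → ℝ) (u : KHessian.E n → ℝ) (G : KHessian.E n → KHessian.E n)
      (H : KHessian.E n → Matrix (Fin n) (Fin n) ℝ),
      (∀ t, 0 ≤ g t) → LocallyLipschitz g →
      KHessian.IsRadial u →
      KHessian.MemWeightedSobolev k (KHessian.unitBall n) u G →
      KHessian.HasWeakJacobian (KHessian.unitBall n \ {0}) G H →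
      KHessian.IsSolution k g u G H →
      KHessian.IsSemistable k g u H →
      ∃ v : ℝ → ℝ, KHessian.IsRadialProfile u v ∧
        (n < 2 * k + 8 → ∀ r ∈ Set.Ioc (0 : ℝ) 1,
          |v r| ≤ D * KHessian.weightedSobolevNorm k
            (Metric.ball 0 1 \ Metric.closedBall 0 (1 / 2)) u G) ∧
        (n = 2 * k + 8 → ∀ r ∈ Set.Ioc (0 : ℝ) 1,
          |v r| ≤ D * KHessian.weightedSobolevNorm k
            (Metric.ball 0 1 \ Metric.closedBall 0 (1 / 2)) u G * (|Real.log r| + 1)) ∧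
        (2 * k + 8 < n → ∀ r ∈ Set.Ioc (0 : ℝ) 1,
          |v r| ≤ D * KHessian.weightedSobolevNorm k
            (Metric.ball 0 1 \ Metric.closedBall 0 (1 / 2)) u G * r ^ KHessian.delta n k) := by
  have : Nonempty (Fin n) := ⟨⟨0, by omega⟩⟩
  have : Nontrivial (KHessian.E n) := inferInstance
  obtain ⟨K, -, hbound⟩ := KHessian.IsRadialSolution.exists_profile_bound (n := n) hk
  have hc0 := KHessian.sphereArea_pos n
  set c := KHessian.sphereArea n with hcdef
  set s : ℝ := 1 / ((k : ℝ) + 1) with hs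
  have hcs : 0 < c ^ s := Real.rpow_pos_of_pos hc0 _
  refine ⟨K / c ^ s, fun g u G H hg0 hg hu hW hH hsol hstab => ?_⟩
  have hG : KHessian.HasWeakGradient (KHessian.unitBall n \ {0}) u G := fun i =>
    (hW.1 i).mono Set.sdiff_subset
  obtain ⟨v, q, p', J⟩ := KHessian.exists_isRadialJet hu hG hH
  have S : KHessian.IsRadialSolution n k g v q := by
    rcases hsol with hc | hw
    · exact J.isRadialSolution_of_isClassicalSolution hn hk hkn hg.continuous hG hH hc hstab
    · exact J.isRadialSolution_of_isWeakSolution hk hkn hg0 hg hw hstab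
  have hiv := J.integrableOn_pow_profile hW.2.1
  have hiM := J.integrableOn_energy (by omega) S.nonneg hW.2.2
  set A₁ := ∫ r in Set.Ioo (1 / 2 : ℝ) 1, r ^ (n - 1) * |v r| ^ (k + 1) with hA₁
  set A₂ := ∫ r in Set.Ioo (1 / 2 : ℝ) 1, r ^ (n + 1) * (q r / r) ^ (k + 1) with hA₂
  have hA₁0 : 0 ≤ A₁ := MeasureTheory.setIntegral_nonneg measurableSet_Ioo fun r hr => by
    have : 0 < r := by linarith [hr.1]
    positivity
  have hA₂0 : 0 ≤ A₂ := MeasureTheory.setIntegral_nonneg measurableSet_Ioo fun r hr => by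
    have h1 : 0 < r := by linarith [hr.1]
    have := S.ratio_nonneg ⟨h1, hr.2⟩
    positivity
  set L := (A₁ + A₂) ^ s with hL
  have hL0 : 0 ≤ L := Real.rpow_nonneg (by linarith) _
  have hLpow : L ^ (k + 1) = A₁ + A₂ := by
    rw [hL, ← Real.rpow_natCast, ← Real.rpow_mul (by linarith), hs]
    push_cast
    rw [one_div, inv_mul_cancel₀ (by positivity), Real.rpow_one]
  have hN : K / c ^ s * KHessian.weightedSobolevNorm k
      (Metric.ball 0 1 \ Metric.closedBall 0 (1 / 2)) u G = K * L := by
    rw [J.weightedSobolevNorm_annulus (by omega) S.nonneg k, ← hA₁, ← hA₂, ← hs, ← hcdef,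
      Real.mul_rpow hc0.le (by linarith), ← hL, ← mul_assoc, div_mul_cancel₀ _ hcs.ne']
  rw [hN]
  -- `L` may vanish, so the estimates are applied with every `l > L`.
  have hest := fun l (hl : L < l) =>
    have hle := pow_le_pow_left₀ hL0 hl.le (k + 1)
    hbound g v q S hg0 hg hiv hiM l (hL0.trans_lt hl) (by linarith) (by linarith)
  have hbdd : BddAbove (v '' Set.Ioo 0 1) := by
    refine ⟨K * (L + 1), ?_⟩
    rintro _ ⟨r, hr, rfl⟩
    have hm : max r (1 / 2) ∈ Set.Ioo (0 : ℝ) 1 :=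
      ⟨hr.1.trans_le (le_max_left _ _), max_lt hr.2 (by norm_num)⟩
    exact (S.monotoneOn_profile hr hm (le_max_left _ _)).trans
      ((le_abs_self _).trans ((hest (L + 1) (by linarith) _ hm).1 (le_max_right _ _)))
  have hlim := S.monotoneOn_profile.tendsto_nhdsWithin_Ioo_left
    (Set.nonempty_Ioo.2 one_pos) hbdd
  set w : ℝ → ℝ := extendFrom (Set.Ioo 0 1) v with hw
  have hwv : ∀ r ∈ Set.Ioo (0 : ℝ) 1, w r = v r := fun r hr =>
    extendFrom_extends S.continuousOn_profile r hr
  have hwc : ContinuousOn w (Set.Ioc 0 1) :=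
    continuousOn_Ioc_extendFrom_Ioo S.continuousOn_profile hlim
  refine ⟨w, ⟨hwc, ?_⟩, fun h8 => ?_, fun h8 => ?_, fun h8 => ?_⟩
  · have h0 : ∀ᵐ x ∂(MeasureTheory.volume.restrict (KHessian.unitBall n)),
        x ∈ KHessian.unitBall n \ {0} := by
      rw [← KHessian.restrict_punctured]
      exact MeasureTheory.ae_restrict_mem (KHessian.isOpen_punctured n).measurableSet
    filter_upwards [J.ae_eq, h0] with x h1 h2
    rw [h1, hwv _ (KHessian.norm_mem_Ioo h2)]
  · refine KHessian.le_on_Ioc_of_le_on_Ioo hwc.abs continuousOn_const fun r hr => ?_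
    rw [hwv r hr]
    have := KHessian.le_mul_of_forall_gt_le_mul (x := |v r|) (a := K) (b := L) (c := 1)
      fun l hl => by rw [mul_one]; exact (hest l hl r hr).2.1 h8
    rwa [mul_one] at this
  · refine KHessian.le_on_Ioc_of_le_on_Ioo hwc.abs (continuousOn_const.mul
      ((Real.continuousOn_log.mono fun r hr => hr.1.ne').abs.add continuousOn_const)) fun r hr => ?_
    rw [hwv r hr]
    exact KHessian.le_mul_of_forall_gt_le_mul fun l hl => (hest l hl r hr).2.2.1 h8
  · refine KHessian.le_on_Ioc_of_le_on_Ioo hwc.abs (continuousOn_const.mul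
      (continuousOn_id.rpow_const fun r hr => Or.inl hr.1.ne')) fun r hr => ?_
    rw [hwv r hr]
    exact KHessian.le_mul_of_forall_gt_le_mul fun l hl => (hest l hl r hr).2.2.2 h8
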